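/- Write $(u,v)=\sum_k u_kv_k$ for the standard complex bilinear form on $\mathbb{C}^N$. A configuration $\mathcal A=(A,m)$ in $\mathbb{C}^N$ is a finite set $A$ of pairwise non-collinear vectors $\alpha_i\in\mathbb{C}^N$ with $(\alpha_i,\alpha_i)\neq 0$, together with multiplicities $m_i=m(\alpha_i)\in\mathbb{Z}_{\ge 0}$. It admits the Baker-Akhiezer (BA) function if there is a function $\phi(\lambda,x)=P(\lambda,x)e^{(\lambda,x)}$ of $\lambda,x\in\mathbb{C}^N$ such that $P$ is a polynomial in $\lambda$ and $x$ with highest-degree homogeneous part $\prod_{i}(\alpha_i,\lambda)^{m_i}(\alpha_i,x)^{m_i}$, and such that for every $i$ and every $1\le s\le m_i$ the derivative $\partial_{\alpha_i}^{2s-1}\phi(\lambda,x)$, with $\partial_{\alpha_i}=(\alpha_i,\partial/\partial x)$, vanishes for all $\lambda$ and all $x$ with $(\alpha_i,x)=0$. Let $N=2$. Every vector of a configuration in $\mathbb{C}^2$ is a non-zero multiple of a vector $(\cos\varphi_i,\sin\varphi_i)$ with $\varphi_i\in\mathbb{C}$; choose such angles $\varphi_i$. For an integer $q\ge 1$ let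 $T_q(\mathcal A)$ consist of the vectors $$\alpha_{i,s}=(\cos\varphi_{i,s},\sin\varphi_{i,s}),\qquad \varphi_{i,s}=\frac{\varphi_i+\pi s}{q},\qquad s=1,\ldots,q,$$ with multiplicities $m(\alpha_{i,s})=m(\alpha_i)$. Proposition. If a configuration $\mathcal A$ in $\mathbb{C}^2$ admits the BA function, then for every integer $q\ge1$ and every choice of the angles $\varphi_i$, $T_q(\mathcal A)$ is again a configuration (its vectors $\alpha_{i,s}$ are non-isotropic and pairwise non-collinear), and it admits the BA function. -/

import Mathlib

namespace BakerAkhiezer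

/-- A configuration in `ℂ^N`: a finite family of pairwise non-collinear vectors that are
non-isotropic for the standard complex bilinear inner product `(u, v) = ∑ u_k v_k`.
The multiplicities are a separate function `m : ι → ℕ` on the index set. -/
structure IsConfiguration {N : ℕ} {ι : Type*} (α : ι → Fin N → ℂ) : Prop where
  nonisotropic : ∀ i, dotProduct (α i) (α i) ≠ 0
  noncollinear : ∀ i j, i ≠ j → LinearIndependent ℂ ![α i, α j]

/-- The linear form `(a, λ)` as a polynomial in the variables `(λ, x)`. -/
noncomputable def linFormLam {N : ℕ} (a : Fin N → ℂ) : MvPolynomial (Fin N ⊕ Fin N) ℂ :=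
  ∑ k, MvPolynomial.C (a k) * MvPolynomial.X (Sum.inl k)

/-- The linear form `(a, x)` as a polynomial in the variables `(λ, x)`. -/
noncomputable def linFormX {N : ℕ} (a : Fin N → ℂ) : MvPolynomial (Fin N ⊕ Fin N) ℂ :=
  ∑ k, MvPolynomial.C (a k) * MvPolynomial.X (Sum.inr k)

/-- The prescribed highest term `∏ (α_i, λ)^{m_i} (α_i, x)^{m_i}`, homogeneous of degree
`2 ∑ m_i` in `(λ, x)`. -/
noncomputable def highestTerm {N : ℕ} {ι : Type*} [Fintype ι]
    (α : ι → Fin N → ℂ) (m : ι → ℕ) : MvPolynomial (Fin N ⊕ Fin N) ℂ :=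
  ∏ i, linFormLam (α i) ^ m i * linFormX (α i) ^ m i

/-- The iterated directional derivative `(∂_v)^r f` at `x`, as the `r`-th derivative of
`t ↦ f (x + t v)` at `t = 0`. -/
noncomputable def dirDeriv {N : ℕ} (v : Fin N → ℂ) (r : ℕ) (f : (Fin N → ℂ) → ℂ)
    (x : Fin N → ℂ) : ℂ :=
  iteratedDeriv r (fun t : ℂ => f (x + t • v)) 0

/-- `Φ (λ, x)` is the Baker-Akhiezer function of the configuration `(α, m)`. -/
structure IsBAFunction {N : ℕ} {ι : Type*} [Fintype ι] (α : ι → Fin N → ℂ) (m : ι → ℕ)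
    (Φ : (Fin N → ℂ) → (Fin N → ℂ) → ℂ) : Prop where
  /-- `Φ = P e^{(λ, x)}` with `P` a polynomial whose top-degree homogeneous part is
  `highestTerm α m`. -/
  form : ∃ P : MvPolynomial (Fin N ⊕ Fin N) ℂ,
    P.totalDegree ≤ 2 * ∑ i, m i ∧
    MvPolynomial.homogeneousComponent (2 * ∑ i, m i) P = highestTerm α m ∧
    ∀ lam x, Φ lam x = MvPolynomial.eval (Sum.elim lam x) P * Complex.exp (dotProduct lam x)
  /-- The odd normal derivatives of order `2s - 1`, `1 ≤ s ≤ m_i`, vanish on the hyperplane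
  `(α_i, x) = 0`. -/
  vanish : ∀ i, ∀ s : ℕ, 1 ≤ s → s ≤ m i → ∀ lam x, dotProduct (α i) x = 0 →
    dirDeriv (α i) (2 * s - 1) (Φ lam) x = 0

/-- The configuration `(α, m)` admits the Baker-Akhiezer function. -/
def AdmitsBA {N : ℕ} {ι : Type*} [Fintype ι] (α : ι → Fin N → ℂ) (m : ι → ℕ) : Prop :=
  ∃ Φ : (Fin N → ℂ) → (Fin N → ℂ) → ℂ, IsBAFunction α m Φ

/-- The vector `(cos φ, sin φ)` of complex angle `φ`. -/
noncomputable def unitVec (φ : ℂ) : Fin 2 → ℂ := ![Complex.cos φ, Complex.sin φ]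

/-- The vectors of `T_q(A)` for a planar configuration with angles `φ_i`: the vectors of angles
`(φ_i + π s) / q`, where `s = 1, …, q` is represented by `Fin q` shifted by one. -/
noncomputable def Tvec {ι : Type*} (q : ℕ) (φ : ι → ℂ) : ι × Fin q → Fin 2 → ℂ :=
  fun p => unitVec ((φ p.1 + (Real.pi : ℂ) * (((p.2 : ℕ) : ℂ) + 1)) / (q : ℂ))

/-- The multiplicities of `T_q(A)`: each new vector inherits that of the vector it comes from. -/
def Tmult {ι : Type*} (q : ℕ) (m : ι → ℕ) : ι × Fin q → ℕ := fun p => m p.1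

end BakerAkhiezer

/-! In the plane, existence of the BA function amounts to the trigonometric `CotCondition`: for each
i, the sums over j of m_j cot(φ_j - φ_i)^(2s-1) vanish for 1 ≤ s ≤ m_i. Division of the angles by q
preserves this condition (`CotCondition.cover`). Indeed the sum of cot^r over the q angles (ψ +
πs)/q is a polynomial in cot ψ of degree at most r and of the parity of r, so each odd condition for
the new configuration is a linear combination of old odd conditions of no higher order.

Sufficiency (`exists_quasiInv`) is a formula of Berest type. Let N = ∑ m_i, let e_i be the unit
vectors, and consider the gauged Calogero-Moser operator Δ - 2 ∑ m_j (e_j, x)⁻¹ ∂_{e_j}. In the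
normal coordinate t of the line (e_i, x) = 0 its singular part ∂_t² - (2m_i/t) ∂_t preserves the
vanishing of the odd Taylor coefficients below order 2m_i. The rest preserves it too, because the
cotangent sums are the even coefficients of the regular first order term. Minus (λ, λ) and
conjugated by the exponential, the operator is applied N times to ∏ (e_i, x)^(2m_i); the top part
becomes 2^N N! ∏ (e_i, λ)^(m_i) (e_i, x)^(m_i).

Necessity (`cotCondition_of_admitsBA`) needs P to satisfy a differential equation in x. One may keep
only the part of P of equal degrees in λ and x. The x-leading component of a quasi-invariant
polynomial is divisible by ∏ (e_i, x)^(m_i), so a quasi-invariant polynomial of x-degree below N is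
zero. This uniqueness gives an equation in λ (`exists_lam_equation`). The operators in λ and in x
commute on polynomials of equal bidegrees, and solutions of the λ-equation of λ-degree below N
vanish; together these give the equation in x (`exists_x_equation`), with an unknown potential
depending on x only. Comparing the equation at two values of λ eliminates the potential. What
remains says that the regular first order coefficient, times a series without even coefficients
below 2m_i but with non-zero linear coefficient, has no odd coefficients below 2m_i. Hence its even
coefficients, the cotangent sums, vanish (`slope_sum_eq_zero`). -/

namespace BakerAkhiezer

open Finset

/-! ### The cotangent conditions and their behaviour under division of angles. -/

section Trigonometry

open Complex

/-- The odd power sums of the cotangents of the angle differences vanish up to order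
`2 m_i - 1`. As `cot 0 = 0`, the term `j = i` does not contribute. -/
def CotCondition {ι : Type*} [Fintype ι] (m : ι → ℕ) (φ : ι → ℂ) : Prop :=
  ∀ i, ∀ s : ℕ, 1 ≤ s → s ≤ m i → ∑ j, (m j : ℂ) * cot (φ j - φ i) ^ (2 * s - 1) = 0

theorem hasDerivAt_cot {z : ℂ} (hz : sin z ≠ 0) : HasDerivAt cot (-(1 + cot z ^ 2)) z := by
  have h := (hasDerivAt_cos z).div (hasDerivAt_sin z) hz
  have h2 : cot = fun z => cos z / sin z := rfl
  rw [h2]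
  refine h.congr_deriv ?_
  field_simp
  ring

theorem sin_div_ne_zero {q : ℕ} (hq : 1 ≤ q) {ψ : ℂ} (hψ : sin ψ ≠ 0) (s : ℤ) :
    sin ((ψ + Real.pi * s) / q) ≠ 0 := by
  intro h
  rw [sin_eq_zero_iff] at h
  obtain ⟨k, hk⟩ := h
  have hq' : (q : ℂ) ≠ 0 := by exact_mod_cast (by omega : q ≠ 0)
  apply hψ
  rw [sin_eq_zero_iff]
  refine ⟨k * q - s, ?_⟩
  rw [div_eq_iff hq'] at hk
  push_cast
  linear_combination hk

theorem sum_range_add_int_of_periodic {f : ℤ → ℂ} {q : ℕ} (hf : ∀ k, f (k + q) = f k) (k : ℤ) :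
    ∑ s ∈ range q, f (s + k) = ∑ s ∈ range q, f s := by
  have step : ∀ k : ℤ, ∑ s ∈ range q, f (s + (k + 1)) = ∑ s ∈ range q, f (s + k) := by
    intro k
    have h1 := sum_range_succ (fun s : ℕ => f (s + k)) q
    have h2 := sum_range_succ' (fun s : ℕ => f (s + k)) q
    rw [h1] at h2
    have h3 : f ((q : ℤ) + k) = f (((0 : ℕ) : ℤ) + k) := by
      rw [add_comm, hf]; simp
    rw [h3] at h2
    have h4 := add_right_cancel h2
    rw [h4]
    refine sum_congr rfl fun s _ => ?_
    congr 1
    push_cast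
    ring
  induction k using Int.induction_on with
  | zero => simp
  | succ i ih => rw [step, ih]
  | pred i ih =>
    rw [← ih, ← step]
    simp

theorem sum_range_neg_of_periodic {f : ℤ → ℂ} {q : ℕ} (hf : ∀ k, f (k + q) = f k) :
    ∑ s ∈ range q, f (-s) = ∑ s ∈ range q, f s := by
  rw [← sum_range_add_int_of_periodic hf (1 - q), ← sum_range_reflect]
  refine sum_congr rfl fun s hs => ?_
  congr 1
  have := mem_range.1 hs
  omega

/-- Sums of powers of a cotangent over the `q` preimages of `ψ` under `θ ↦ q θ`. -/
theorem cot_eq_I_mul {z : ℂ} (hz : sin z ≠ 0) :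
    cot z = I * (1 + 2 * (exp (2 * I * z) - 1)⁻¹) ∧ exp (2 * I * z) - 1 ≠ 0 := by
  have h1 : exp (2 * I * z) = exp (z * I) * exp (z * I) := by rw [← exp_add]; ring_nf
  have h2 : exp (-z * I) = (exp (z * I))⁻¹ := by rw [neg_mul, exp_neg]
  have he : exp (z * I) ≠ 0 := exp_ne_zero _
  have hI : I ^ 2 = -1 := I_sq
  have h3 : exp (2 * I * z) - 1 ≠ 0 := by
    intro h
    apply hz
    rw [sin, h2]
    field_simp
    rw [h1] at h
    linear_combination (-I) * h
  refine ⟨?_, h3⟩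
  rw [cot_eq_cos_div_sin, div_eq_iff hz, cos, sin, h2]
  rw [h1] at h3 ⊢
  generalize exp (z * I) = w at *
  have h4 : w ^ 2 - 1 ≠ 0 := by rwa [pow_two]
  field_simp
  linear_combination (w ^ 2 - 1) * (w ^ 2 + 1) * hI

/-- In terms of w = e^{2iz} one has cot z = i (1 + 2/(w - 1)), and the q angles give the q-th roots
Zζ^s of e^{2iψ}. Expanding (Z^q - 1)/(Zζ^s - 1) as a geometric sum and using that ∑_s ζ^{sk}
vanishes for 0 < k < q gives ∑_s 1/(Zζ^s - 1) = q/(Z^q - 1). -/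
theorem sum_cot {q : ℕ} (hq : 1 ≤ q) {ψ : ℂ} (hψ : sin ψ ≠ 0) :
    ∑ s ∈ range q, cot ((ψ + Real.pi * s) / q) = q * cot ψ := by
  have hq' : (q : ℂ) ≠ 0 := by exact_mod_cast (by omega : q ≠ 0)
  set ζ : ℂ := exp (2 * Real.pi * I / q) with hζ
  have hprim : IsPrimitiveRoot ζ q := Complex.isPrimitiveRoot_exp q (by omega)
  set Z : ℂ := exp (2 * I * ψ / q)
  have hw : ∀ s : ℕ, exp (2 * I * ((ψ + Real.pi * s) / q)) = Z * ζ ^ s := by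
    intro s
    rw [hζ, ← exp_nat_mul, ← exp_add]
    congr 1
    field_simp
  have hW : exp (2 * I * ψ) = Z ^ q := by
    rw [← exp_nat_mul]; congr 1; field_simp
  obtain ⟨hc, hne⟩ := cot_eq_I_mul hψ
  rw [hW] at hc hne
  have key : ∑ s ∈ range q, (Z * ζ ^ s - 1)⁻¹ = q * (Z ^ q - 1)⁻¹ := by
    have h1 : ∀ s ∈ range q, (Z * ζ ^ s - 1)⁻¹ =
        (Z ^ q - 1)⁻¹ * ∑ k ∈ range q, (Z * ζ ^ s) ^ k := by
      intro s _
      have h2 : Z * ζ ^ s - 1 ≠ 0 := by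
        have := (cot_eq_I_mul (sin_div_ne_zero hq hψ (s : ℤ))).2
        push_cast at this
        rwa [hw] at this
      have h3 := geom_sum_mul (Z * ζ ^ s) q
      have h4 : (Z * ζ ^ s) ^ q = Z ^ q := by
        rw [mul_pow, ← pow_mul, mul_comm s q, pow_mul, hprim.pow_eq_one]; simp
      rw [h4] at h3
      rw [← h3] at hne ⊢
      have h5 := left_ne_zero_of_mul hne
      field_simp
    rw [sum_congr rfl h1, ← mul_sum, sum_comm]
    have h6 : ∀ k ∈ range q, ∑ s ∈ range q, (Z * ζ ^ s) ^ k = if k = 0 then (q : ℂ) else 0 := by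
      intro k hk
      split_ifs with h0
      · simp [h0]
      · have hk' : k < q := mem_range.1 hk
        have hz1 : ζ ^ k ≠ 1 := hprim.pow_ne_one_of_pos_of_lt h0 hk'
        have : ∀ s ∈ range q, (Z * ζ ^ s) ^ k = Z ^ k * (ζ ^ k) ^ s := by
          intro s _
          rw [mul_pow, ← pow_mul, ← pow_mul, mul_comm s k]
        rw [sum_congr rfl this, ← mul_sum, geom_sum_eq hz1, ← pow_mul, mul_comm k q, pow_mul,
          hprim.pow_eq_one]
        simp
    rw [sum_congr rfl h6, sum_ite_eq' (range q) 0, if_pos (mem_range.2 hq)]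
    ring
  have hs : ∀ s ∈ range q, cot ((ψ + Real.pi * s) / q) = I * (1 + 2 * (Z * ζ ^ s - 1)⁻¹) := by
    intro s _
    have := (cot_eq_I_mul (sin_div_ne_zero hq hψ (s : ℤ))).1
    push_cast at this
    rw [this, hw]
  rw [sum_congr rfl hs, ← mul_sum, sum_add_distrib, ← mul_sum, key, hc]
  simp
  ring

/-- Write S_r for the sum. Since cot' = -(1 + cot²), differentiating S_{r+1} = p(cot ψ) in ψ gives
S_r + S_{r+2} = (q/(r+1)) (1 + cot² ψ) p'(cot ψ). This recursion raises the degree by two and keeps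
the parity; it starts from S_0 = q and from `sum_cot`. -/
theorem exists_polynomial_sum_cot_pow {q : ℕ} (hq : 1 ≤ q) (r : ℕ) :
    ∃ p : Polynomial ℂ, (∀ k, p.coeff k ≠ 0 → k ≤ r ∧ k % 2 = r % 2) ∧
      ∀ ψ : ℂ, sin ψ ≠ 0 →
        ∑ s ∈ range q, cot ((ψ + Real.pi * s) / q) ^ r = p.eval (cot ψ) := by
  have hq' : (q : ℂ) ≠ 0 := by exact_mod_cast (by omega : q ≠ 0)
  induction r using Nat.strong_induction_on with
  | _ r ih =>
  match r, ih with
  | 0, _ =>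
    refine ⟨Polynomial.C (q : ℂ), ?_, ?_⟩
    · intro k hk
      rw [Polynomial.coeff_C] at hk
      have : k = 0 := by by_contra h; simp [h] at hk
      simp [this]
    · intro ψ _; simp
  | 1, _ =>
    refine ⟨Polynomial.C (q : ℂ) * Polynomial.X, ?_, ?_⟩
    · intro k hk
      rw [Polynomial.coeff_C_mul_X] at hk
      have : k = 1 := by by_contra h; simp [h] at hk
      simp [this]
    · intro ψ hψ
      simpa using sum_cot hq hψ
  | (r + 2), ih =>
    obtain ⟨p, hp, hps⟩ := ih (r + 1) (by omega)
    obtain ⟨p', hp', hps'⟩ := ih r (by omega)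
    have hr : ((r : ℂ) + 1) ≠ 0 := by exact_mod_cast Nat.succ_ne_zero r
    refine ⟨Polynomial.C ((q : ℂ) / (r + 1)) * (p.derivative + p.derivative * Polynomial.X ^ 2) - p',
      ?_, ?_⟩
    · intro k hk
      by_contra hcon
      apply hk
      have e1 : p'.coeff k = 0 := by
        by_contra h
        have := hp' k h
        omega
      have e2 : p.coeff (k + 1) = 0 := by
        by_contra h
        have := hp _ h
        omega
      rw [Polynomial.coeff_sub, Polynomial.coeff_C_mul, Polynomial.coeff_add,
        Polynomial.coeff_mul_X_pow', Polynomial.coeff_derivative, e1, e2]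
      split_ifs with h2
      · have e3 : p.coeff (k - 2 + 1) = 0 := by
          by_contra h
          have := hp _ h
          omega
        rw [Polynomial.coeff_derivative, e3]
        simp
      · simp
    · intro ψ hψ
      have hopen : ∀ᶠ z in nhds ψ, sin z ≠ 0 :=
        continuous_sin.continuousAt.eventually_ne hψ
      have hEq : (fun z => ∑ s ∈ range q, cot ((z + Real.pi * s) / q) ^ (r + 1)) =ᶠ[nhds ψ]
          fun z => p.eval (cot z) := hopen.mono fun z hz => hps z hz
      have hL : HasDerivAt (fun z => ∑ s ∈ range q, cot ((z + Real.pi * s) / q) ^ (r + 1))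
          (∑ s ∈ range q, ((r + 1 : ℕ) : ℂ) * cot ((ψ + Real.pi * s) / q) ^ r *
            (-(1 + cot ((ψ + Real.pi * s) / q) ^ 2) * (1 / q))) ψ := by
        refine HasDerivAt.fun_sum fun s _ => ?_
        have h0 : sin ((ψ + Real.pi * s) / q) ≠ 0 := by
          have := sin_div_ne_zero hq hψ (s : ℤ); push_cast at this; exact this
        have h1 : HasDerivAt (fun z : ℂ => (z + Real.pi * s) / q) (1 / q) ψ :=
          ((hasDerivAt_id ψ).add_const _).div_const _
        have h2 := (hasDerivAt_cot h0).comp ψ h1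
        have h3 := h2.pow (r + 1)
        exact h3
      have hR : HasDerivAt (fun z => p.eval (cot z))
          (p.derivative.eval (cot ψ) * (-(1 + cot ψ ^ 2))) ψ :=
        (p.hasDerivAt (cot ψ)).comp ψ (hasDerivAt_cot hψ)
      have hd := (hL.congr_of_eventuallyEq hEq.symm).unique hR
      have hsum : ∑ s ∈ range q, ((r + 1 : ℕ) : ℂ) * cot ((ψ + Real.pi * s) / q) ^ r *
            (-(1 + cot ((ψ + Real.pi * s) / q) ^ 2) * (1 / q)) =
          -((r + 1) / q) * (∑ s ∈ range q, cot ((ψ + Real.pi * s) / q) ^ r +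
            ∑ s ∈ range q, cot ((ψ + Real.pi * s) / q) ^ (r + 2)) := by
        rw [← sum_add_distrib, mul_sum]
        refine sum_congr rfl fun s _ => ?_
        push_cast
        ring
      rw [hsum, hps' ψ hψ] at hd
      simp only [Polynomial.eval_sub, Polynomial.eval_mul, Polynomial.eval_C, Polynomial.eval_add,
        Polynomial.eval_pow, Polynomial.eval_X]
      generalize ∑ s ∈ range q, cot ((ψ + Real.pi * s) / q) ^ (r + 2) = S at *
      field_simp at hd ⊢
      linear_combination -hd

/-- The angle of the vector `Tvec q φ p`. -/
noncomputable def coverAngle {ι : Type*} (q : ℕ) (φ : ι → ℂ) (p : ι × Fin q) : ℂ :=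
  (φ p.1 + (Real.pi : ℂ) * (((p.2 : ℕ) : ℂ) + 1)) / (q : ℂ)

theorem cot_add_int_mul_pi (z : ℂ) (k : ℤ) : cot (z + k * Real.pi) = cot z := by
  have h : Function.Periodic cot (Real.pi : ℂ) := fun w => by
    rw [cot_eq_cos_div_sin, cot_eq_cos_div_sin, cos_add_pi, sin_add_pi, neg_div_neg_eq]
  exact h.int_mul k z

/-- For fixed j the sum over the preimages of φ_j is p(cot(φ_j - φ_i)), with one odd polynomial p of
degree at most 2s - 1 serving all j. Summing over j coefficient by coefficient leaves only old
conditions of odd exponent at most 2s - 1. -/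
theorem CotCondition.cover {ι : Type*} [Fintype ι] {m : ι → ℕ} {φ : ι → ℂ}
    (hφ : ∀ i j, i ≠ j → sin (φ j - φ i) ≠ 0) (h : CotCondition m φ) {q : ℕ} (hq : 1 ≤ q) :
    CotCondition (Tmult q m) (coverAngle q φ) := by
  classical
  have hq' : (q : ℂ) ≠ 0 := by exact_mod_cast (by omega : q ≠ 0)
  rintro ⟨i, t⟩ s hs1 hs2
  obtain ⟨p, hp, hps⟩ := exists_polynomial_sum_cot_pow hq (2 * s - 1)
  have hinner : ∀ j, ∑ u : Fin q, ((Tmult q m (j, u) : ℕ) : ℂ) *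
      cot (coverAngle q φ (j, u) - coverAngle q φ (i, t)) ^ (2 * s - 1) =
      (m j : ℂ) * p.eval (cot (φ j - φ i)) := by
    intro j
    simp only [Tmult]
    rw [← mul_sum]
    congr 1
    set f : ℤ → ℂ := fun k => cot (((φ j - φ i) + Real.pi * k) / q) ^ (2 * s - 1) with hf
    have hper : ∀ k, f (k + q) = f k := by
      intro k
      simp only [hf]
      have : ((φ j - φ i) + Real.pi * ((k + q : ℤ) : ℂ)) / q =
          ((φ j - φ i) + Real.pi * k) / q + (1 : ℤ) * Real.pi := by
        push_cast; field_simp; ring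
      rw [this, cot_add_int_mul_pi]
    -- The offsets u + 1 and t + 1 subtract to u - t; as cot has period π, `f` has period q and the
    -- shift by t is harmless.
    have h1 : ∑ u : Fin q, cot (coverAngle q φ (j, u) - coverAngle q φ (i, t)) ^ (2 * s - 1) =
        ∑ u ∈ range q, f (u + (-(t : ℕ) : ℤ)) := by
      rw [sum_range fun u => f (u + (-(t : ℕ) : ℤ))]
      refine sum_congr rfl fun u _ => ?_
      simp only [hf, coverAngle]
      congr 2
      push_cast
      field_simp
      ring
    rw [h1, sum_range_add_int_of_periodic hper]
    -- For j = i the identity for p is unavailable because sin 0 = 0. Instead both sides vanish: the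
    -- sum is odd under u ↦ -u, and p has no constant term.
    by_cases hij : i = j
    · subst hij
      have hodd : Odd (2 * s - 1) := ⟨s - 1, by omega⟩
      have h2 := sum_range_neg_of_periodic hper
      have h3 : ∀ u : ℕ, f (-u) = - f u := by
        intro u
        simp only [hf, sub_self, zero_add]
        rw [← hodd.neg_pow]
        congr 1
        rw [cot_eq_cos_div_sin, cot_eq_cos_div_sin]
        have : (Real.pi : ℂ) * ((-(u : ℤ) : ℤ) : ℂ) / q = -(Real.pi * ((u : ℤ) : ℂ) / q) := by
          push_cast; ring
        rw [this, sin_neg, cos_neg, div_neg]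
      simp only [h3, sum_neg_distrib] at h2
      have h4 : ∑ u ∈ range q, f u = 0 := by linear_combination (-1 / 2 : ℂ) * h2
      rw [h4, sub_self]
      have : cot 0 = 0 := by simp [cot_eq_cos_div_sin]
      rw [this, ← Polynomial.coeff_zero_eq_eval_zero, eq_comm]
      by_contra hne
      have := hp 0 hne
      omega
    · have := hps (φ j - φ i) (hφ i j hij)
      rw [← this]
      simp [hf]
  rw [Fintype.sum_prod_type, sum_congr rfl fun j _ => hinner j]
  simp_rw [Polynomial.eval_eq_sum, Polynomial.sum, mul_sum]
  rw [sum_comm]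
  refine sum_eq_zero fun k hk => ?_
  obtain ⟨hk1, hk2⟩ := hp k (Polynomial.mem_support_iff.1 hk)
  have h5 := h i ((k + 1) / 2) (by omega) (by simp only [Tmult] at hs2; omega)
  rw [show 2 * ((k + 1) / 2) - 1 = k by omega] at h5
  calc _ = p.coeff k * ∑ j, (m j : ℂ) * cot (φ j - φ i) ^ k := by
        rw [mul_sum]; exact sum_congr rfl fun j _ => by ring
    _ = 0 := by rw [h5, mul_zero]

/-- The determinant of the two vectors is sin(η - θ). If it vanishes, the relations with
coefficients (sin η, -sin θ) and (cos η, -cos θ) cannot both be trivial. -/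
theorem linearIndependent_unitVec_iff (θ η : ℂ) :
    LinearIndependent ℂ ![unitVec θ, unitVec η] ↔ sin (η - θ) ≠ 0 := by
  rw [LinearIndependent.pair_iff, sin_sub]
  constructor
  · intro h h0
    have h1 := h (sin η) (-sin θ) (by
      ext k; fin_cases k <;> simp [unitVec]
      · linear_combination h0
      · ring)
    have h2 := h (cos η) (-cos θ) (by
      ext k; fin_cases k <;> simp [unitVec]
      · ring
      · linear_combination -h0)
    have h3 := sin_sq_add_cos_sq η
    rw [h1.1, h2.1] at h3
    norm_num at h3
  · intro h s t hst
    have h1 : s * cos θ + t * cos η = 0 := by simpa [unitVec] using congrFun hst 0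
    have h2 : s * sin θ + t * sin η = 0 := by simpa [unitVec] using congrFun hst 1
    constructor
    · apply (mul_eq_zero.1 (_ : s * (sin η * cos θ - cos η * sin θ) = 0)).resolve_right h
      linear_combination sin η * h1 - cos η * h2
    · apply (mul_eq_zero.1 (_ : t * (sin η * cos θ - cos η * sin θ) = 0)).resolve_right h
      linear_combination cos θ * h2 - sin θ * h1

theorem sin_coverAngle_sub_ne_zero {ι : Type*} {φ : ι → ℂ}
    (hφ : ∀ i j, i ≠ j → sin (φ j - φ i) ≠ 0) {q : ℕ} (hq : 1 ≤ q) (a b : ι × Fin q)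
    (hab : a ≠ b) : sin (coverAngle q φ b - coverAngle q φ a) ≠ 0 := by
  have hq' : (q : ℂ) ≠ 0 := by exact_mod_cast (by omega : q ≠ 0)
  obtain ⟨i, s⟩ := a
  obtain ⟨j, t⟩ := b
  have h1 : coverAngle q φ (j, t) - coverAngle q φ (i, s) =
      ((φ j - φ i) + Real.pi * ((t - s : ℤ) : ℂ)) / q := by
    simp only [coverAngle]; push_cast; field_simp; ring
  rw [h1]
  by_cases hij : i = j
  · subst hij
    intro h
    rw [sin_eq_zero_iff] at h
    obtain ⟨k, hk⟩ := h
    have hpi : (Real.pi : ℂ) ≠ 0 := by exact_mod_cast Real.pi_ne_zero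
    rw [div_eq_iff hq', sub_self, zero_add] at hk
    have h2 : ((t - s : ℤ) : ℂ) = ((k * q : ℤ) : ℂ) := by
      apply mul_left_cancel₀ hpi
      rw [hk]; push_cast; ring
    have h3 : (t - s : ℤ) = k * q := by exact_mod_cast h2
    have ht := t.2
    have hs := s.2
    have h4 : (t - s : ℤ) = 0 := by
      apply Int.eq_zero_of_abs_lt_dvd (m := (q : ℤ)) ⟨k, by rw [h3]; ring⟩
      rw [abs_lt]; constructor <;> omega
    apply hab
    ext <;> simp
    omega
  · exact sin_div_ne_zero hq (hφ i j hij) _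

end Trigonometry

/-! ### Parity of truncated power series and singular second order operators. -/

section Parity

open PowerSeries

/-- The coefficients of odd index below `n` vanish. -/
def OddVanish (n : ℕ) (f : ℂ⟦X⟧) : Prop := ∀ k, Odd k → k < n → coeff k f = 0

/-- The coefficients of even index below `n` vanish. -/
def EvenVanish (n : ℕ) (f : ℂ⟦X⟧) : Prop := ∀ k, Even k → k < n → coeff k f = 0

variable {n : ℕ} {f g : ℂ⟦X⟧}

theorem OddVanish.add (hf : OddVanish n f) (hg : OddVanish n g) : OddVanish n (f + g) :=
  fun k hk hkn => by rw [map_add, hf k hk hkn, hg k hk hkn, add_zero]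

theorem OddVanish.sub (hf : OddVanish n f) (hg : OddVanish n g) : OddVanish n (f - g) :=
  fun k hk hkn => by rw [map_sub, hf k hk hkn, hg k hk hkn, sub_zero]

theorem EvenVanish.sub (hf : EvenVanish n f) (hg : EvenVanish n g) : EvenVanish n (f - g) :=
  fun k hk hkn => by rw [map_sub, hf k hk hkn, hg k hk hkn, sub_zero]

theorem oddVanish_C (c : ℂ) : OddVanish n (C c) := fun k hk _ => by
  rw [coeff_C, if_neg]
  rintro rfl
  exact absurd hk (by decide)

theorem evenVanish_X : EvenVanish n (X : ℂ⟦X⟧) := fun k hk _ => by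
  rw [coeff_X, if_neg]
  rintro rfl
  exact absurd hk (by decide)

theorem OddVanish.mul (hf : OddVanish n f) (hg : OddVanish n g) : OddVanish n (f * g) := by
  intro k hk hkn
  rw [coeff_mul]
  refine sum_eq_zero fun x hx => ?_
  have hx' := mem_antidiagonal.1 hx
  rcases Nat.even_or_odd x.1 with h | h
  · rcases Nat.even_or_odd x.2 with h2 | h2
    · rw [← hx'] at hk
      exact absurd (h.add h2) (by simpa using hk)
    · rw [hg x.2 h2 (by omega), mul_zero]
  · rw [hf x.1 h (by omega), zero_mul]

theorem EvenVanish.mul (hf : EvenVanish n f) (hg : EvenVanish n g) : OddVanish n (f * g) := by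
  intro k hk hkn
  rw [coeff_mul]
  refine sum_eq_zero fun x hx => ?_
  have hx' := mem_antidiagonal.1 hx
  rcases Nat.even_or_odd x.1 with h | h
  · rw [hf x.1 h (by omega), zero_mul]
  · rcases Nat.even_or_odd x.2 with h2 | h2
    · rw [hg x.2 h2 (by omega), mul_zero]
    · rw [← hx'] at hk
      exact absurd (h.add_odd h2) (by simpa using hk)

theorem EvenVanish.mul_oddVanish (hf : EvenVanish n f) (hg : OddVanish n g) :
    EvenVanish n (f * g) := by
  intro k hk hkn
  rw [coeff_mul]
  refine sum_eq_zero fun x hx => ?_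
  have hx' := mem_antidiagonal.1 hx
  rcases Nat.even_or_odd x.1 with h | h
  · rw [hf x.1 h (by omega), zero_mul]
  · rcases Nat.even_or_odd x.2 with h2 | h2
    · rw [← hx'] at hk
      exact absurd (h.add_even h2) (by simpa using hk)
    · rw [hg x.2 h2 (by omega), mul_zero]

theorem OddVanish.of_C_mul {c : ℂ} (hc : c ≠ 0) (h : OddVanish n (C c * f)) : OddVanish n f := by
  intro k hk hkn
  have := h k hk hkn
  rw [coeff_C_mul] at this
  exact (mul_eq_zero.1 this).resolve_left hc

theorem OddVanish.derivative {m : ℕ} (hf : OddVanish (2 * m) f) :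
    EvenVanish (2 * m) (d⁄dX ℂ f) := by
  intro k hk hkn
  rw [coeff_derivative, hf (k + 1) hk.add_one (by obtain ⟨r, rfl⟩ := hk; omega), zero_mul]

/-- Here `p₁` is p'/t, so this is p'' - (2m/t) p'. Its k-th coefficient is (k + 2)(k + 1 - 2m) times
the (k + 2)-nd coefficient of p: the latter vanishes for odd k < 2m - 1, and the factor k + 1 - 2m
vanishes for k = 2m - 1. -/
theorem OddVanish.singular_part {m : ℕ} {p p₁ : ℂ⟦X⟧} (hp : OddVanish (2 * m) p)
    (hp₁ : d⁄dX ℂ p = X * p₁) : OddVanish (2 * m) (d⁄dX ℂ (d⁄dX ℂ p) - C (2 * m : ℂ) * p₁) := by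
  intro k hk hkn
  have h1 : coeff k p₁ = coeff (k + 2) p * (k + 2) := by
    have := congrArg (coeff (k + 1)) hp₁
    rw [coeff_succ_X_mul, coeff_derivative] at this
    rw [← this]; push_cast; ring
  rw [map_sub, coeff_C_mul, h1, coeff_derivative, coeff_derivative]
  rcases Nat.lt_or_ge (k + 2) (2 * m) with h | h
  · rw [hp (k + 2) (by rcases hk with ⟨r, rfl⟩; exact ⟨r + 1, by ring⟩) h]; simp
  · have h2 : (k : ℂ) + 1 = 2 * m := by
      have : k + 1 = 2 * m := by obtain ⟨r, rfl⟩ := hk; omega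
      exact_mod_cast this
    push_cast
    linear_combination (coeff (k + 1 + 1) p * (k + 2)) * h2

/-- A Laplacian with first order singularities whose coefficients have the right parity
preserves the vanishing of odd coefficients. -/
theorem OddVanish.laplacian {m : ℕ} {p p₁ u c a b : ℂ⟦X⟧} {s κ : ℂ} {ν : ℂ} (hs : s ≠ 0)
    (hp : OddVanish (2 * m) p) (hp₁ : d⁄dX ℂ p = X * p₁)
    (hu : OddVanish (2 * m) u) (hc : OddVanish (2 * m) c) (ha : EvenVanish (2 * m) a)
    (hb : C s * b + X * a = C ν) :
    OddVanish (2 * m) (d⁄dX ℂ (d⁄dX ℂ p) + c - C κ * p - C (2 * m : ℂ) * p₁ -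
      C 2 * (a * d⁄dX ℂ p + b * u)) := by
  have hb' : OddVanish (2 * m) b := by
    apply OddVanish.of_C_mul hs
    rw [eq_sub_of_add_eq hb]
    exact (oddVanish_C _).sub (evenVanish_X.mul ha)
  have h := ((((hp.singular_part hp₁).add hc).sub ((oddVanish_C κ).mul hp)).sub
    ((oddVanish_C 2).mul ((ha.mul hp.derivative).add (hb'.mul hu))))
  convert h using 1
  ring

/-- Induction on the even index: in the coefficient of order 2k + 1 of a w, every term other than
a_{2k} w_1 contains an even coefficient of w or an earlier even coefficient of a. -/
theorem EvenVanish.of_mul {m : ℕ} {a w : ℂ⟦X⟧} (hw : EvenVanish (2 * m) w) (hw1 : coeff 1 w ≠ 0)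
    (h : OddVanish (2 * m) (a * w)) : EvenVanish (2 * m) a := by
  have key : ∀ k, k < m → coeff (2 * k) a = 0 := by
    intro k
    induction k using Nat.strong_induction_on with
    | _ k ih =>
    intro hk
    have h1 := h (2 * k + 1) ⟨k, rfl⟩ (by omega)
    rw [coeff_mul, sum_eq_single (2 * k, 1)] at h1
    · exact (mul_eq_zero.1 h1).resolve_right hw1
    · rintro ⟨i, j⟩ hx hne
      have hx' : i + j = 2 * k + 1 := mem_antidiagonal.1 hx
      rcases Nat.even_or_odd j with hj | hj
      · rw [hw j hj (by omega), mul_zero]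
      · obtain ⟨r, hr⟩ := hj
        have hi : i = 2 * (k - r) := by omega
        have hr0 : r ≠ 0 := by
          rintro rfl
          apply hne
          ext <;> simp <;> omega
        rw [show i = 2 * (k - r) from hi, ih (k - r) (by omega) (by omega), zero_mul]
    · intro h2
      exact (h2 (by simp)).elim
  rintro k ⟨r, rfl⟩ hkn
  rw [← two_mul]
  exact key r (by omega)

/-- If the same singular Laplacian has two eigenfunctions without odd coefficients that are
sufficiently independent, then its first order coefficient is odd. -/
theorem EvenVanish.of_laplacian {m : ℕ} {p p₁ u c q q₁ v d a b : ℂ⟦X⟧} {κ μ ν : ℂ}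
    (hp : OddVanish (2 * m) p) (hp₁ : d⁄dX ℂ p = X * p₁)
    (hu : OddVanish (2 * m) u) (hc : OddVanish (2 * m) c)
    (hq : OddVanish (2 * m) q) (hq₁ : d⁄dX ℂ q = X * q₁)
    (hv : OddVanish (2 * m) v) (hd : OddVanish (2 * m) d)
    (hb : b + X * a = C ν)
    (heq : (d⁄dX ℂ (d⁄dX ℂ p) + c - C κ * p - C (2 * m : ℂ) * p₁ -
        C 2 * (a * d⁄dX ℂ p + b * u)) * q =
      (d⁄dX ℂ (d⁄dX ℂ q) + d - C μ * q - C (2 * m : ℂ) * q₁ -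
        C 2 * (a * d⁄dX ℂ q + b * v)) * p)
    (hne : (constantCoeff p₁ - constantCoeff u) * constantCoeff q ≠
      (constantCoeff q₁ - constantCoeff v) * constantCoeff p) :
    EvenVanish (2 * m) a := by
  -- After substituting b = ν - X a into `heq`, all occurrences of a collect into 2 a w for this
  -- series w. Its linear coefficient is the difference of the two sides of `hne`.
  have hw : EvenVanish (2 * m) ((d⁄dX ℂ p - X * u) * q - (d⁄dX ℂ q - X * v) * p) :=
    ((hp.derivative.sub (evenVanish_X.mul_oddVanish hu)).mul_oddVanish hq).sub
      ((hq.derivative.sub (evenVanish_X.mul_oddVanish hv)).mul_oddVanish hp)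
  refine EvenVanish.of_mul hw ?_ (OddVanish.of_C_mul (c := 2) two_ne_zero ?_)
  · rw [hp₁, hq₁, show (X * p₁ - X * u) * q - (X * q₁ - X * v) * p =
      X * ((p₁ - u) * q - (q₁ - v) * p) by ring, show (1 : ℕ) = 0 + 1 from rfl, coeff_succ_X_mul,
      coeff_zero_eq_constantCoeff_apply]
    simpa [sub_eq_zero] using hne
  · have h1 := (((((hp.singular_part hp₁).add hc).sub ((oddVanish_C κ).mul hp)).sub
      ((oddVanish_C (2 * ν)).mul hu)).mul hq).sub
      (((((hq.singular_part hq₁).add hd).sub ((oddVanish_C μ).mul hq)).sub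
      ((oddVanish_C (2 * ν)).mul hv)).mul hp)
    convert h1 using 1
    rw [map_mul C 2 ν, ← hb]
    linear_combination -heq

end Parity

/-- Polynomials in the variables `(λ, x)` for `λ, x ∈ ℂ²`. -/
abbrev PolyLX := MvPolynomial (Fin 2 ⊕ Fin 2) ℂ

/-! ### Derivatives conjugated by e^{(λ, x)}. -/

section Operators

open MvPolynomial

/-- The operator on `P` induced by the partial derivative of `P e^{(λ, x)}` with respect to a
variable. -/
noncomputable def cov (i : Fin 2 ⊕ Fin 2) : PolyLX →ₗ[ℂ] PolyLX :=
  (pderiv i).toLinearMap + LinearMap.mulLeft ℂ (X i.swap)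

theorem cov_apply (i : Fin 2 ⊕ Fin 2) (P : PolyLX) : cov i P = pderiv i P + X i.swap * P := rfl

theorem cov_mul (i : Fin 2 ⊕ Fin 2) (f P : PolyLX) :
    cov i (f * P) = pderiv i f * P + f * cov i P := by
  simp only [cov_apply, Derivation.leibniz, smul_eq_mul]; ring

theorem pderiv_comm (i j : Fin 2 ⊕ Fin 2) (P : PolyLX) :
    pderiv i (pderiv j P) = pderiv j (pderiv i P) := by
  have h : ⁅(pderiv i : Derivation ℂ PolyLX PolyLX), (pderiv j : Derivation ℂ PolyLX PolyLX)⁆ = 0 := by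
    apply MvPolynomial.derivation_ext
    intro k
    simp [Derivation.commutator_apply, pderiv_X, Pi.single_apply, apply_ite]
  have := congrArg (fun D => D P) h
  simpa [Derivation.commutator_apply, sub_eq_zero] using this

theorem cov_comm (i j : Fin 2 ⊕ Fin 2) (P : PolyLX) : cov i (cov j P) = cov j (cov i P) := by
  simp only [cov_apply, map_add, Derivation.leibniz, smul_eq_mul, pderiv_comm i j]
  have h : pderiv (R := ℂ) i (X j.swap) = pderiv j (X i.swap) := by
    rw [pderiv_X, pderiv_X]
    rcases i with i | i <;> rcases j with j | j <;> simp [Pi.single_apply, eq_comm]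
  rw [h]
  ring

/-- The directional derivative in the `x` variables. -/
noncomputable def dX (v : Fin 2 → ℂ) : Derivation ℂ PolyLX PolyLX :=
  v 0 • pderiv (Sum.inr 0) + v 1 • pderiv (Sum.inr 1)

/-- The operator on `P` induced by the derivative of `P e^{(λ, x)}` in the direction `v` of the
`x` variables. -/
noncomputable def twX (v : Fin 2 → ℂ) : Module.End ℂ PolyLX :=
  v 0 • cov (Sum.inr 0) + v 1 • cov (Sum.inr 1)

theorem dX_apply (v : Fin 2 → ℂ) (P : PolyLX) :
    dX v P = C (v 0) * pderiv (Sum.inr 0) P + C (v 1) * pderiv (Sum.inr 1) P := by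
  simp [dX, MvPolynomial.smul_eq_C_mul]

theorem twX_apply' (v : Fin 2 → ℂ) (P : PolyLX) :
    twX v P = C (v 0) * cov (Sum.inr 0) P + C (v 1) * cov (Sum.inr 1) P := by
  simp [twX, MvPolynomial.smul_eq_C_mul]

theorem twX_apply (v : Fin 2 → ℂ) (P : PolyLX) : twX v P = dX v P + linFormLam v * P := by
  rw [twX_apply', dX_apply, cov_apply, cov_apply]
  simp [linFormLam]
  ring

theorem twX_mul (v : Fin 2 → ℂ) (f P : PolyLX) : twX v (f * P) = dX v f * P + f * twX v P := by
  simp only [twX_apply, Derivation.leibniz, smul_eq_mul]; ring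

theorem twX_comm (v w : Fin 2 → ℂ) (P : PolyLX) : twX v (twX w P) = twX w (twX v P) := by
  simp only [twX_apply', map_add, ← MvPolynomial.smul_eq_C_mul, map_smul]
  rw [cov_comm (Sum.inr 1) (Sum.inr 0)]
  simp only [smul_add, smul_smul, mul_comm (w _)]
  abel

theorem twX_cov_comm (v : Fin 2 → ℂ) (i : Fin 2 ⊕ Fin 2) (P : PolyLX) :
    twX v (cov i P) = cov i (twX v P) := by
  simp only [twX, LinearMap.add_apply, LinearMap.smul_apply, map_add, map_smul, cov_comm i]

theorem twX_pow_comm (v : Fin 2 → ℂ) {F : Module.End ℂ PolyLX}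
    (hF : ∀ P, twX v (F P) = F (twX v P)) (r : ℕ) (P : PolyLX) :
    (twX v ^ r) (F P) = F ((twX v ^ r) P) := by
  induction r generalizing P with
  | zero => rfl
  | succ r ih => rw [pow_succ, Module.End.mul_apply, Module.End.mul_apply, hF, ih]

theorem linFormX_apply (v : Fin 2 → ℂ) :
    linFormX v = C (v 0) * X (Sum.inr 0) + C (v 1) * X (Sum.inr 1) := by
  simp [linFormX]

theorem linFormLam_apply (v : Fin 2 → ℂ) :
    linFormLam v = C (v 0) * X (Sum.inl 0) + C (v 1) * X (Sum.inl 1) := by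
  simp [linFormLam]

theorem dX_linFormX (v w : Fin 2 → ℂ) : dX v (linFormX w) = C (dotProduct v w) := by
  rw [dX_apply, linFormX_apply]
  simp [pderiv_X, dotProduct, Fin.sum_univ_two]

theorem dX_linFormLam (v w : Fin 2 → ℂ) : dX v (linFormLam w) = 0 := by
  rw [dX_apply, linFormLam_apply]
  simp [pderiv_X]

theorem eval_linFormX (v lam x : Fin 2 → ℂ) :
    eval (Sum.elim lam x) (linFormX v) = dotProduct v x := by
  simp [linFormX, dotProduct]

theorem eval_linFormLam (v lam x : Fin 2 → ℂ) :
    eval (Sum.elim lam x) (linFormLam v) = dotProduct v lam := by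
  simp [linFormLam, dotProduct]

theorem hasDerivAt_eval_line (v lam x : Fin 2 → ℂ) (P : PolyLX) (t : ℂ) :
    HasDerivAt (fun t : ℂ => eval (Sum.elim lam (x + t • v)) P)
      (eval (Sum.elim lam (x + t • v)) (dX v P)) t := by
  induction P using MvPolynomial.induction_on with
  | C a => simpa [dX_apply] using hasDerivAt_const t a
  | add p q hp hq => simpa using! hp.add hq
  | mul_X p i hp =>
    have hX : HasDerivAt (fun t : ℂ => eval (Sum.elim lam (x + t • v)) (X i))
        (eval (Sum.elim lam (x + t • v)) (dX v (X i))) t := by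
      rcases i with k | k
      · simpa [dX_apply, pderiv_X] using hasDerivAt_const t (lam k)
      · have h1 : eval (Sum.elim lam (x + t • v)) (dX v (X (Sum.inr k))) = v k := by
          fin_cases k <;> simp [dX_apply, pderiv_X]
        rw [h1]
        simpa using ((hasDerivAt_id t).mul_const (v k)).const_add (x k)
    have := hp.mul hX
    simp only [Derivation.leibniz, smul_eq_mul, map_add, map_mul] at this ⊢
    refine this.congr_deriv ?_
    ring

theorem hasDerivAt_eval_line_mul_exp (v lam x : Fin 2 → ℂ) (P : PolyLX) (t : ℂ) :
    HasDerivAt (fun t : ℂ => eval (Sum.elim lam (x + t • v)) P *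
        Complex.exp (dotProduct lam (x + t • v)))
      (eval (Sum.elim lam (x + t • v)) (twX v P) *
        Complex.exp (dotProduct lam (x + t • v))) t := by
  have h1 : HasDerivAt (fun t : ℂ => dotProduct lam (x + t • v)) (dotProduct lam v) t := by
    have : (fun t : ℂ => dotProduct lam (x + t • v)) =
        fun t => dotProduct lam x + t * dotProduct lam v := by
      ext t; rw [dotProduct_add, dotProduct_smul, smul_eq_mul]
    rw [this]
    simpa using ((hasDerivAt_id t).mul_const (dotProduct lam v)).const_add (dotProduct lam x)
  have h := (hasDerivAt_eval_line v lam x P t).mul h1.cexp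
  refine h.congr_deriv ?_
  rw [twX_apply, map_add, map_mul, eval_linFormLam, dotProduct_comm v lam]
  ring

theorem iteratedDeriv_eval_line_mul_exp (v lam x : Fin 2 → ℂ) (P : PolyLX) (r : ℕ) :
    iteratedDeriv r (fun t : ℂ => eval (Sum.elim lam (x + t • v)) P *
        Complex.exp (dotProduct lam (x + t • v))) =
      fun t : ℂ => eval (Sum.elim lam (x + t • v)) ((twX v ^ r) P) *
        Complex.exp (dotProduct lam (x + t • v)) := by
  induction r with
  | zero => simp
  | succ r ih =>
    rw [iteratedDeriv_succ, ih]
    ext t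
    rw [(hasDerivAt_eval_line_mul_exp v lam x _ t).deriv, pow_succ', Module.End.mul_apply]

/-- This is the passage between the analytic vanishing conditions and polynomial algebra: the
exponential never vanishes, so only the polynomial factor matters. -/
theorem dirDeriv_mul_exp (v lam x : Fin 2 → ℂ) (P : PolyLX) (r : ℕ) :
    dirDeriv v r (fun x => eval (Sum.elim lam x) P * Complex.exp (dotProduct lam x)) x =
      eval (Sum.elim lam x) ((twX v ^ r) P) * Complex.exp (dotProduct lam x) := by
  rw [dirDeriv, iteratedDeriv_eval_line_mul_exp]
  simp

end Operators

/-! ### Restriction to a line and divisibility by its linear form. -/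

section Restriction

open MvPolynomial

/-- The rotation of `e` by a right angle. -/
def perp (e : Fin 2 → ℂ) : Fin 2 → ℂ := ![-e 1, e 0]

theorem dotProduct_perp (e : Fin 2 → ℂ) : dotProduct e (perp e) = 0 := by
  simp [perp, dotProduct, Fin.sum_univ_two]; ring

theorem eq_add_perp {e : Fin 2 → ℂ} (he : dotProduct e e = 1) (x : Fin 2 → ℂ) :
    x = dotProduct e x • e + dotProduct (perp e) x • perp e := by
  simp only [dotProduct, Fin.sum_univ_two] at he
  ext k
  fin_cases k <;> simp [perp, dotProduct, Fin.sum_univ_two]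
  · linear_combination (-x 0) * he
  · linear_combination (-x 1) * he

/-- Restriction to the line `(e, x) = 0`, as an endomorphism of the polynomial ring: the
orthogonal projection of `x` is substituted for `x`. -/
noncomputable def restr (e : Fin 2 → ℂ) : PolyLX →ₐ[ℂ] PolyLX :=
  aeval (Sum.elim (fun k => X (Sum.inl k)) (fun k => C (perp e k) * linFormX (perp e)))

theorem eval_restr (e lam x : Fin 2 → ℂ) (Q : PolyLX) :
    eval (Sum.elim lam x) (restr e Q) =
      eval (Sum.elim lam (dotProduct (perp e) x • perp e)) Q := by
  have h : (eval (Sum.elim lam x)).comp (restr e).toRingHom =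
      eval (Sum.elim lam (dotProduct (perp e) x • perp e)) := by
    apply MvPolynomial.ringHom_ext
    · intro r; simp [restr]
    · rintro (k | k)
      · simp [restr]
      · simp only [restr, RingHom.comp_apply, AlgHom.toRingHom_eq_coe, RingHom.coe_coe, aeval_X,
          Sum.elim_inr, map_mul, eval_C, eval_linFormX, eval_X, Pi.smul_apply, smul_eq_mul]
        ring
  exact congrArg (fun F => F Q) h

variable {e : Fin 2 → ℂ}

/-- Since x = (e, x) e + (e⊥, x) e⊥, the vector x and its projection to the line agree modulo (e,
x); so do their images under any polynomial. -/
theorem linFormX_dvd_sub_restr (he : dotProduct e e = 1) (Q : PolyLX) :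
    linFormX e ∣ Q - restr e Q := by
  rw [← Ideal.mem_span_singleton, ← Ideal.Quotient.eq]
  have h : (Ideal.Quotient.mkₐ ℂ (Ideal.span {linFormX e})) =
      (Ideal.Quotient.mkₐ ℂ (Ideal.span {linFormX e})).comp (restr e) := by
    apply MvPolynomial.algHom_ext
    rintro (k | k)
    · simp [restr]
    · simp only [Ideal.Quotient.mkₐ_eq_mk, AlgHom.comp_apply, restr, aeval_X, Sum.elim_inr]
      rw [Ideal.Quotient.eq, Ideal.mem_span_singleton]
      refine ⟨C (e k), ?_⟩
      have h1 : (C (e 0) * C (e 0) + C (e 1) * C (e 1) : PolyLX) = 1 := by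
        rw [← C_1, ← he]
        simp [dotProduct, Fin.sum_univ_two]
      fin_cases k
      · simp [perp, linFormX_apply]
        linear_combination (-X (Sum.inr 0)) * h1
      · simp [perp, linFormX_apply]
        linear_combination (-X (Sum.inr 1)) * h1
  exact congrArg (fun F => F Q) h

theorem restr_linFormX : restr e (linFormX e) = 0 := by
  apply MvPolynomial.funext
  intro z
  obtain ⟨lam, x, rfl⟩ : ∃ lam x, z = Sum.elim lam x := ⟨_, _, (Sum.elim_comp_inl_inr z).symm⟩
  rw [eval_restr, eval_linFormX, dotProduct_smul, dotProduct_perp]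
  simp

theorem linFormX_dvd_iff (he : dotProduct e e = 1) {Q : PolyLX} :
    linFormX e ∣ Q ↔ restr e Q = 0 := by
  constructor
  · rintro ⟨Q', rfl⟩
    rw [map_mul, restr_linFormX, zero_mul]
  · intro h
    have := linFormX_dvd_sub_restr he Q
    rwa [h, sub_zero] at this

theorem linFormX_ne_zero (he : dotProduct e e = 1) : linFormX e ≠ 0 := by
  intro h
  have := eval_linFormX e 0 e
  rw [h, he] at this
  simp at this

/-- The multiples of the form are the kernel of `restr e`, a homomorphism into a domain. -/
theorem linFormX_prime (he : dotProduct e e = 1) : Prime (linFormX e) := by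
  refine ⟨linFormX_ne_zero he, ?_, ?_⟩
  · intro h
    have := (linFormX_dvd_iff he).1 (h.dvd (a := 1))
    simp at this
  · intro a b hab
    rw [linFormX_dvd_iff he, map_mul] at hab
    rcases mul_eq_zero.1 hab with h | h
    · exact Or.inl ((linFormX_dvd_iff he).2 h)
    · exact Or.inr ((linFormX_dvd_iff he).2 h)

theorem linFormX_dvd_of_eval (he : dotProduct e e = 1) {Q : PolyLX}
    (h : ∀ lam : Fin 2 → ℂ, ∀ s : ℂ, s ≠ 0 → eval (Sum.elim lam (s • perp e)) Q = 0) :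
    linFormX e ∣ Q := by
  rw [linFormX_dvd_iff he]
  have hp : dotProduct (perp e) (perp e) = 1 := by
    rw [← he]; simp [perp, dotProduct, Fin.sum_univ_two]; ring
  -- Multiplying by (e⊥, x) takes care of the excluded point s = 0, where the local expansions used
  -- later have a pole.
  have h1 : restr e Q * linFormX (perp e) = 0 := by
    apply MvPolynomial.funext
    intro z
    obtain ⟨lam, x, rfl⟩ : ∃ lam x, z = Sum.elim lam x := ⟨_, _, (Sum.elim_comp_inl_inr z).symm⟩
    rw [map_mul, eval_restr, eval_linFormX]
    by_cases hs : dotProduct (perp e) x = 0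
    · simp [hs]
    · rw [h lam _ hs]; simp
  exact (mul_eq_zero.1 h1).resolve_right (linFormX_ne_zero hp)

theorem eval_eq_zero_of_linFormX_dvd {Q : PolyLX} (h : linFormX e ∣ Q) (lam : Fin 2 → ℂ)
    {x : Fin 2 → ℂ} (hx : dotProduct e x = 0) : eval (Sum.elim lam x) Q = 0 := by
  obtain ⟨Q', rfl⟩ := h
  rw [map_mul, eval_linFormX, hx, zero_mul]

end Restriction

/-! ### Taylor expansions across a line. -/

section Jets

open PowerSeries

/-- The Taylor expansion of `t ↦ P(λ, x + t v)`. -/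
noncomputable def lineSubst (lam x v : Fin 2 → ℂ) : PolyLX →ₐ[ℂ] ℂ⟦X⟧ :=
  MvPolynomial.aeval (Sum.elim (fun k => C (lam k)) (fun k => C (x k) + C (v k) * X))

/-- The power series of `t ↦ e^{c t}`. -/
noncomputable def expSeries (c : ℂ) : ℂ⟦X⟧ := PowerSeries.mk fun n => c ^ n / n.factorial

theorem derivative_expSeries (c : ℂ) : d⁄dX ℂ (expSeries c) = C c * expSeries c := by
  ext n
  rw [coeff_derivative, coeff_C_mul, expSeries, coeff_mk, coeff_mk, Nat.factorial_succ]
  have h1 : (n.factorial : ℂ) ≠ 0 := by exact_mod_cast n.factorial_ne_zero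
  have h2 : (n : ℂ) + 1 ≠ 0 := by exact_mod_cast n.succ_ne_zero
  push_cast
  field_simp
  ring

/-- The Taylor expansion of `t ↦ P(λ, x + t v) e^{(λ, v) t}`. -/
noncomputable def jet (lam x v : Fin 2 → ℂ) : PolyLX →ₗ[ℂ] ℂ⟦X⟧ :=
  (LinearMap.mulRight ℂ (expSeries (dotProduct lam v))) ∘ₗ (lineSubst lam x v).toLinearMap

theorem jet_apply (lam x v : Fin 2 → ℂ) (P : PolyLX) :
    jet lam x v P = lineSubst lam x v P * expSeries (dotProduct lam v) := rfl

theorem jet_mul (lam x v : Fin 2 → ℂ) (f P : PolyLX) :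
    jet lam x v (f * P) = lineSubst lam x v f * jet lam x v P := by
  rw [jet_apply, jet_apply, map_mul, mul_assoc]

theorem derivative_lineSubst (lam x v : Fin 2 → ℂ) (P : PolyLX) :
    d⁄dX ℂ (lineSubst lam x v P) = lineSubst lam x v (dX v P) := by
  induction P using MvPolynomial.induction_on with
  | C a =>
    rw [lineSubst, MvPolynomial.aeval_C]
    simp
  | add p q hp hq => simp only [map_add, hp, hq]
  | mul_X p i hp =>
    have hX : d⁄dX ℂ (lineSubst lam x v (MvPolynomial.X i)) =
        lineSubst lam x v (dX v (MvPolynomial.X i)) := by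
      rcases i with k | k
      · simp [lineSubst, dX_apply, MvPolynomial.pderiv_X]
      · fin_cases k <;>
          simp [lineSubst, dX_apply, MvPolynomial.pderiv_X]
    simp only [map_mul, Derivation.leibniz, smul_eq_mul, map_add, hp, hX]

theorem derivative_jet (lam x v : Fin 2 → ℂ) (P : PolyLX) :
    d⁄dX ℂ (jet lam x v P) = jet lam x v (twX v P) := by
  have h : lineSubst lam x v (linFormLam v) = C (dotProduct lam v) := by
    simp [linFormLam_apply, lineSubst, dotProduct, Fin.sum_univ_two, mul_comm]
  rw [twX_apply, map_add, jet_mul, h, jet_apply, jet_apply, Derivation.leibniz,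
    derivative_expSeries, derivative_lineSubst, smul_eq_mul, smul_eq_mul]
  ring

theorem constantCoeff_lineSubst (lam x v : Fin 2 → ℂ) (P : PolyLX) :
    constantCoeff (lineSubst lam x v P) = MvPolynomial.eval (Sum.elim lam x) P := by
  have h : (constantCoeff (R := ℂ)).comp (lineSubst lam x v).toRingHom =
      MvPolynomial.eval (Sum.elim lam x) := by
    apply MvPolynomial.ringHom_ext
    · intro r; simp [lineSubst]
    · rintro (k | k) <;> simp [lineSubst]
  exact congrArg (fun F => F P) h

theorem constantCoeff_jet (lam x v : Fin 2 → ℂ) (P : PolyLX) :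
    constantCoeff (jet lam x v P) = MvPolynomial.eval (Sum.elim lam x) P := by
  rw [jet_apply, map_mul, constantCoeff_lineSubst, expSeries,
    ← coeff_zero_eq_constantCoeff_apply (PowerSeries.mk _), coeff_mk]
  simp

theorem coeff_jet (lam x v : Fin 2 → ℂ) (P : PolyLX) (r : ℕ) :
    coeff r (jet lam x v P) * r.factorial =
      MvPolynomial.eval (Sum.elim lam x) ((twX v ^ r) P) := by
  induction r generalizing P with
  | zero => simp [constantCoeff_jet]
  | succ r ih =>
    rw [pow_succ, Module.End.mul_apply, ← ih, ← derivative_jet, coeff_derivative,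
      Nat.factorial_succ]
    push_cast
    ring

theorem coeff_jet_eq_zero_iff (lam x v : Fin 2 → ℂ) (P : PolyLX) (r : ℕ) :
    coeff r (jet lam x v P) = 0 ↔ MvPolynomial.eval (Sum.elim lam x) ((twX v ^ r) P) = 0 := by
  rw [← coeff_jet, mul_eq_zero]
  simp [r.factorial_ne_zero]

end Jets

/-! ### Quasi-invariant polynomials. -/

section QuasiInvariance

/-- `P e^{(λ, x)}` has vanishing normal derivatives of orders `1, 3, …, 2m - 1` along the line
`(e, x) = 0`. -/
def QuasiInvAlong (e : Fin 2 → ℂ) (m : ℕ) (P : PolyLX) : Prop :=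
  ∀ s : ℕ, 1 ≤ s → s ≤ m → linFormX e ∣ (twX e ^ (2 * s - 1)) P

variable {e : Fin 2 → ℂ} {m : ℕ} {P : PolyLX}

theorem QuasiInvAlong.oddVanish (h : QuasiInvAlong e m P) (lam : Fin 2 → ℂ) (s : ℂ) :
    OddVanish (2 * m) (jet lam (s • perp e) e P) := by
  intro k hk hkm
  obtain ⟨r, rfl⟩ := hk
  rw [coeff_jet_eq_zero_iff]
  apply eval_eq_zero_of_linFormX_dvd (h (r + 1) (by omega) (by omega))
  rw [dotProduct_smul, dotProduct_perp, smul_zero]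

theorem quasiInvAlong_of_oddVanish (he : dotProduct e e = 1)
    (h : ∀ lam : Fin 2 → ℂ, ∀ s : ℂ, s ≠ 0 → OddVanish (2 * m) (jet lam (s • perp e) e P)) :
    QuasiInvAlong e m P := by
  intro r hr1 hr2
  apply linFormX_dvd_of_eval he
  intro lam s hs
  rw [← coeff_jet_eq_zero_iff]
  exact h lam s hs _ ⟨r - 1, by omega⟩ (by omega)

/-- Derivatives along the line preserve quasi-invariance. -/
theorem QuasiInvAlong.twX_perp (h : QuasiInvAlong e m P) :
    QuasiInvAlong e m (twX (perp e) P) := by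
  intro s hs1 hs2
  obtain ⟨Q, hQ⟩ := h s hs1 hs2
  rw [twX_pow_comm e (twX_comm e (perp e)), hQ, twX_mul, dX_linFormX, dotProduct_comm, dotProduct_perp]
  exact ⟨twX (perp e) Q, by simp⟩

end QuasiInvariance

/-! ### Total degree estimates. -/

section Degrees

open MvPolynomial

theorem totalDegree_pderiv_le (i : Fin 2 ⊕ Fin 2) (P : PolyLX) :
    (pderiv i P).totalDegree ≤ P.totalDegree - 1 := by
  conv_lhs => rw [P.as_sum, map_sum]
  refine totalDegree_finsetSum_le fun s hs => ?_
  rw [pderiv_monomial]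
  by_cases h : s i = 0
  · simp [h]
  · refine (totalDegree_monomial_le _ _).trans ?_
    have h1 := le_totalDegree hs
    have h2 : (s - Finsupp.single i 1) + Finsupp.single i 1 = s := by
      ext j
      by_cases hj : i = j
      · subst hj; simp; omega
      · simp [hj]
    rw [← h2, Finsupp.sum_add_index' (by simp) (by simp), Finsupp.sum_single_index rfl] at h1
    change ((s - Finsupp.single i 1).sum fun _ e => e) ≤ _
    omega

theorem totalDegree_X_mul_pderiv_le (k i : Fin 2 ⊕ Fin 2) (P : PolyLX) (h : 0 < P.totalDegree) :
    (X k * pderiv i P).totalDegree ≤ P.totalDegree := by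
  refine (totalDegree_mul _ _).trans ?_
  rw [totalDegree_X]
  have := totalDegree_pderiv_le i P
  omega

theorem isHomogeneous_linFormX (e : Fin 2 → ℂ) : (linFormX e).IsHomogeneous 1 := by
  rw [linFormX_apply]
  exact ((isHomogeneous_C_mul_X _ _)).add (isHomogeneous_C_mul_X _ _)

theorem isHomogeneous_linFormLam (e : Fin 2 → ℂ) : (linFormLam e).IsHomogeneous 1 := by
  rw [linFormLam_apply]
  exact ((isHomogeneous_C_mul_X _ _)).add (isHomogeneous_C_mul_X _ _)

end Degrees

/-! ### Polarization and derivations of products of linear forms. -/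

section Polarization

open MvPolynomial

/-- The derivation `∑ λ_k ∂/∂x_k`. -/
noncomputable def polarX : Derivation ℂ PolyLX PolyLX :=
  (X (Sum.inl 0) : PolyLX) • pderiv (Sum.inr 0) + (X (Sum.inl 1) : PolyLX) • pderiv (Sum.inr 1)

theorem polarX_apply (P : PolyLX) :
    polarX P = X (Sum.inl 0) * pderiv (Sum.inr 0) P + X (Sum.inl 1) * pderiv (Sum.inr 1) P := by
  simp [polarX]

theorem polarX_linFormX (e : Fin 2 → ℂ) : polarX (linFormX e) = linFormLam e := by
  rw [polarX_apply, linFormX_apply, linFormLam_apply]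
  simp [pderiv_X]
  ring

theorem polarX_linFormLam (e : Fin 2 → ℂ) : polarX (linFormLam e) = 0 := by
  rw [polarX_apply, linFormLam_apply]
  simp [pderiv_X]

theorem derivation_iterate_mul {A : Type*} [CommRing A] [Algebra ℂ A] (D : Derivation ℂ A A)
    {l c : A} (hl : D l = c) (hc : D c = 0) (f : A) (r : ℕ) :
    D^[r + 1] (l * f) = l * D^[r + 1] f + (r + 1) * c * D^[r] f := by
  induction r with
  | zero => simp [hl]; ring
  | succ r ih =>
    rw [Function.iterate_succ_apply', ih, map_add, Derivation.leibniz, Derivation.leibniz,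
      Derivation.leibniz, hl, hc, ← Function.iterate_succ_apply' D (r + 1) f,
      ← Function.iterate_succ_apply' D r f]
    simp
    ring

theorem derivation_iterate_linear_mul {A : Type*} [CommRing A] [Algebra ℂ A]
    (D : Derivation ℂ A A) {l c f g : A} (hl : D l = c) (hc : D c = 0) {n : ℕ}
    (hf : D^[n] f = n.factorial * g) (hg : D g = 0) :
    D^[n + 1] (l * f) = (n + 1).factorial * (c * g) ∧ D (c * g) = 0 := by
  constructor
  · rw [derivation_iterate_mul D hl hc, Function.iterate_succ_apply', hf, Derivation.leibniz, hg,
      Nat.factorial_succ]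
    simp
    ring
  · rw [Derivation.leibniz, hc, hg]; simp

/-- D kills every c_i, so with as many derivations as linear factors each factor must be
differentiated exactly once; the factorial counts the orders. -/
theorem derivation_iterate_prod {A ι : Type*} [CommRing A] [Algebra ℂ A] [DecidableEq ι]
    (D : Derivation ℂ A A) (l c : ι → A) (hl : ∀ i, D (l i) = c i) (hc : ∀ i, D (c i) = 0)
    (m : ι → ℕ) (s : Finset ι) :
    D^[∑ i ∈ s, m i] (∏ i ∈ s, l i ^ m i) =
        ((∑ i ∈ s, m i).factorial : A) * ∏ i ∈ s, c i ^ m i ∧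
      D (∏ i ∈ s, c i ^ m i) = 0 := by
  induction s using Finset.induction_on with
  | empty => simp
  | insert a s ha ih =>
    rw [prod_insert ha, prod_insert ha, sum_insert ha]
    generalize m a = k
    induction k with
    | zero => simpa using ih
    | succ k ihk =>
      have := derivation_iterate_linear_mul D (hl a) (hc a) ihk.1 ihk.2
      rw [show k + 1 + ∑ i ∈ s, m i = k + ∑ i ∈ s, m i + 1 by ring, pow_succ', pow_succ',
        mul_assoc, mul_assoc]
      exact this

/-- The logarithmic derivative of a product, without denominators. -/
theorem exists_derivation_prod {A ι : Type*} [CommRing A] [Algebra ℂ A] [DecidableEq ι]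
    (D : Derivation ℂ A A) (l : ι → A) (m : ι → ℕ) (s : Finset ι) :
    D (∏ i ∈ s, l i ^ m i) = ∑ i ∈ s, (m i : A) * D (l i) *
      (l i ^ (m i - 1) * ∏ j ∈ s.erase i, l j ^ m j) := by
  induction s using Finset.induction_on with
  | empty => simp
  | insert a s ha ih =>
    rw [prod_insert ha, Derivation.leibniz, ih, sum_insert ha, erase_insert ha,
      Derivation.leibniz_pow, smul_eq_mul, smul_eq_mul, mul_sum, add_comm]
    congr 1
    · simp; ring
    · refine sum_congr rfl fun i hi => ?_
      have hne : a ≠ i := fun h => ha (h ▸ hi)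
      rw [erase_insert_of_ne hne, prod_insert (by simp [ha])]
      ring

end Polarization

/-! ### The gauged Calogero-Moser operator near a line. -/

section SingularLaplacian

open MvPolynomial

variable {κ : Type*} [Fintype κ] [DecidableEq κ]

/-- The gauged Calogero-Moser operator on polynomial factors: `R j` stands for the quotient of
`twX (e j) P` by the linear form of `e j`. The constant `-(λ, λ)` is included. -/
noncomputable def singLaplacian (m : κ → ℕ) (P : PolyLX) (R : κ → PolyLX) : PolyLX :=
  cov (Sum.inr 0) (cov (Sum.inr 0) P) + cov (Sum.inr 1) (cov (Sum.inr 1) P) -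
    (X (Sum.inl 0) ^ 2 + X (Sum.inl 1) ^ 2) * P - 2 * ∑ j, (m j : PolyLX) * R j

theorem sum_cov_sq {e : Fin 2 → ℂ} (he : dotProduct e e = 1) (P : PolyLX) :
    cov (Sum.inr 0) (cov (Sum.inr 0) P) + cov (Sum.inr 1) (cov (Sum.inr 1) P) =
      twX e (twX e P) + twX (perp e) (twX (perp e) P) := by
  have h1 : (C (e 0) * C (e 0) + C (e 1) * C (e 1) : PolyLX) = 1 := by
    rw [← C_1, ← he]
    simp [dotProduct, Fin.sum_univ_two]
  simp only [twX, perp, LinearMap.add_apply, LinearMap.smul_apply, map_add, map_smul,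
    Matrix.cons_val_zero, Matrix.cons_val_one]
  rw [cov_comm (Sum.inr 1) (Sum.inr 0)]
  simp only [MvPolynomial.smul_eq_C_mul, C_neg]
  linear_combination (-(cov (Sum.inr 0) (cov (Sum.inr 0) P)) -
    cov (Sum.inr 1) (cov (Sum.inr 1) P)) * h1

theorem twX_eq_add {e : Fin 2 → ℂ} (he : dotProduct e e = 1) (v : Fin 2 → ℂ) (P : PolyLX) :
    twX v P = C (dotProduct v e) * twX e P + C (dotProduct v (perp e)) * twX (perp e) P := by
  conv_lhs => rw [eq_add_perp he v]
  rw [dotProduct_comm v e, dotProduct_comm v (perp e)]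
  simp only [twX_apply', Pi.add_apply, Pi.smul_apply, smul_eq_mul, C_add, C_mul]
  ring

variable (e : κ → Fin 2 → ℂ) (m : κ → ℕ)

/-- The tangents of the angles between `e j` and the line orthogonal to `e i`. -/
noncomputable def slope (i j : κ) : ℂ := dotProduct (e j) (e i) / dotProduct (e j) (perp (e i))

variable {e m}

open PowerSeries in
/-- The power series of `(s + c t)⁻¹`. -/
noncomputable def invLinear (s c : ℂ) : ℂ⟦X⟧ := PowerSeries.mk fun n => (-c) ^ n / s ^ (n + 1)

open PowerSeries in
theorem invLinear_spec {s : ℂ} (hs : s ≠ 0) (c : ℂ) :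
    (PowerSeries.C s + PowerSeries.C c * PowerSeries.X) * invLinear s c = 1 := by
  ext n
  rw [add_mul, map_add, mul_assoc, PowerSeries.coeff_C_mul, PowerSeries.coeff_C_mul]
  rcases n with _ | n
  · simp [invLinear, hs]
  · rw [PowerSeries.coeff_succ_X_mul, invLinear, PowerSeries.coeff_mk, PowerSeries.coeff_mk]
    simp [PowerSeries.coeff_one]
    field_simp
    ring

theorem lineSubst_linFormX_self {v : Fin 2 → ℂ} (hv : dotProduct v v = 1) (lam : Fin 2 → ℂ)
    (s : ℂ) : lineSubst lam (s • perp v) v (linFormX v) = PowerSeries.X := by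
  have h1 : (PowerSeries.C (v 0) * PowerSeries.C (v 0) +
      PowerSeries.C (v 1) * PowerSeries.C (v 1) : PowerSeries ℂ) = 1 := by
    rw [← map_one PowerSeries.C, ← hv]
    simp [dotProduct, Fin.sum_univ_two]
  simp [linFormX_apply, lineSubst, perp]
  linear_combination PowerSeries.X * h1

theorem lineSubst_linFormX {v w : Fin 2 → ℂ} (hw : dotProduct w (perp v) ≠ 0)
    (lam : Fin 2 → ℂ) (s : ℂ) :
    lineSubst lam (s • perp v) v (linFormX w) = PowerSeries.C (dotProduct w (perp v)) *
      (PowerSeries.C s + PowerSeries.C (dotProduct w v / dotProduct w (perp v)) *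
        PowerSeries.X) := by
  rw [mul_add, ← mul_assoc, ← map_mul, ← map_mul, mul_div_cancel₀ _ hw]
  simp [linFormX_apply, lineSubst, perp, dotProduct,
    Fin.sum_univ_two]
  ring

open PowerSeries in
/-- The first order coefficient of the operator near the line orthogonal to `e i`. -/
noncomputable def tangentCoeff (e : κ → Fin 2 → ℂ) (m : κ → ℕ) (i : κ) (s : ℂ) : ℂ⟦X⟧ :=
  ∑ j ∈ univ.erase i, PowerSeries.C ((m j : ℂ) * slope e i j) * invLinear s (slope e i j)

open PowerSeries in
/-- The coefficient of the derivative along the line orthogonal to `e i`. -/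
noncomputable def alongCoeff (e : κ → Fin 2 → ℂ) (m : κ → ℕ) (i : κ) (s : ℂ) : ℂ⟦X⟧ :=
  ∑ j ∈ univ.erase i, PowerSeries.C (m j : ℂ) * invLinear s (slope e i j)

theorem alongCoeff_add {s : ℂ} (hs : s ≠ 0) (i : κ) :
    PowerSeries.C s * alongCoeff e m i s + PowerSeries.X * tangentCoeff e m i s =
      PowerSeries.C (∑ j ∈ univ.erase i, (m j : ℂ)) := by
  rw [alongCoeff, tangentCoeff, mul_sum, mul_sum, ← sum_add_distrib, map_sum]
  refine sum_congr rfl fun j _ => ?_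
  have := invLinear_spec hs (slope e i j)
  rw [map_mul]
  linear_combination PowerSeries.C (m j : ℂ) * this

theorem coeff_tangentCoeff (i : κ) (s : ℂ) (r : ℕ) :
    PowerSeries.coeff r (tangentCoeff e m i s) =
      (-1) ^ r / s ^ (r + 1) * ∑ j, (m j : ℂ) * slope e i j ^ (r + 1) := by
  -- The denominator is zero, so the quotient is zero by convention; this lets the sum run over all
  -- j.
  have h0 : slope e i i = 0 := by rw [slope, dotProduct_perp, div_zero]
  rw [← add_sum_erase univ _ (mem_univ i), h0, tangentCoeff, map_sum]
  simp only [zero_pow (Nat.succ_ne_zero r), mul_zero, zero_add, mul_sum]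
  refine sum_congr rfl fun j _ => ?_
  rw [PowerSeries.coeff_C_mul, invLinear, PowerSeries.coeff_mk, neg_pow]
  ring

/-- By the geometric series, the coefficient of order 2r - 2 is a non-zero multiple of the power sum
of order 2r - 1 of the slopes. This is the bridge between parity and the cotangent conditions. -/
theorem tangentCoeff_evenVanish_iff {s : ℂ} (hs : s ≠ 0) (i : κ) (M : ℕ) :
    EvenVanish (2 * M) (tangentCoeff e m i s) ↔
      ∀ r : ℕ, 1 ≤ r → r ≤ M → ∑ j, (m j : ℂ) * slope e i j ^ (2 * r - 1) = 0 := by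
  constructor
  · intro h r hr1 hr2
    have := h (2 * r - 2) ⟨r - 1, by omega⟩ (by omega)
    rw [coeff_tangentCoeff, show 2 * r - 2 + 1 = 2 * r - 1 by omega, mul_eq_zero] at this
    refine this.resolve_left ?_
    exact div_ne_zero (pow_ne_zero _ (by norm_num)) (pow_ne_zero _ hs)
  · rintro h _ ⟨k, rfl⟩ hk
    have := h (k + 1) (by omega) (by omega)
    rw [coeff_tangentCoeff, show k + k + 1 = 2 * (k + 1) - 1 by omega, this, mul_zero]

open PowerSeries in
/-- The singular Laplacian preserves quasi-invariance. -/
theorem QuasiInvAlong.singLaplacian (he : ∀ i, dotProduct (e i) (e i) = 1)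
    (hne : ∀ i j, j ≠ i → dotProduct (e j) (perp (e i)) ≠ 0) (i : κ)
    (hcond : ∀ r : ℕ, 1 ≤ r → r ≤ m i → ∑ j, (m j : ℂ) * slope e i j ^ (2 * r - 1) = 0)
    {P : PolyLX} {R : κ → PolyLX} (hP : QuasiInvAlong (e i) (m i) P)
    (hR : ∀ j, m j ≠ 0 → linFormX (e j) * R j = twX (e j) P) :
    QuasiInvAlong (e i) (m i) (singLaplacian m P R) := by
  by_cases hmi : m i = 0
  · intro s hs1 hs2; omega
  apply quasiInvAlong_of_oddVanish (he i)
  intro lam s hs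
  set v := e i with hv
  set J := jet lam (s • perp v) v with hJ
  have hloc := OddVanish.laplacian (κ := dotProduct lam lam) hs (hP.oddVanish lam s) (p₁ := J (R i))
    (by
      rw [derivative_jet, ← hR i hmi, jet_mul, lineSubst_linFormX_self (he i)])
    (hP.twX_perp.oddVanish lam s) (hP.twX_perp.twX_perp.oddVanish lam s)
    ((tangentCoeff_evenVanish_iff hs i (m i)).2 hcond) (alongCoeff_add hs i)
  convert hloc using 1
  -- Away from e_i the form (e_j, x) becomes a unit multiple of s + ct with c the slope, so division
  -- by it is multiplication by `invLinear`. The derivative along e_j is split into its parts along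
  -- e_i and its perpendicular.
  have hRj : ∀ j ∈ univ.erase i, J ((m j : PolyLX) * R j) =
      (PowerSeries.C ((m j : ℂ) * slope e i j) * invLinear s (slope e i j)) * J (twX v P) +
      (PowerSeries.C (m j : ℂ) * invLinear s (slope e i j)) * J (twX (perp v) P) := by
    intro j hj
    by_cases hmj : m j = 0
    · simp [hmj]
    have hji := hne i j (ne_of_mem_erase hj)
    have h1 := congrArg J (hR j hmj)
    rw [hJ, jet_mul, lineSubst_linFormX hji, twX_eq_add (he i), map_add, jet_mul, jet_mul] at h1
    have h2 : ∀ c : ℂ, lineSubst lam (s • perp v) v (MvPolynomial.C c) = PowerSeries.C c := by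
      intro c; simp [lineSubst]
    rw [h2, h2, ← hv, ← hJ] at h1
    have h3 := invLinear_spec hs (slope e i j)
    have h4 : PowerSeries.C (dotProduct (e j) v) =
        PowerSeries.C (dotProduct (e j) (perp v)) * PowerSeries.C (slope e i j) := by
      rw [← map_mul, slope, mul_div_cancel₀ _ hji]
    have h5 : (PowerSeries.C (dotProduct (e j) (perp v)) : ℂ⟦X⟧) ≠ 0 := by
      rw [Ne, map_eq_zero_iff _ PowerSeries.C_injective]; exact hji
    rw [h4] at h1
    have h6 : (PowerSeries.C s + PowerSeries.C (slope e i j) * PowerSeries.X) * J (R j) =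
        PowerSeries.C (slope e i j) * J (twX v P) + J (twX (perp v) P) := by
      apply mul_left_cancel₀ h5
      rw [← mul_assoc]
      exact h1.trans (by ring)
    have h7 : J ((m j : PolyLX) * R j) = PowerSeries.C (m j : ℂ) * J (R j) := by
      rw [hJ, jet_mul]
      simp
    rw [h7, map_mul]
    linear_combination (PowerSeries.C (m j : ℂ) * invLinear s (slope e i j)) * h6 -
      PowerSeries.C (m j : ℂ) * J (R j) * h3
  have hsum : J (∑ j, (m j : PolyLX) * R j) = PowerSeries.C (m i : ℂ) * J (R i) +
      (tangentCoeff e m i s * J (twX v P) + alongCoeff e m i s * J (twX (perp v) P)) := by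
    rw [map_sum, ← add_sum_erase univ _ (mem_univ i), sum_congr rfl hRj, sum_add_distrib,
      tangentCoeff, alongCoeff, sum_mul, sum_mul, hJ, jet_mul]
    simp
  have h8 : lineSubst lam (s • perp v) v
      (MvPolynomial.X (Sum.inl 0) ^ 2 + MvPolynomial.X (Sum.inl 1) ^ 2) =
      PowerSeries.C (dotProduct lam lam) := by
    simp [lineSubst, dotProduct, Fin.sum_univ_two]
    ring
  rw [BakerAkhiezer.singLaplacian, sum_cov_sq (he i), ← hJ, derivative_jet, derivative_jet, ← hJ]
  rw [map_sub, map_sub, map_add, two_mul, map_add, hsum, hJ, jet_mul, h8, ← hJ, map_mul,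
    show (PowerSeries.C (2 : ℂ) : ℂ⟦X⟧) = 2 from map_ofNat _ 2]
  ring

end SingularLaplacian

/-! ### Construction of the BA function from the cotangent conditions. -/

section Existence

open MvPolynomial

variable {κ : Type*} [Fintype κ] [DecidableEq κ]

/-- `P = T + lower`, where the lower part has total degree less than `n`. -/
def EqUpToLower (n : ℕ) (P T : PolyLX) : Prop := (P - T).totalDegree < n

theorem totalDegree_natCast_mul_le (k : ℕ) (P : PolyLX) :
    ((k : PolyLX) * P).totalDegree ≤ P.totalDegree := by
  rw [← C_eq_coe_nat, ← MvPolynomial.smul_eq_C_mul]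
  exact totalDegree_smul_le _ _

theorem totalDegree_polarX_le (P : PolyLX) : (polarX P).totalDegree ≤ P.totalDegree := by
  by_cases h : P.totalDegree = 0
  · rw [totalDegree_eq_zero_iff_eq_C.1 h]
    simp
  · rw [polarX_apply]
    refine (totalDegree_add _ _).trans (max_le ?_ ?_) <;>
      exact totalDegree_X_mul_pderiv_le _ _ _ (by omega)

theorem totalDegree_dX_le (v : Fin 2 → ℂ) (P : PolyLX) :
    (dX v P).totalDegree ≤ P.totalDegree - 1 := by
  have h : ∀ (c : ℂ) (i : Fin 2 ⊕ Fin 2), (C c * pderiv i P).totalDegree ≤ P.totalDegree - 1 := by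
    intro c i
    rw [← MvPolynomial.smul_eq_C_mul]
    exact (totalDegree_smul_le _ _).trans (totalDegree_pderiv_le i P)
  rw [dX_apply]
  exact (totalDegree_add _ _).trans (max_le (h _ _) (h _ _))

theorem quotient_totalDegree {e : Fin 2 → ℂ} (he : dotProduct e e = 1) {Q B : PolyLX} {n : ℕ}
    (h : linFormX e * Q = B) (hB : B.totalDegree ≤ n) (hn : 0 < n) : Q.totalDegree < n := by
  by_cases hQ : Q = 0
  · simpa [hQ] using hn
  · have h1 := totalDegree_mul_of_isDomain (linFormX_ne_zero he) hQ
    rw [(isHomogeneous_linFormX e).totalDegree (linFormX_ne_zero he), h] at h1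
    omega

/-- The terms that can keep the total degree 2N are 2 ∑ λ_k ∂P/∂x_k and -2 ∑ m_j (e_j, λ) P/(e_j,
x). On δS the second is -2 S times `polarX δ`, by the logarithmic derivative of δ, and cancels the
part of the first in which δ is differentiated. -/
theorem singLaplacian_eqUpToLower {e : κ → Fin 2 → ℂ} {m : κ → ℕ}
    (he : ∀ i, dotProduct (e i) (e i) = 1) {N : ℕ} (hN : 0 < N) {P S : PolyLX} {R : κ → PolyLX}
    (hdeg : ((∏ i, linFormX (e i) ^ m i) * S).totalDegree ≤ 2 * N)
    (hP : EqUpToLower (2 * N) P ((∏ i, linFormX (e i) ^ m i) * S))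
    (hR : ∀ j, m j ≠ 0 → linFormX (e j) * R j = twX (e j) P) :
    EqUpToLower (2 * N) (singLaplacian m P R) ((∏ i, linFormX (e i) ^ m i) * (2 * polarX S)) := by
  set δ := ∏ i, linFormX (e i) ^ m i with hδ
  set L := P - δ * S with hL
  have hPL : P = δ * S + L := by rw [hL]; ring
  have hPdeg : P.totalDegree ≤ 2 * N := by
    rw [hPL]
    exact (totalDegree_add _ _).trans (max_le hdeg hP.le)
  set δ' : κ → PolyLX := fun i =>
    linFormX (e i) ^ (m i - 1) * ∏ j ∈ univ.erase i, linFormX (e j) ^ m j with hδ'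
  have hfac : ∀ i, m i ≠ 0 → δ = linFormX (e i) * δ' i := by
    intro i hi
    simp only [hδ, hδ']
    rw [← mul_prod_erase univ _ (mem_univ i), ← mul_assoc, mul_pow_sub_one hi]
  have hDδ : polarX δ = ∑ i, (m i : PolyLX) * linFormLam (e i) * δ' i := by
    rw [hδ, exists_derivation_prod polarX]
    simp only [polarX_linFormX, hδ']
  -- R' j is R j without its top part; (e_j, x) R' j is ∂_{e_j} P + (e_j, λ) L, of degree at most
  -- 2N, so R' j has degree below 2N.
  set R' : κ → PolyLX := fun j => R j - linFormLam (e j) * δ' j * S with hR'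
  have hR'deg : ∀ j, m j ≠ 0 → (R' j).totalDegree < 2 * N := by
    intro j hj
    refine quotient_totalDegree (he j) (Q := R' j)
      (B := dX (e j) P + linFormLam (e j) * L) ?_ ?_ (by omega)
    · simp only [hR']
      rw [mul_sub, hR j hj, twX_apply]
      rw [show linFormX (e j) * (linFormLam (e j) * δ' j * S) =
        linFormLam (e j) * ((linFormX (e j) * δ' j) * S) by ring, ← hfac j hj, hL]
      ring
    · refine (totalDegree_add _ _).trans (max_le ?_ ?_)
      · have := totalDegree_dX_le (e j) P
        omega
      · refine (totalDegree_mul _ _).trans ?_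
        have h1 := (isHomogeneous_linFormLam (e j)).totalDegree_le
        have h2 : L.totalDegree < 2 * N := hP
        omega
  have hexp : singLaplacian m P R - δ * (2 * polarX S) =
      (pderiv (Sum.inr 0) (pderiv (Sum.inr 0) P) + pderiv (Sum.inr 1) (pderiv (Sum.inr 1) P)) +
      ((2 : ℕ) : PolyLX) * polarX L - ((2 : ℕ) : PolyLX) * ∑ j, (m j : PolyLX) * R' j := by
    have h1 : ∑ j, (m j : PolyLX) * R' j = ∑ j, (m j : PolyLX) * R j - polarX δ * S := by
      rw [hDδ, sum_mul, ← sum_sub_distrib]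
      refine sum_congr rfl fun j _ => ?_
      simp only [hR']
      ring
    have h2 : polarX L = polarX P - (polarX δ * S + δ * polarX S) := by
      rw [hL, map_sub, Derivation.leibniz, smul_eq_mul, smul_eq_mul]
      ring
    rw [h1, h2, singLaplacian]
    simp only [cov_apply, map_add, Derivation.leibniz, smul_eq_mul, Sum.swap_inr, polarX_apply,
      pderiv_X]
    simp
    ring
  rw [EqUpToLower, hexp]
  refine (totalDegree_sub _ _).trans_lt (max_lt ((totalDegree_add _ _).trans_lt (max_lt
    ((totalDegree_add _ _).trans_lt (max_lt ?_ ?_)) ?_)) ?_)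
  · have h1 := totalDegree_pderiv_le (Sum.inr 0) P
    have h2 := totalDegree_pderiv_le (Sum.inr 0) (pderiv (Sum.inr 0) P)
    omega
  · have h1 := totalDegree_pderiv_le (Sum.inr 1) P
    have h2 := totalDegree_pderiv_le (Sum.inr 1) (pderiv (Sum.inr 1) P)
    omega
  · exact (totalDegree_natCast_mul_le _ _).trans_lt ((totalDegree_polarX_le L).trans_lt hP)
  · refine (totalDegree_natCast_mul_le _ _).trans_lt ?_
    refine lt_of_le_of_lt (b := 2 * N - 1) (totalDegree_finsetSum_le fun j _ => ?_) (by omega)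
    by_cases hj : m j = 0
    · simp [hj]
    · have := hR'deg j hj
      have := totalDegree_natCast_mul_le (m j) (R' j)
      omega

theorem isHomogeneous_pderiv_mul_X {n : ℕ} {P : PolyLX} (h : P.IsHomogeneous n)
    (k i : Fin 2 ⊕ Fin 2) : (X k * pderiv i P).IsHomogeneous n := by
  rcases n with _ | n
  · rw [← totalDegree_zero_iff_isHomogeneous, totalDegree_eq_zero_iff_eq_C] at h
    rw [h, pderiv_C, mul_zero]
    exact isHomogeneous_zero _ _ _
  · rw [add_comm]
    exact (isHomogeneous_X _ _).mul h.pderiv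

theorem isHomogeneous_polarX {n : ℕ} {P : PolyLX} (h : P.IsHomogeneous n) :
    (polarX P).IsHomogeneous n := by
  rw [polarX_apply]
  exact (isHomogeneous_pderiv_mul_X h _ _).add (isHomogeneous_pderiv_mul_X h _ _)

theorem isHomogeneous_polarX_iterate {n : ℕ} {P : PolyLX} (h : P.IsHomogeneous n) (k : ℕ) :
    (polarX^[k] P).IsHomogeneous n := by
  induction k with
  | zero => exact h
  | succ k ih =>
    rw [Function.iterate_succ_apply']
    exact isHomogeneous_polarX ih

omit [DecidableEq κ] in
theorem isHomogeneous_prod_linFormX (e : κ → Fin 2 → ℂ) (m : κ → ℕ) :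
    (∏ i, linFormX (e i) ^ m i).IsHomogeneous (∑ i, m i) := by
  refine IsHomogeneous.prod _ _ _ fun i _ => ?_
  simpa using (isHomogeneous_linFormX (e i)).pow (m i)

theorem QuasiInvAlong.smul {e : Fin 2 → ℂ} {m : ℕ} {P : PolyLX} (h : QuasiInvAlong e m P) (c : ℂ) :
    QuasiInvAlong e m (c • P) := by
  intro s hs1 hs2
  rw [map_smul, MvPolynomial.smul_eq_C_mul]
  exact (h s hs1 hs2).mul_left _

theorem pow_dvd_twX_mul (e : Fin 2 → ℂ) (l : PolyLX) (k : ℕ) (Q : PolyLX) :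
    l ^ k ∣ twX e (l ^ (k + 1) * Q) := by
  rw [twX_mul, Derivation.leibniz_pow]
  refine dvd_add (Dvd.dvd.mul_right ?_ _) ?_
  · exact ⟨(k + 1) • dX e l, by simp; ring⟩
  · exact Dvd.dvd.mul_right (pow_dvd_pow _ (Nat.le_succ k)) _

theorem dvd_twX_pow (e : Fin 2 → ℂ) (l : PolyLX) (r k : ℕ) (hk : k < r) (Q : PolyLX) :
    l ∣ (twX e ^ k) (l ^ r * Q) := by
  induction k generalizing r Q with
  | zero => exact Dvd.dvd.mul_right (dvd_pow_self _ (by omega)) _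
  | succ k ih =>
    obtain ⟨r, rfl⟩ : ∃ r', r = r' + 1 := ⟨r - 1, by omega⟩
    obtain ⟨Q', hQ'⟩ := pow_dvd_twX_mul e l r Q
    rw [pow_succ, Module.End.mul_apply, hQ']
    exact ih r (by omega) Q'

/-- The square of δ = ∏ (e_i, x)^(m_i) is quasi-invariant because it vanishes to order 2m_i on each
line. Each application of the singular Laplacian replaces the second factor of the top part by twice
its polarization, and the N-th polarization of δ is N! ∏ (e_i, λ)^(m_i). -/
theorem exists_quasiInv {e : κ → Fin 2 → ℂ} {m : κ → ℕ}
    (he : ∀ i, dotProduct (e i) (e i) = 1)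
    (hne : ∀ i j, j ≠ i → dotProduct (e j) (perp (e i)) ≠ 0)
    (hcond : ∀ i, ∀ r : ℕ, 1 ≤ r → r ≤ m i → ∑ j, (m j : ℂ) * slope e i j ^ (2 * r - 1) = 0) :
    ∃ P : PolyLX, (∀ i, QuasiInvAlong (e i) (m i) P) ∧ P.totalDegree ≤ 2 * ∑ i, m i ∧
      homogeneousComponent (2 * ∑ i, m i) P = highestTerm e m := by
  set N := ∑ i, m i with hN
  -- For N = 0 no remainder has degree strictly below 2N, so P = 1 is treated apart.
  rcases Nat.eq_zero_or_pos N with h0 | hpos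
  · have hm : ∀ i, m i = 0 := fun i => by
      have := Finset.sum_eq_zero_iff.1 (hN.symm.trans h0) i (mem_univ i)
      exact this
    refine ⟨1, fun i s hs1 hs2 => ?_, by simp, ?_⟩
    · rw [hm i] at hs2; omega
    · simp [highestTerm, hm, h0, homogeneousComponent_zero]
  set δ := ∏ i, linFormX (e i) ^ m i with hδ
  have hδh : δ.IsHomogeneous N := isHomogeneous_prod_linFormX e m
  have hSh : ∀ k : ℕ, ((2 : PolyLX) ^ k * polarX^[k] δ).IsHomogeneous N := by
    intro k
    have h2 : (2 : PolyLX) ^ k = C (2 ^ k) := by rw [C_pow, map_ofNat]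
    rw [h2]
    exact IsHomogeneous.C_mul (isHomogeneous_polarX_iterate hδh k) _
  have hTh : ∀ k : ℕ, (δ * ((2 : PolyLX) ^ k * polarX^[k] δ)).IsHomogeneous (2 * N) := by
    intro k
    rw [two_mul]
    exact hδh.mul (hSh k)
  have iter : ∀ k : ℕ, ∃ P : PolyLX, (∀ i, QuasiInvAlong (e i) (m i) P) ∧
      EqUpToLower (2 * N) P (δ * ((2 : PolyLX) ^ k * polarX^[k] δ)) := by
    intro k
    induction k with
    | zero =>
      refine ⟨δ * δ, fun i s hs1 hs2 => ?_, ?_⟩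
      · have : δ * δ = linFormX (e i) ^ (2 * m i) *
            (∏ j ∈ univ.erase i, linFormX (e j) ^ m j) ^ 2 := by
          rw [hδ, ← mul_prod_erase univ _ (mem_univ i)]
          ring
        rw [this]
        exact dvd_twX_pow _ _ _ _ (by omega) _
      · simp [EqUpToLower, hpos]
    | succ k ih =>
      obtain ⟨P, hP1, hP2⟩ := ih
      -- The first normal derivative is divisible by (e_j, x) when m_j ≥ 1. When m_j = 0 the
      -- quotient need not exist, but it is multiplied by zero in the operator.
      have hR : ∀ j, ∃ R, m j ≠ 0 → linFormX (e j) * R = twX (e j) P := by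
        intro j
        by_cases hj : m j = 0
        · exact ⟨0, fun h => absurd hj h⟩
        · obtain ⟨R, hR⟩ := hP1 j 1 le_rfl (by omega)
          exact ⟨R, fun _ => by simpa using hR.symm⟩
      choose R hR using hR
      refine ⟨singLaplacian m P R, fun i => ?_, ?_⟩
      · exact QuasiInvAlong.singLaplacian he hne i (hcond i) (hP1 i) hR
      · have := singLaplacian_eqUpToLower he hpos (hTh k).totalDegree_le hP2 hR
        convert this using 2
        rw [Derivation.leibniz, Function.iterate_succ_apply', pow_succ]
        have h2 : polarX ((2 : PolyLX) ^ k) = 0 := by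
          have : (2 : PolyLX) ^ k = ((2 ^ k : ℕ) : PolyLX) := by push_cast; rfl
          rw [this, Derivation.map_natCast]
        rw [h2]
        simp only [smul_eq_mul, mul_zero, add_zero]
        ring
  obtain ⟨P, hP1, hP2⟩ := iter N
  have htop : δ * ((2 : PolyLX) ^ N * polarX^[N] δ) =
      C ((2 : ℂ) ^ N * N.factorial) * highestTerm e m := by
    have h1 := (derivation_iterate_prod polarX (fun i => linFormX (e i)) (fun i => linFormLam (e i))
      (fun i => polarX_linFormX (e i)) (fun i => polarX_linFormLam (e i)) m univ).1
    rw [← hN, ← hδ] at h1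
    rw [h1, highestTerm, prod_mul_distrib, ← hδ]
    simp only [C_mul, C_pow, map_ofNat, map_natCast]
    ring
  have hc : ((2 : ℂ) ^ N * N.factorial) ≠ 0 :=
    mul_ne_zero (pow_ne_zero _ two_ne_zero) (by exact_mod_cast N.factorial_ne_zero)
  refine ⟨((2 : ℂ) ^ N * N.factorial)⁻¹ • P, fun i => (hP1 i).smul _, ?_, ?_⟩
  · refine (totalDegree_smul_le _ _).trans ?_
    have : P = (P - δ * ((2 : PolyLX) ^ N * polarX^[N] δ)) +
      δ * ((2 : PolyLX) ^ N * polarX^[N] δ) := by ring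
    rw [this]
    exact (totalDegree_add _ _).trans (max_le (le_of_lt hP2) (hTh N).totalDegree_le)
  · have h1 := homogeneousComponent_eq_zero _ _ hP2
    rw [map_sub, homogeneousComponent_eq_self (hTh N), sub_eq_zero, htop] at h1
    rw [map_smul, h1, MvPolynomial.smul_eq_C_mul, ← mul_assoc, ← C_mul, inv_mul_cancel₀ hc, C_1,
      one_mul]

theorem admitsBA_of_quasiInv {ι : Type*} [Fintype ι] {e : ι → Fin 2 → ℂ} {m : ι → ℕ} {P : PolyLX}
    (h1 : ∀ i, QuasiInvAlong (e i) (m i) P) (h2 : P.totalDegree ≤ 2 * ∑ i, m i)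
    (h3 : homogeneousComponent (2 * ∑ i, m i) P = highestTerm e m) : AdmitsBA e m := by
  refine ⟨fun lam x => eval (Sum.elim lam x) P * Complex.exp (dotProduct lam x),
    ⟨P, h2, h3, fun _ _ => rfl⟩, fun i s hs1 hs2 lam x hx => ?_⟩
  rw [dirDeriv_mul_exp, eval_eq_zero_of_linFormX_dvd (h1 i s hs1 hs2) lam hx, zero_mul]

end Existence

/-! ### From slopes to cotangents. -/

section UnitVectors

theorem dotProduct_unitVec_self (θ : ℂ) : dotProduct (unitVec θ) (unitVec θ) = 1 := by
  simp only [unitVec, dotProduct, Fin.sum_univ_two, Matrix.cons_val_zero, Matrix.cons_val_one]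
  linear_combination Complex.sin_sq_add_cos_sq θ

theorem dotProduct_unitVec_perp (θ η : ℂ) :
    dotProduct (unitVec η) (perp (unitVec θ)) = Complex.sin (η - θ) := by
  rw [Complex.sin_sub]
  simp [unitVec, perp, dotProduct, Fin.sum_univ_two]
  ring

theorem slope_unitVec {κ : Type*} (φ : κ → ℂ) (i j : κ) :
    slope (fun i => unitVec (φ i)) i j = Complex.cot (φ j - φ i) := by
  rw [slope, dotProduct_unitVec_perp, Complex.cot_eq_cos_div_sin, Complex.cos_sub]
  simp [unitVec, dotProduct, Fin.sum_univ_two]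

theorem CotCondition.admitsBA {κ : Type*} [Fintype κ] {m : κ → ℕ} {φ : κ → ℂ}
    (hφ : ∀ i j, i ≠ j → Complex.sin (φ j - φ i) ≠ 0) (h : CotCondition m φ) :
    AdmitsBA (fun i => unitVec (φ i)) m := by
  classical
  obtain ⟨P, h1, h2, h3⟩ := exists_quasiInv (e := fun i => unitVec (φ i)) (m := m)
    (fun i => dotProduct_unitVec_self _)
    (fun i j hij => by rw [dotProduct_unitVec_perp]; exact hφ i j hij.symm)
    (fun i r hr1 hr2 => by simpa only [slope_unitVec] using h i r hr1 hr2)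
  exact admitsBA_of_quasiInv h1 h2 h3

end UnitVectors

/-! ### Weighted homogeneous components. -/

section Components

open MvPolynomial

variable {σ M : Type*} [AddCancelCommMonoid M] {w : σ → M}

/-- The weighted homogeneous component of a polynomial. -/
noncomputable abbrev comp (w : σ → M) (n : M) : MvPolynomial σ ℂ →ₗ[ℂ] MvPolynomial σ ℂ :=
  weightedHomogeneousComponent w n

theorem comp_mul {f : MvPolynomial σ ℂ} {a : M} (hf : f.IsWeightedHomogeneous w a) (n : M)
    (Q : MvPolynomial σ ℂ) : comp w (a + n) (f * Q) = f * comp w n Q := by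
  classical
  induction Q using MvPolynomial.induction_on' with
  | monomial d c =>
    have h1 := isWeightedHomogeneous_monomial w d c rfl
    rw [weightedHomogeneousComponent_of_mem (n := a + Finsupp.weight w d) (hf.mul h1),
      weightedHomogeneousComponent_of_mem (n := Finsupp.weight w d) h1]
    simp only [add_right_inj]
    split_ifs <;> simp
  | add p q hp hq => rw [mul_add, map_add, map_add, mul_add, hp, hq]

theorem dvd_comp {f F : MvPolynomial σ ℂ} {a : M} (hf : f.IsWeightedHomogeneous w a) (n : M)
    (h : f ∣ F) : f ∣ comp w n F := by
  classical
  obtain ⟨Q, rfl⟩ := h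
  induction Q using MvPolynomial.induction_on' with
  | monomial d c =>
    have h1 := isWeightedHomogeneous_monomial w d c rfl
    rw [weightedHomogeneousComponent_of_mem (n := a + Finsupp.weight w d) (hf.mul h1)]
    split_ifs <;> simp
  | add p q hp hq => rw [mul_add, map_add]; exact dvd_add hp hq

theorem comp_pderiv (i : σ) (n : M) (Q : MvPolynomial σ ℂ) :
    comp w n (pderiv i Q) = pderiv i (comp w (n + w i) Q) := by
  classical
  induction Q using MvPolynomial.induction_on' with
  | monomial d c =>
    have h1 := isWeightedHomogeneous_monomial w d c rfl
    rw [weightedHomogeneousComponent_of_mem (n := Finsupp.weight w d) h1]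
    by_cases hi : d i = 0
    · have : pderiv i (monomial d c) = 0 := by rw [pderiv_monomial, hi]; simp
      rw [this]
      split_ifs <;> simp [this]
    · have h2 : (d - Finsupp.single i 1) + Finsupp.single i 1 = d := by
        ext j
        by_cases hj : i = j
        · subst hj; simp; omega
        · simp [hj]
      have h3 : Finsupp.weight w d = Finsupp.weight w (d - Finsupp.single i 1) + w i := by
        conv_lhs => rw [← h2]
        rw [map_add, Finsupp.weight_single, one_smul]
      have h4 := isWeightedHomogeneous_monomial w (d - Finsupp.single i 1) (c * (d i : ℂ)) rfl
      rw [pderiv_monomial, weightedHomogeneousComponent_of_mem h4, h3]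
      simp only [add_left_inj]
      split_ifs
      · rw [pderiv_monomial]
      · simp
  | add p q hp hq => simp only [map_add, hp, hq]

theorem eq_zero_of_comp {Q : MvPolynomial σ ℂ} (h : ∀ n, comp w n Q = 0) : Q = 0 := by
  rw [← sum_weightedHomogeneousComponent w Q]
  simp only [h, finsum_zero]

/-- A factor of a weighted homogeneous polynomial by a weighted homogeneous one is weighted
homogeneous, and vanishes if the degrees do not match. -/
theorem comp_factor {f h : MvPolynomial σ ℂ} {a n : M} (hf : f.IsWeightedHomogeneous w a)
    (hf0 : f ≠ 0) (hfh : (f * h).IsWeightedHomogeneous w n) (k : M) (hk : a + k ≠ n) :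
    comp w k h = 0 := by
  have h1 := comp_mul hf k h
  rw [hfh.weightedHomogeneousComponent_ne _ hk] at h1
  exact (mul_eq_zero.1 h1.symm).resolve_left hf0

theorem isWeightedHomogeneous_factor {f h : MvPolynomial σ ℂ} {a n : M}
    (hf : f.IsWeightedHomogeneous w a) (hf0 : f ≠ 0)
    (hfh : (f * h).IsWeightedHomogeneous w (a + n)) : h.IsWeightedHomogeneous w n := by
  classical
  have h1 : h - comp w n h = 0 := by
    apply eq_zero_of_comp (w := w)
    intro k
    rw [map_sub]
    by_cases hk : k = n
    · rw [hk, weightedHomogeneousComponent_eq_self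
        (weightedHomogeneousComponent_isWeightedHomogeneous n h), sub_self]
    · rw [comp_factor hf hf0 hfh k (fun h => hk (add_left_cancel h)),
        (weightedHomogeneousComponent_isWeightedHomogeneous n h).weightedHomogeneousComponent_ne _
          hk, sub_zero]
  rw [sub_eq_zero.1 h1]
  exact weightedHomogeneousComponent_isWeightedHomogeneous n h

theorem eq_zero_of_isWeightedHomogeneous_mul {w : σ → ℕ} {f h : MvPolynomial σ ℂ} {a n : ℕ}
    (hf : f.IsWeightedHomogeneous w a) (hf0 : f ≠ 0) (hfh : (f * h).IsWeightedHomogeneous w n)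
    (hn : n < a) : h = 0 :=
  eq_zero_of_comp fun k => comp_factor hf hf0 hfh k (by omega)

theorem exists_comp_bound (w : σ → ℕ) (Q : MvPolynomial σ ℂ) :
    ∃ B, ∀ n, B ≤ n → comp w n Q = 0 := by
  have h := weightedHomogeneousComponent_finsupp (w := w) Q
  obtain ⟨B, hB⟩ := h.bddAbove
  refine ⟨B + 1, fun n hn => ?_⟩
  by_contra hne
  have := hB hne
  omega

theorem eq_sum_comp {w : σ → ℕ} {Q : MvPolynomial σ ℂ} {B : ℕ}
    (hB : ∀ n, B ≤ n → comp w n Q = 0) : Q = ∑ n ∈ range B, comp w n Q := by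
  conv_lhs => rw [← sum_weightedHomogeneousComponent w Q]
  apply finsum_eq_sum_of_support_subset
  intro n hn
  simp only [coe_range, Set.mem_Iio]
  by_contra h
  exact hn (hB n (by omega))

theorem eval_of_isWeightedHomogeneous {w : σ → ℕ} {Q : MvPolynomial σ ℂ} {n : ℕ}
    (hQ : Q.IsWeightedHomogeneous w n) (s : ℂ) (z : σ → ℂ) :
    eval (fun i => s ^ w i * z i) Q = s ^ n * eval z Q := by
  refine hQ.induction_on (motive := fun Q _ => eval (fun i => s ^ w i * z i) Q = s ^ n * eval z Q)
    (by simp) (fun p q _ _ hp hq => by rw [map_add, map_add, hp, hq, mul_add]) ?_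
  intro d r hd
  rw [eval_monomial, eval_monomial, ← hd]
  simp only [Finsupp.prod, mul_pow, prod_mul_distrib]
  have : ∏ i ∈ d.support, (s ^ w i) ^ d i = s ^ Finsupp.weight w d := by
    rw [Finsupp.weight_apply, Finsupp.sum, ← prod_pow_eq_pow_sum]
    refine prod_congr rfl fun i _ => ?_
    rw [← pow_mul, smul_eq_mul, mul_comm]
  rw [this]
  ring

end Components

/-! ### Gradings by the degrees in λ and x. -/

section Weights

open MvPolynomial

/-- The weights that count the degree in `x`. -/
def wtX : Fin 2 ⊕ Fin 2 → ℕ := Sum.elim (fun _ => 0) (fun _ => 1)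

/-- The weights that count the degree in `λ`. -/
def wtL : Fin 2 ⊕ Fin 2 → ℕ := Sum.elim (fun _ => 1) (fun _ => 0)

/-- The weights that count the difference of the degrees in `λ` and in `x`. -/
def wtZ : Fin 2 ⊕ Fin 2 → ℤ := Sum.elim (fun _ => 1) (fun _ => -1)

theorem weight_wtZ (d : Fin 2 ⊕ Fin 2 →₀ ℕ) :
    Finsupp.weight wtZ d = (Finsupp.weight wtL d : ℤ) - Finsupp.weight wtX d := by
  simp [Finsupp.weight_apply, Finsupp.sum_fintype, Fintype.sum_sum_type, wtZ, wtL, wtX]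
  ring

theorem degree_eq_weight (d : Fin 2 ⊕ Fin 2 →₀ ℕ) :
    d.degree = Finsupp.weight wtL d + Finsupp.weight wtX d := by
  simp [Finsupp.weight_apply, Finsupp.sum_fintype, Fintype.sum_sum_type, wtL, wtX,
    Finsupp.degree_eq_sum]

theorem pderiv_inr_eq_zero {h : PolyLX} (hh : h.IsWeightedHomogeneous wtX 0) (k : Fin 2) :
    pderiv (Sum.inr k) h = 0 := by
  rw [h.as_sum, map_sum]
  refine sum_eq_zero fun d hd => ?_
  have h1 := hh (mem_support_iff.1 hd)
  have h2 : d (Sum.inr k) = 0 := by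
    simp [Finsupp.weight_apply, Finsupp.sum_fintype, Fintype.sum_sum_type, wtX] at h1
    fin_cases k <;> simp <;> omega
  rw [pderiv_monomial, h2]
  simp

theorem pderiv_inl_eq_zero {h : PolyLX} (hh : h.IsWeightedHomogeneous wtL 0) (k : Fin 2) :
    pderiv (Sum.inl k) h = 0 := by
  rw [h.as_sum, map_sum]
  refine sum_eq_zero fun d hd => ?_
  have h1 := hh (mem_support_iff.1 hd)
  have h2 : d (Sum.inl k) = 0 := by
    simp [Finsupp.weight_apply, Finsupp.sum_fintype, Fintype.sum_sum_type, wtL] at h1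
    fin_cases k <;> simp <;> omega
  rw [pderiv_monomial, h2]
  simp

section LinearForms

variable {M : Type*} [AddCancelCommMonoid M] {w : Fin 2 ⊕ Fin 2 → M} {a : M}

theorem linFormX_isWeightedHomogeneous (hw : ∀ k, w (Sum.inr k) = a) (e : Fin 2 → ℂ) :
    (linFormX e).IsWeightedHomogeneous w a := by
  refine IsWeightedHomogeneous.sum _ _ _ fun k _ => ?_
  rw [← hw k]
  exact (isWeightedHomogeneous_X _ _ _).C_mul _

theorem linFormLam_isWeightedHomogeneous (hw : ∀ k, w (Sum.inl k) = a) (e : Fin 2 → ℂ) :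
    (linFormLam e).IsWeightedHomogeneous w a := by
  refine IsWeightedHomogeneous.sum _ _ _ fun k _ => ?_
  rw [← hw k]
  exact (isWeightedHomogeneous_X _ _ _).C_mul _

end LinearForms

theorem comp_wtX_dX (v : Fin 2 → ℂ) (n : ℕ) (F : PolyLX) :
    comp wtX n (dX v F) = dX v (comp wtX (n + 1) F) := by
  rw [dX_apply, dX_apply, map_add, weightedHomogeneousComponent_C_mul,
    weightedHomogeneousComponent_C_mul, comp_pderiv, comp_pderiv]
  rfl

theorem comp_wtX_dX_iterate (v : Fin 2 → ℂ) (n r : ℕ) (F : PolyLX) :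
    comp wtX n ((dX v)^[r] F) = (dX v)^[r] (comp wtX (n + r) F) := by
  induction r generalizing F with
  | zero => rfl
  | succ r ih =>
    rw [Function.iterate_succ_apply, ih, comp_wtX_dX, Function.iterate_succ_apply]
    rfl

/-- The derivative in x commutes with multiplication by (v, λ), so the binomial theorem applies. -/
theorem twX_pow (v : Fin 2 → ℂ) (u : ℕ) (F : PolyLX) :
    (twX v ^ u) F =
      ∑ r ∈ range (u + 1), (u.choose r : PolyLX) * (linFormLam v ^ (u - r) * (dX v)^[r] F) := by
  have h1 : twX v = (dX v).toLinearMap + LinearMap.mulLeft ℂ (linFormLam v) :=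
    LinearMap.ext fun P => twX_apply v P
  have hc : Commute ((dX v).toLinearMap : Module.End ℂ PolyLX)
      (LinearMap.mulLeft ℂ (linFormLam v)) := by
    refine LinearMap.ext fun P => ?_
    simp [Module.End.mul_apply, dX_linFormLam]
  have h2 : ∀ r : ℕ, ∀ Q : PolyLX, (((dX v).toLinearMap : Module.End ℂ PolyLX) ^ r) Q =
      (dX v)^[r] Q := fun r Q => by rw [Module.End.pow_apply]; rfl
  rw [h1, hc.add_pow, LinearMap.sum_apply]
  refine sum_congr rfl fun r _ => ?_
  rw [(Commute.pow_pow hc r (u - r)).eq, ← Nat.cast_comm, ← nsmul_eq_mul, LinearMap.smul_apply,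
    Module.End.mul_apply, h2, LinearMap.pow_mulLeft, LinearMap.mulLeft_apply, nsmul_eq_mul]

theorem comp_wtX_twX_pow (v : Fin 2 → ℂ) (u k : ℕ) (F : PolyLX) :
    comp wtX k ((twX v ^ u) F) = ∑ r ∈ range (u + 1), (u.choose r : PolyLX) *
      (linFormLam v ^ (u - r) * (dX v)^[r] (comp wtX (k + r) F)) := by
  rw [twX_pow, map_sum]
  refine sum_congr rfl fun r _ => ?_
  rw [← nsmul_eq_mul, map_nsmul, ← nsmul_eq_mul]
  congr 1
  have h1 : (linFormLam v ^ (u - r)).IsWeightedHomogeneous wtX 0 := by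
    simpa using (linFormLam_isWeightedHomogeneous (w := wtX) (a := 0) (fun _ => rfl) v).pow (u - r)
  have h2 := comp_mul h1 k ((dX v)^[r] F)
  rw [zero_add] at h2
  rw [h2, comp_wtX_dX_iterate]

end Weights

/-! ### Linear systems with binomial coefficients. -/

section BinomialSystem

variable {A : Type*} [CommRing A] [IsDomain A] [Algebra ℂ A]

/-- A combination of binomial coefficients `∑ Y_r (u choose r)`, `r ≤ d`, with more than `d` zeros
is trivial. -/
theorem eq_zero_of_sum_choose {Y : ℕ → A} {d : ℕ} {S : Finset ℕ} (hS : d < S.card)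
    (h : ∀ u ∈ S, ∑ r ∈ range (d + 1), (u.choose r : A) * Y r = 0) : ∀ r ≤ d, Y r = 0 := by
  have : CharZero A := charZero_of_injective_algebraMap (algebraMap ℂ A).injective
  -- As a function of u the sum is a polynomial of degree at most d, written in falling factorials;
  -- more than d zeros force it to vanish.
  set p : Polynomial A := ∑ r ∈ range (d + 1),
    Polynomial.C (Y r * algebraMap ℂ A (r.factorial : ℂ)⁻¹) * descPochhammer A r with hp
  have heval : ∀ u : ℕ, p.eval (u : A) = ∑ r ∈ range (d + 1), (u.choose r : A) * Y r := by
    intro u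
    rw [hp, Polynomial.eval_finsetSum]
    refine sum_congr rfl fun r _ => ?_
    rw [Polynomial.eval_mul, Polynomial.eval_C, descPochhammer_eval_eq_descFactorial,
      Nat.descFactorial_eq_factorial_mul_choose]
    have h1 : algebraMap ℂ A (r.factorial : ℂ)⁻¹ * (r.factorial : A) = 1 := by
      rw [← map_natCast (algebraMap ℂ A), ← map_mul, inv_mul_cancel₀, map_one]
      exact_mod_cast r.factorial_ne_zero
    push_cast
    linear_combination (Y r * (u.choose r : A)) * h1
  have hdeg : p.natDegree ≤ d := by
    refine Polynomial.natDegree_sum_le_of_forall_le _ _ fun r hr => ?_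
    refine (Polynomial.natDegree_C_mul_le _ _).trans ?_
    rw [descPochhammer_natDegree]
    have := mem_range.1 hr
    omega
  have hp0 : p = 0 := by
    apply Polynomial.eq_zero_of_natDegree_lt_card_of_eval_eq_zero' p
      (S.map ⟨fun u : ℕ => (u : A), Nat.cast_injective⟩)
    · intro x hx
      obtain ⟨u, hu, rfl⟩ := mem_map.1 hx
      exact (heval u).trans (h u hu)
    · rw [card_map]; omega
  -- At u = r the terms of index above r vanish with their binomial coefficients, and those below r
  -- by induction.
  intro r
  induction r using Nat.strong_induction_on with
  | _ r ih =>
    intro hr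
    have h1 := heval r
    rw [hp0, Polynomial.eval_zero, sum_eq_single r] at h1
    · simpa using h1.symm
    · intro k hk hkr
      rcases lt_or_gt_of_ne hkr with h2 | h2
      · rw [ih k h2 (by omega), mul_zero]
      · rw [Nat.choose_eq_zero_of_lt h2]; simp
    · intro h2
      exact absurd (mem_range.2 (by omega)) h2

omit [IsDomain A] [Algebra ℂ A] in
-- The factors c^(u - r) depend on u. Rescaling turns the unknowns into c^(d - r) y_r, the same for
-- all u, so that `eq_zero_of_sum_choose` becomes applicable.
theorem sum_choose_shift (c : A) {y : ℕ → A} {u d : ℕ} (hy : ∀ r, d < r → y r = 0) :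
    c ^ d * ∑ r ∈ range (u + 1), (u.choose r : A) * (c ^ (u - r) * y r) =
      c ^ u * ∑ r ∈ range (d + 1), (u.choose r : A) * (c ^ (d - r) * y r) := by
  have h1 : ∑ r ∈ range (u + 1), (u.choose r : A) * (c ^ (u - r) * y r) =
      ∑ r ∈ range (u + d + 1), (u.choose r : A) * (c ^ (u - r) * y r) := by
    apply sum_subset (range_mono (by omega))
    intro r _ hr
    rw [Nat.choose_eq_zero_of_lt (by rw [mem_range] at hr; omega)]
    simp
  have h2 : ∑ r ∈ range (d + 1), (u.choose r : A) * (c ^ (d - r) * y r) =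
      ∑ r ∈ range (u + d + 1), (u.choose r : A) * (c ^ (d - r) * y r) := by
    apply sum_subset (range_mono (by omega))
    intro r _ hr
    rw [hy r (by rw [mem_range] at hr; omega)]
    simp
  rw [h1, h2, mul_sum, mul_sum]
  refine sum_congr rfl fun r _ => ?_
  by_cases hd : d < r
  · simp [hy r hd]
  · by_cases hu : u < r
    · simp [Nat.choose_eq_zero_of_lt hu]
    · have : c ^ d * c ^ (u - r) = c ^ u * c ^ (d - r) := by
        rw [← pow_add, ← pow_add]; congr 1; omega
      linear_combination ((u.choose r : A) * y r) * this

end BinomialSystem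

/-! ### Operations preserving quasi-invariance. -/

section Closure

open MvPolynomial

variable {e : Fin 2 → ℂ} {m : ℕ} {P Q : PolyLX}

theorem QuasiInvAlong.add (hP : QuasiInvAlong e m P) (hQ : QuasiInvAlong e m Q) :
    QuasiInvAlong e m (P + Q) := fun s hs1 hs2 => by
  rw [map_add]; exact dvd_add (hP s hs1 hs2) (hQ s hs1 hs2)

theorem QuasiInvAlong.sub (hP : QuasiInvAlong e m P) (hQ : QuasiInvAlong e m Q) :
    QuasiInvAlong e m (P - Q) := fun s hs1 hs2 => by
  rw [map_sub]; exact dvd_sub (hP s hs1 hs2) (hQ s hs1 hs2)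

theorem QuasiInvAlong.map (hP : QuasiInvAlong e m P) {F : Module.End ℂ PolyLX}
    (hF : ∀ Q, twX e (F Q) = F (twX e Q)) (hl : ∀ Q, F (linFormX e * Q) = linFormX e * F Q) :
    QuasiInvAlong e m (F P) := fun s hs1 hs2 => by
  obtain ⟨Q, hQ⟩ := hP s hs1 hs2
  rw [twX_pow_comm e hF, hQ, hl]
  exact dvd_mul_right _ _

theorem QuasiInvAlong.mul (hP : QuasiInvAlong e m P) {f : PolyLX} (hf : dX e f = 0) :
    QuasiInvAlong e m (f * P) :=
  hP.map (F := LinearMap.mulLeft ℂ f)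
    (fun Q => by simp [twX_mul, hf]) (fun Q => by simp; ring)

theorem QuasiInvAlong.cov_inl (hP : QuasiInvAlong e m P) (k : Fin 2) :
    QuasiInvAlong e m (cov (Sum.inl k) P) :=
  hP.map (fun Q => twX_cov_comm e _ Q) fun Q => by
    rw [cov_mul, linFormX_apply]
    simp [pderiv_X]

theorem twX_pow_succ_linFormX_mul (he : dotProduct e e = 1) (r : ℕ) (P : PolyLX) :
    (twX e ^ (r + 1)) (linFormX e * P) =
      linFormX e * (twX e ^ (r + 1)) P + (r + 1) * (twX e ^ r) P := by
  induction r with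
  | zero => simp [twX_mul, dX_linFormX, he]; ring
  | succ r ih =>
    have h1 : ∀ Q : PolyLX, twX e ((r + 1 : PolyLX) * Q) = (r + 1) * twX e Q := fun Q => by
      rw [twX_mul]; simp
    rw [pow_succ', Module.End.mul_apply, ih, map_add, twX_mul, dX_linFormX, he, h1,
      ← Module.End.mul_apply (twX e) (twX e ^ r), ← pow_succ', Module.End.mul_apply]
    push_cast
    rw [C_1]
    ring

/-- Modulo (e, x), the normal derivative of order 2r + 1 of (e, x)² P is (2r + 1)(2r) times the
normal derivative of order 2r - 1 of P. -/
theorem QuasiInvAlong.mul_sq (he : dotProduct e e = 1) (hP : QuasiInvAlong e m P) :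
    QuasiInvAlong e m (linFormX e ^ 2 * P) := by
  intro s hs1 hs2
  obtain ⟨r, rfl⟩ : ∃ r, s = r + 1 := ⟨s - 1, by omega⟩
  rw [show 2 * (r + 1) - 1 = 2 * r + 1 by omega, sq, mul_assoc, twX_pow_succ_linFormX_mul he]
  refine dvd_add (dvd_mul_right _ _) ?_
  rcases r with _ | r
  · simp
  · refine Dvd.dvd.mul_left ?_ _
    rw [show 2 * (r + 1) = 2 * r + 1 + 1 by ring, twX_pow_succ_linFormX_mul he]
    refine dvd_add (dvd_mul_right _ _) (Dvd.dvd.mul_left ?_ _)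
    have := hP (r + 1) (by omega) (by omega)
    rwa [show 2 * (r + 1) - 1 = 2 * r + 1 by omega] at this

theorem linFormX_sq_add (he : dotProduct e e = 1) :
    X (Sum.inr 0) ^ 2 + X (Sum.inr 1) ^ 2 = linFormX e ^ 2 + linFormX (perp e) ^ 2 := by
  have h1 : (C (e 0) * C (e 0) + C (e 1) * C (e 1) : PolyLX) = 1 := by
    rw [← C_1, ← he]
    simp [dotProduct, Fin.sum_univ_two]
  simp [linFormX_apply, perp]
  linear_combination (-X (Sum.inr 0) ^ 2 - X (Sum.inr 1) ^ 2) * h1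

theorem QuasiInvAlong.mul_norm_sq (he : dotProduct e e = 1) (hP : QuasiInvAlong e m P) :
    QuasiInvAlong e m ((X (Sum.inr 0) ^ 2 + X (Sum.inr 1) ^ 2) * P) := by
  rw [linFormX_sq_add he, add_mul]
  refine (hP.mul_sq he).add (hP.mul ?_)
  rw [sq, Derivation.leibniz, dX_linFormX, dotProduct_perp]
  simp

theorem comp_wtZ_twX (v : Fin 2 → ℂ) (n : ℤ) (F : PolyLX) :
    comp wtZ (1 + n) (twX v F) = twX v (comp wtZ n F) := by
  rw [twX_apply, twX_apply, map_add,
    comp_mul (linFormLam_isWeightedHomogeneous (w := wtZ) (a := 1) (fun _ => rfl) v),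
    dX_apply, dX_apply, map_add, weightedHomogeneousComponent_C_mul,
    weightedHomogeneousComponent_C_mul, comp_pderiv, comp_pderiv]
  simp [wtZ]

theorem comp_wtZ_twX_pow (v : Fin 2 → ℂ) (n : ℤ) (u : ℕ) (F : PolyLX) :
    comp wtZ (u + n) ((twX v ^ u) F) = (twX v ^ u) (comp wtZ n F) := by
  induction u generalizing n F with
  | zero => simp
  | succ u ih =>
    rw [pow_succ, Module.End.mul_apply, Module.End.mul_apply, ← comp_wtZ_twX, ← ih]
    congr 2
    push_cast
    ring

/-- Both terms of the conjugated derivative, ∂_v and multiplication by (v, λ), raise the difference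
of the degrees in λ and x by one, and (e, x) is homogeneous for this grading. -/
theorem QuasiInvAlong.comp_wtZ (hP : QuasiInvAlong e m P) (n : ℤ) :
    QuasiInvAlong e m (comp wtZ n P) := fun s hs1 hs2 => by
  rw [← comp_wtZ_twX_pow]
  exact dvd_comp (linFormX_isWeightedHomogeneous (w := wtZ) (a := -1) (fun _ => rfl) e) _
    (hP s hs1 hs2)

end Closure

/-! ### The x-leading component along one line. -/

section LeadingTerm

open MvPolynomial

variable {e : Fin 2 → ℂ} {m : ℕ} {F : PolyLX}

theorem restr_linFormLam (v : Fin 2 → ℂ) : restr e (linFormLam v) = linFormLam v := by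
  simp [linFormLam_apply, restr]

theorem linFormLam_ne_zero (he : dotProduct e e = 1) : linFormLam e ≠ 0 := by
  intro h
  have := eval_linFormLam e e 0
  rw [h, he] at this
  simp at this

/-- The system of equations on the components of a quasi-invariant polynomial along a line. -/
theorem QuasiInvAlong.sum_choose (he : dotProduct e e = 1) (hF : QuasiInvAlong e m F) {n d : ℕ}
    (hn : ∀ j, n < j → comp wtX j F = 0) (hd : d ≤ n) {s : ℕ} (hs1 : 1 ≤ s) (hs2 : s ≤ m) :
    ∑ r ∈ range (d + 1), ((2 * s - 1).choose r : PolyLX) *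
      (linFormLam e ^ (d - r) * restr e ((dX e)^[r] (comp wtX (n - d + r) F))) = 0 := by
  have h1 := dvd_comp (linFormX_isWeightedHomogeneous (w := wtX) (a := 1) (fun _ => rfl) e) (n - d)
    (hF s hs1 hs2)
  rw [linFormX_dvd_iff he, comp_wtX_twX_pow, map_sum] at h1
  simp only [map_mul, map_natCast, map_pow, restr_linFormLam] at h1
  have h2 := sum_choose_shift (linFormLam e) (u := 2 * s - 1) (d := d)
    (y := fun r => restr e ((dX e)^[r] (comp wtX (n - d + r) F))) (fun r hr => by
      rw [hn _ (by omega), iterate_map_zero, map_zero])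
  rw [h1, mul_zero] at h2
  exact (mul_eq_zero.1 h2.symm).resolve_left (pow_ne_zero _ (linFormLam_ne_zero he))

/-- The odd numbers `1, 3, …, 2m - 1`. -/
theorem card_image_odd (m : ℕ) : ((Icc 1 m).image fun s => 2 * s - 1).card = m := by
  rw [card_image_of_injOn, Nat.card_Icc, Nat.add_sub_cancel]
  intro a ha b hb hab
  simp only [coe_Icc, Set.mem_Icc] at ha hb
  simp only at hab
  omega

/-- For d < m the m odd numbers 1, 3, …, 2m - 1 are too many zeros for a system of degree d. All its
unknowns vanish, in particular the last one, r = d. -/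
theorem QuasiInvAlong.restr_iterate_eq_zero (he : dotProduct e e = 1) (hF : QuasiInvAlong e m F)
    {n d : ℕ} (hn : ∀ j, n < j → comp wtX j F = 0) (hd : d ≤ n) (hdm : d < m) :
    restr e ((dX e)^[d] (comp wtX n F)) = 0 := by
  have h1 := eq_zero_of_sum_choose (A := PolyLX) (d := d) (S := (Icc 1 m).image fun s => 2 * s - 1)
    (Y := fun r => linFormLam e ^ (d - r) * restr e ((dX e)^[r] (comp wtX (n - d + r) F)))
    (by rwa [card_image_odd]) (by
      intro u hu
      obtain ⟨s, hs, rfl⟩ := mem_image.1 hu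
      exact hF.sum_choose he hn hd (mem_Icc.1 hs).1 (mem_Icc.1 hs).2) d le_rfl
  simpa [Nat.sub_add_cancel hd] using h1

/-- If the even values of the system vanish too, then so do all its terms. -/
theorem QuasiInvAlong.sum_choose_ne_zero (he : dotProduct e e = 1) (hF : QuasiInvAlong e m F)
    {n : ℕ} (hn : ∀ j, n < j → comp wtX j F = 0) (hm : m ≤ n)
    (hne : restr e ((dX e)^[m] (comp wtX n F)) ≠ 0) {u : ℕ} (hu : Even u) :
    ∑ r ∈ range (m + 1), (u.choose r : PolyLX) *
      (linFormLam e ^ (m - r) * restr e ((dX e)^[r] (comp wtX (n - m + r) F))) ≠ 0 := by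
  intro h0
  apply hne
  -- An even zero would be new, making m + 1 zeros against degree m.
  have hu' : u ∉ (Icc 1 m).image fun s => 2 * s - 1 := by
    rw [mem_image]
    rintro ⟨s, hs, rfl⟩
    have := (mem_Icc.1 hs).1
    obtain ⟨k, hk⟩ := hu
    omega
  have h1 := eq_zero_of_sum_choose (A := PolyLX) (d := m)
    (S := insert u ((Icc 1 m).image fun s => 2 * s - 1))
    (Y := fun r => linFormLam e ^ (m - r) * restr e ((dX e)^[r] (comp wtX (n - m + r) F)))
    (by rw [card_insert_of_notMem hu', card_image_odd]; omega) (by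
      intro v hv
      rcases mem_insert.1 hv with rfl | hv
      · exact h0
      · obtain ⟨s, hs, rfl⟩ := mem_image.1 hv
        exact hF.sum_choose he hn hm (mem_Icc.1 hs).1 (mem_Icc.1 hs).2) m le_rfl
  simpa [Nat.sub_add_cancel hm] using h1

theorem pow_linFormX_dvd (he : dotProduct e e = 1) (k : ℕ) (f : PolyLX)
    (h : ∀ d < k, restr e ((dX e)^[d] f) = 0) : linFormX e ^ k ∣ f := by
  induction k generalizing f with
  | zero => simp
  | succ k ih =>
    obtain ⟨g, rfl⟩ := (linFormX_dvd_iff he).2 (h 0 (by omega))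
    rw [pow_succ']
    refine mul_dvd_mul_left _ (ih g fun d hd => ?_)
    have h1 := h (d + 1) (by omega)
    rw [derivation_iterate_mul (dX e) (dX_linFormX e e) (by simp [he]), map_add, map_mul,
      restr_linFormX, zero_mul, zero_add, he] at h1
    have h2 : ((d : PolyLX) + 1) ≠ 0 := by exact_mod_cast d.succ_ne_zero
    simpa [h2] using h1

theorem iterate_dX_eq_zero {n d : ℕ} (hF : F.IsWeightedHomogeneous wtX n) (hd : n < d)
    (v : Fin 2 → ℂ) : (dX v)^[d] F = 0 := by
  apply eq_zero_of_comp (w := wtX)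
  intro k
  rw [comp_wtX_dX_iterate, hF.weightedHomogeneousComponent_ne _ (by omega), iterate_map_zero]

theorem QuasiInvAlong.pow_dvd_leading (he : dotProduct e e = 1) (hF : QuasiInvAlong e m F) {n : ℕ}
    (hn : ∀ j, n < j → comp wtX j F = 0) : linFormX e ^ m ∣ comp wtX n F := by
  apply pow_linFormX_dvd he
  intro d hd
  rcases le_or_gt d n with h | h
  · exact hF.restr_iterate_eq_zero he hn h hd
  · rw [iterate_dX_eq_zero (weightedHomogeneousComponent_isWeightedHomogeneous n F) h, map_zero]

end LeadingTerm

/-! ### Leading components along all lines, and uniqueness. -/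

section LeadingTerms

open MvPolynomial

variable {ι : Type*} [Fintype ι] {e : ι → Fin 2 → ℂ} {m : ι → ℕ} {F : PolyLX}

/-- The product `∏ (e_i, x)^{m_i}`. -/
noncomputable def prodX (e : ι → Fin 2 → ℂ) (m : ι → ℕ) : PolyLX := ∏ i, linFormX (e i) ^ m i

/-- The product `∏ (e_i, λ)^{m_i}`. -/
noncomputable def prodLam (e : ι → Fin 2 → ℂ) (m : ι → ℕ) : PolyLX := ∏ i, linFormLam (e i) ^ m i

theorem prodX_isWeightedHomogeneous : (prodX e m).IsWeightedHomogeneous wtX (∑ i, m i) := by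
  refine IsWeightedHomogeneous.prod _ _ _ fun i _ => ?_
  simpa using (linFormX_isWeightedHomogeneous (w := wtX) (a := 1) (fun _ => rfl) (e i)).pow (m i)

theorem prodX_isWeightedHomogeneous_wtL : (prodX e m).IsWeightedHomogeneous wtL 0 := by
  have := IsWeightedHomogeneous.prod (w := wtL) univ (fun i => linFormX (e i) ^ m i) (fun _ => 0)
    fun i _ => by
      simpa using (linFormX_isWeightedHomogeneous (w := wtL) (a := 0) (fun _ => rfl) (e i)).pow (m i)
  simpa [prodX] using this

theorem prodLam_isWeightedHomogeneous_wtL :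
    (prodLam e m).IsWeightedHomogeneous wtL (∑ i, m i) := by
  refine IsWeightedHomogeneous.prod _ _ _ fun i _ => ?_
  simpa using (linFormLam_isWeightedHomogeneous (w := wtL) (a := 1) (fun _ => rfl) (e i)).pow (m i)

theorem prodLam_isWeightedHomogeneous : (prodLam e m).IsWeightedHomogeneous wtX 0 := by
  have := IsWeightedHomogeneous.prod (w := wtX) univ (fun i => linFormLam (e i) ^ m i) (fun _ => 0)
    fun i _ => by
      simpa using
        (linFormLam_isWeightedHomogeneous (w := wtX) (a := 0) (fun _ => rfl) (e i)).pow (m i)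
  simpa [prodLam] using this

theorem prodX_ne_zero (he : ∀ i, dotProduct (e i) (e i) = 1) : prodX e m ≠ 0 :=
  prod_ne_zero_iff.2 fun i _ => pow_ne_zero _ (linFormX_ne_zero (he i))

theorem prodLam_ne_zero (he : ∀ i, dotProduct (e i) (e i) = 1) : prodLam e m ≠ 0 :=
  prod_ne_zero_iff.2 fun i _ => pow_ne_zero _ (linFormLam_ne_zero (he i))

theorem isRelPrime_linFormX {κ : Type*} {e : κ → Fin 2 → ℂ} (he : ∀ i, dotProduct (e i) (e i) = 1)
    (hne : ∀ i j, j ≠ i → dotProduct (e j) (perp (e i)) ≠ 0) {i j : κ} (hij : i ≠ j) :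
    IsRelPrime (linFormX (e i)) (linFormX (e j)) := by
  rw [(linFormX_prime (he i)).irreducible.isRelPrime_iff_not_dvd]
  intro h
  have h1 := eval_eq_zero_of_linFormX_dvd h 0 (dotProduct_perp (e i))
  rw [eval_linFormX] at h1
  exact hne i j hij.symm h1

theorem prodX_dvd_leading (he : ∀ i, dotProduct (e i) (e i) = 1)
    (hne : ∀ i j, j ≠ i → dotProduct (e j) (perp (e i)) ≠ 0)
    (hF : ∀ i, QuasiInvAlong (e i) (m i) F) {n : ℕ} (hn : ∀ j, n < j → comp wtX j F = 0) :
    prodX e m ∣ comp wtX n F :=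
  Fintype.prod_dvd_of_isRelPrime
    (fun _ _ hij => (isRelPrime_linFormX he hne hij).pow)
    fun i => (hF i).pow_dvd_leading (he i) hn

/-- A quasi-invariant polynomial of small degree in `x` vanishes. -/
theorem eq_zero_of_quasiInv (he : ∀ i, dotProduct (e i) (e i) = 1)
    (hne : ∀ i j, j ≠ i → dotProduct (e j) (perp (e i)) ≠ 0)
    (hF : ∀ i, QuasiInvAlong (e i) (m i) F)
    (hn : ∀ j, ∑ i, m i ≤ j → comp wtX j F = 0) : F = 0 := by
  -- Descending induction on the x-degree: a component with nothing above it is a multiple of a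
  -- polynomial of x-degree N, so it is zero in degrees below N.
  have h : ∀ k n, ∑ i, m i ≤ n + k → comp wtX n F = 0 := by
    intro k
    induction k with
    | zero => exact hn
    | succ k ih =>
      intro n hk
      rcases le_or_gt (∑ i, m i) n with h1 | h1
      · exact hn n h1
      obtain ⟨g, hg⟩ := prodX_dvd_leading he hne hF (n := n) fun j hj => ih j (by omega)
      have h2 := weightedHomogeneousComponent_isWeightedHomogeneous (w := wtX) n F
      rw [hg] at h2
      rw [comp, hg, eq_zero_of_isWeightedHomogeneous_mul prodX_isWeightedHomogeneous
        (prodX_ne_zero he) h2 h1, mul_zero]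
  exact eq_zero_of_comp fun n => h _ n (Nat.le_add_left _ _)

end LeadingTerms

/-! ### Gauged operators in λ and in x, and their commutation. -/

section GaugedOperator

open MvPolynomial

/-- The operator `f² ∑ E_k² - 2 f ∑ (∂_k f) E_k`, where the `E_k` are the covariant derivatives in
the variables `s 0`, `s 1`. -/
noncomputable def gaugedSq (s : Fin 2 → Fin 2 ⊕ Fin 2) (f : PolyLX) : Module.End ℂ PolyLX :=
  LinearMap.mulLeft ℂ (f ^ 2) ∘ₗ (cov (s 0) ∘ₗ cov (s 0) + cov (s 1) ∘ₗ cov (s 1)) -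
    (LinearMap.mulLeft ℂ (2 * f * pderiv (s 0) f) ∘ₗ cov (s 0) +
      LinearMap.mulLeft ℂ (2 * f * pderiv (s 1) f) ∘ₗ cov (s 1))

/-- The Schrödinger operator obtained by gauging with `f`, multiplied by `f²`, with the constant
term included. -/
noncomputable def gaugedOp (s : Fin 2 → Fin 2 ⊕ Fin 2) (f P : PolyLX) : PolyLX :=
  gaugedSq s f P - f ^ 2 * (X (s 0).swap ^ 2 + X (s 1).swap ^ 2) * P

/-- The derivation that replaces the variables `s k` by their dual variables. -/
noncomputable def polar (s : Fin 2 → Fin 2 ⊕ Fin 2) : Derivation ℂ PolyLX PolyLX :=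
  (X (s 0).swap : PolyLX) • pderiv (s 0) + (X (s 1).swap : PolyLX) • pderiv (s 1)

variable {s t : Fin 2 → Fin 2 ⊕ Fin 2} {f g : PolyLX}

theorem gaugedSq_apply (s : Fin 2 → Fin 2 ⊕ Fin 2) (f P : PolyLX) :
    gaugedSq s f P = f ^ 2 * (cov (s 0) (cov (s 0) P) + cov (s 1) (cov (s 1) P)) -
      (2 * f * pderiv (s 0) f * cov (s 0) P + 2 * f * pderiv (s 1) f * cov (s 1) P) := rfl

theorem polar_apply (s : Fin 2 → Fin 2 ⊕ Fin 2) (P : PolyLX) :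
    polar s P = X (s 0).swap * pderiv (s 0) P + X (s 1).swap * pderiv (s 1) P := by
  simp [polar]

theorem gaugedSq_mul (h0 : pderiv (s 0) g = 0) (h1 : pderiv (s 1) g = 0) (Q : PolyLX) :
    gaugedSq s f (g * Q) = g * gaugedSq s f Q := by
  simp only [gaugedSq_apply, cov_mul, h0, h1, zero_mul, zero_add]
  ring

theorem gaugedOp_mul (h0 : pderiv (s 0) g = 0) (h1 : pderiv (s 1) g = 0) (Q : PolyLX) :
    gaugedOp s f (g * Q) = g * gaugedOp s f Q := by
  rw [gaugedOp, gaugedOp, gaugedSq_mul h0 h1]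
  ring

theorem cov_gaugedSq {i : Fin 2 ⊕ Fin 2} (hf : pderiv i f = 0) (Q : PolyLX) :
    cov i (gaugedSq s f Q) = gaugedSq s f (cov i Q) := by
  have h2 : ∀ k, pderiv i (pderiv (s k) f) = 0 := fun k => by rw [pderiv_comm, hf, map_zero]
  have hi2 : pderiv i (2 : PolyLX) = 0 := by
    simpa using Derivation.map_natCast (pderiv i : Derivation ℂ PolyLX PolyLX) 2
  have hm : ∀ c R : PolyLX, pderiv i c = 0 → cov i (c * R) = c * cov i R := fun c R hc => by
    rw [cov_mul, hc]; ring
  have hc2 : pderiv i (f ^ 2) = 0 := by rw [sq, Derivation.leibniz, hf]; simp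
  have hck : ∀ k, pderiv i (2 * f * pderiv (s k) f) = 0 := fun k => by
    simp [Derivation.leibniz, hf, h2, hi2]
  rw [gaugedSq_apply, gaugedSq_apply, map_sub, map_add, hm _ _ hc2, hm _ _ (hck 0),
    hm _ _ (hck 1), map_add]
  simp only [cov_comm i]

theorem gaugedSq_comm (hf : ∀ k, pderiv (t k) f = 0) (hg : ∀ k, pderiv (s k) g = 0)
    (P : PolyLX) : gaugedSq s f (gaugedSq t g P) = gaugedSq t g (gaugedSq s f P) := by
  have hs2 : ∀ k, pderiv (s k) (2 : PolyLX) = 0 := fun k => by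
    simpa using Derivation.map_natCast (pderiv (s k) : Derivation ℂ PolyLX PolyLX) 2
  have hg2 : ∀ k, pderiv (s k) (g ^ 2) = 0 := fun k => by
    rw [sq, Derivation.leibniz, hg]; simp
  have hgk : ∀ j k, pderiv (s k) (2 * g * pderiv (t j) g) = 0 := fun j k => by
    simp [Derivation.leibniz, hg, hs2, pderiv_comm (s k)]
  rw [gaugedSq_apply t, gaugedSq_apply t, map_sub, map_add, gaugedSq_mul (hg2 0) (hg2 1),
    gaugedSq_mul (hgk 0 0) (hgk 0 1), gaugedSq_mul (hgk 1 0) (hgk 1 1), map_add]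
  simp only [cov_gaugedSq (hf _)]

/-- The commutator of the two-dimensional Laplacian with the squared norm is 4 times the Euler
operator plus 4; the first order part contributes -4N f² through Euler's identity for f. -/
theorem gaugedSq_norm_sq_mul (hs : s 0 ≠ s 1) {N : ℕ}
    (hf : X (s 0) * pderiv (s 0) f + X (s 1) * pderiv (s 1) f = (N : PolyLX) * f) (P : PolyLX) :
    gaugedSq s f ((X (s 0) ^ 2 + X (s 1) ^ 2) * P) =
      (X (s 0) ^ 2 + X (s 1) ^ 2) * gaugedSq s f P + f ^ 2 *
        (4 * (X (s 0) * cov (s 0) P + X (s 1) * cov (s 1) P) + (4 - 4 * (N : PolyLX)) * P) := by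
  have h0 : pderiv (s 0) (X (s 0) ^ 2 + X (s 1) ^ 2 : PolyLX) = 2 * X (s 0) := by
    simp [sq, pderiv_X, hs.symm]; ring
  have h1 : pderiv (s 1) (X (s 0) ^ 2 + X (s 1) ^ 2 : PolyLX) = 2 * X (s 1) := by
    simp [sq, pderiv_X, hs]; ring
  have h2 : ∀ k, pderiv (s k) (2 : PolyLX) = 0 := fun k => by
    simpa using Derivation.map_natCast (pderiv (s k) : Derivation ℂ PolyLX PolyLX) 2
  have h3 : ∀ k, pderiv (s k) (2 * X (s k) : PolyLX) = 2 := fun k => by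
    simp [Derivation.leibniz, h2]
  simp only [gaugedSq_apply, cov_mul, map_add, h0, h1, h3]
  linear_combination (-4 * f * P) * hf

/-- The gauged operators in `λ` and in `x` commute on polynomials of weight zero. -/
theorem gaugedOp_comm {a b P : PolyLX} {N : ℕ} (ha : ∀ k, pderiv (Sum.inr k) a = 0)
    (hb : ∀ k, pderiv (Sum.inl k) b = 0)
    (ha' : X (Sum.inl 0) * pderiv (Sum.inl 0) a + X (Sum.inl 1) * pderiv (Sum.inl 1) a = (N : PolyLX) * a)
    (hb' : X (Sum.inr 0) * pderiv (Sum.inr 0) b + X (Sum.inr 1) * pderiv (Sum.inr 1) b = (N : PolyLX) * b)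
    (hP : X (Sum.inl 0) * cov (Sum.inl 0) P + X (Sum.inl 1) * cov (Sum.inl 1) P =
      X (Sum.inr 0) * cov (Sum.inr 0) P + X (Sum.inr 1) * cov (Sum.inr 1) P) :
    gaugedOp Sum.inl a (gaugedOp Sum.inr b P) = gaugedOp Sum.inr b (gaugedOp Sum.inl a P) := by
  have hb2 : ∀ k, pderiv (Sum.inl k) (b ^ 2) = 0 := fun k => by
    rw [sq, Derivation.leibniz, hb]; simp
  have ha2 : ∀ k, pderiv (Sum.inr k) (a ^ 2) = 0 := fun k => by
    rw [sq, Derivation.leibniz, ha]; simp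
  have e1 := gaugedSq_norm_sq_mul (s := Sum.inl) (by simp) ha' P
  have e2 := gaugedSq_norm_sq_mul (s := Sum.inr) (by simp) hb' P
  have e3 := gaugedSq_comm ha hb P
  simp only [gaugedOp, Sum.swap_inl, Sum.swap_inr, map_sub]
  rw [mul_assoc (b ^ 2) _ P, mul_assoc (a ^ 2) _ P, gaugedSq_mul (hb2 0) (hb2 1),
    gaugedSq_mul (ha2 0) (ha2 1), e1, e2, e3]
  -- The `gaugedSq` parts commute. The two norm commutators differ by Euler operators, equal on P by
  -- `hP`; the constants 4 - 4N cancel because both gauge factors have degree N.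
  linear_combination (-4 * a ^ 2 * b ^ 2) * hP

/-- The part of `gaugedOp` that preserves the degree in the dual variables. -/
noncomputable def gaugedLaplacian (s : Fin 2 → Fin 2 ⊕ Fin 2) (f P : PolyLX) : PolyLX :=
  f ^ 2 * (pderiv (s 0) (pderiv (s 0) P) + pderiv (s 1) (pderiv (s 1) P)) -
    2 * f * (pderiv (s 0) f * pderiv (s 0) P + pderiv (s 1) f * pderiv (s 1) P)

/-- From (∂ + y)² - y² = ∂² + 2y∂: besides a part preserving the degree in the dual variables, only
a part raising it by one remains. -/
theorem gaugedOp_eq (hs : ∀ k, s k ≠ (s k).swap) (f P : PolyLX) :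
    gaugedOp s f P = gaugedLaplacian s f P + 2 * f * (f * polar s P - polar s f * P) := by
  have h : ∀ k, pderiv (s k) (X (s k).swap : PolyLX) = 0 := fun k => by
    rw [pderiv_X_of_ne (hs k).symm]
  simp only [gaugedOp, gaugedSq_apply, gaugedLaplacian, polar_apply, cov_apply, map_add,
    Derivation.leibniz, h, smul_eq_mul]
  ring

section Components

variable {w : Fin 2 ⊕ Fin 2 → ℕ}

theorem comp_mul_of_zero (hf : f.IsWeightedHomogeneous w 0) (n : ℕ) (Q : PolyLX) :
    comp w n (f * Q) = f * comp w n Q := by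
  have := comp_mul hf n Q
  rwa [zero_add] at this

theorem isWeightedHomogeneous_pderiv_zero (hs : ∀ k, w (s k) = 0)
    (hf : f.IsWeightedHomogeneous w 0) (k : Fin 2) :
    (pderiv (s k) f).IsWeightedHomogeneous w 0 := hf.pderiv (by rw [hs])

theorem comp_gaugedLaplacian (hs : ∀ k, w (s k) = 0) (hf : f.IsWeightedHomogeneous w 0) (n : ℕ)
    (P : PolyLX) : comp w n (gaugedLaplacian s f P) = gaugedLaplacian s f (comp w n P) := by
  have hk := isWeightedHomogeneous_pderiv_zero hs hf
  have h2 : (2 : PolyLX).IsWeightedHomogeneous w 0 := isWeightedHomogeneous_C (R := ℂ) w 2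
  have hf2 : (f ^ 2).IsWeightedHomogeneous w 0 := by simpa using hf.pow 2
  have hf3 : (2 * f).IsWeightedHomogeneous w 0 := by simpa using h2.mul hf
  rw [gaugedLaplacian, gaugedLaplacian, map_sub, comp_mul_of_zero hf2, comp_mul_of_zero hf3,
    map_add, map_add, comp_mul_of_zero (hk 0), comp_mul_of_zero (hk 1)]
  simp only [comp_pderiv, hs, add_zero]

theorem comp_polar (hs : ∀ k, w (s k) = 0) (hs' : ∀ k, w (s k).swap = 1) (n : ℕ) (P : PolyLX) :
    comp w (n + 1) (polar s P) = polar s (comp w n P) := by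
  have h : ∀ k, ∀ Q : PolyLX, comp w (n + 1) (X (s k).swap * Q) = X (s k).swap * comp w n Q := by
    intro k Q
    rw [add_comm, ← hs' k]
    exact comp_mul (isWeightedHomogeneous_X _ _ _) n Q
  rw [polar_apply, polar_apply, map_add, h, h, comp_pderiv, comp_pderiv, hs, hs, add_zero]

theorem comp_succ_gaugedOp (hs : ∀ k, w (s k) = 0) (hs' : ∀ k, w (s k).swap = 1)
    (hf : f.IsWeightedHomogeneous w 0) (n : ℕ) (P : PolyLX) :
    comp w (n + 1) (gaugedOp s f P) = gaugedLaplacian s f (comp w (n + 1) P) +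
      2 * f * (f * polar s (comp w n P) - polar s f * comp w n P) := by
  have h2 : (2 : PolyLX).IsWeightedHomogeneous w 0 := isWeightedHomogeneous_C (R := ℂ) w 2
  have hf3 : (2 * f).IsWeightedHomogeneous w 0 := by simpa using h2.mul hf
  have hpf : (polar s f).IsWeightedHomogeneous w 1 := by
    rw [polar_apply]
    have : ∀ k, (X (s k).swap * pderiv (s k) f).IsWeightedHomogeneous w 1 := fun k => by
      have := (isWeightedHomogeneous_X ℂ w (s k).swap).mul
        (isWeightedHomogeneous_pderiv_zero hs hf k)
      rwa [hs'] at this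
    exact (this 0).add (this 1)
  rw [gaugedOp_eq (fun k h => by have := hs' k; rw [← h, hs] at this; omega), map_add,
    comp_gaugedLaplacian hs hf, comp_mul_of_zero hf3, map_sub, comp_mul_of_zero hf,
    comp_polar hs hs', add_comm n 1, comp_mul hpf]

theorem isWeightedHomogeneous_cov_inr {n : ℤ} {P : PolyLX} (h : P.IsWeightedHomogeneous wtZ n)
    (k : Fin 2) : (cov (Sum.inr k) P).IsWeightedHomogeneous wtZ (n + 1) := by
  rw [cov_apply]
  refine (h.pderiv (by simp [wtZ])).add ?_
  rw [add_comm]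
  exact (isWeightedHomogeneous_X ℂ wtZ (Sum.inl k)).mul h

theorem isWeightedHomogeneous_gaugedOp_inr {n d : ℤ} {P : PolyLX}
    (h : P.IsWeightedHomogeneous wtZ n) (hf : f.IsWeightedHomogeneous wtZ d) :
    (gaugedOp Sum.inr f P).IsWeightedHomogeneous wtZ (2 * d + (n + 2)) := by
  have h2 : (2 : PolyLX).IsWeightedHomogeneous wtZ 0 := isWeightedHomogeneous_C (R := ℂ) wtZ 2
  have hf2 : (f ^ 2).IsWeightedHomogeneous wtZ (2 * d) := by simpa using hf.pow 2
  have hx : ∀ k, (X (Sum.inl k) ^ 2 : PolyLX).IsWeightedHomogeneous wtZ 2 := fun k => by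
    simpa [wtZ] using (isWeightedHomogeneous_X ℂ wtZ (Sum.inl k)).pow 2
  have e1 : ∀ k, (cov (Sum.inr k) (cov (Sum.inr k) P)).IsWeightedHomogeneous wtZ (n + 2) := by
    intro k
    have := isWeightedHomogeneous_cov_inr (isWeightedHomogeneous_cov_inr h k) k
    rwa [add_assoc] at this
  have e2 : ∀ k, (2 * f * pderiv (Sum.inr k) f * cov (Sum.inr k) P).IsWeightedHomogeneous wtZ
      (2 * d + (n + 2)) := by
    intro k
    have := ((h2.mul hf).mul (hf.pderiv (i := Sum.inr k) (n' := d + 1) (by simp [wtZ]))).mul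
      (isWeightedHomogeneous_cov_inr h k)
    rwa [show 0 + d + (d + 1) + (n + 1) = 2 * d + (n + 2) by ring] at this
  have e3 : (f ^ 2 * (X (Sum.inl 0) ^ 2 + X (Sum.inl 1) ^ 2) * P).IsWeightedHomogeneous wtZ
      (2 * d + (n + 2)) := by
    have := (hf2.mul ((hx 0).add (hx 1))).mul h
    rwa [show 2 * d + 2 + n = 2 * d + (n + 2) by ring] at this
  have key := sub_mem (sub_mem (hf2.mul ((e1 0).add (e1 1))) ((e2 0).add (e2 1)) :
    _ ∈ weightedHomogeneousSubmodule ℂ wtZ (2 * d + (n + 2))) e3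
  exact key

end Components

theorem euler_wtZ {P : PolyLX} (h : P.IsWeightedHomogeneous wtZ 0) :
    X (Sum.inl 0) * pderiv (Sum.inl 0) P + X (Sum.inl 1) * pderiv (Sum.inl 1) P =
      X (Sum.inr 0) * pderiv (Sum.inr 0) P + X (Sum.inr 1) * pderiv (Sum.inr 1) P := by
  rw [P.as_sum]
  simp only [map_sum, mul_sum, ← sum_add_distrib]
  refine sum_congr rfl fun d hd => ?_
  have h1 := h (mem_support_iff.1 hd)
  simp [Finsupp.weight_apply, Finsupp.sum_fintype, Fintype.sum_sum_type, wtZ] at h1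
  have h2 : d (Sum.inl 0) + d (Sum.inl 1) = d (Sum.inr 0) + d (Sum.inr 1) := by omega
  simp only [X_mul_pderiv_monomial, ← add_smul, h2]

theorem cov_euler_wtZ {P : PolyLX} (h : P.IsWeightedHomogeneous wtZ 0) :
    X (Sum.inl 0) * cov (Sum.inl 0) P + X (Sum.inl 1) * cov (Sum.inl 1) P =
      X (Sum.inr 0) * cov (Sum.inr 0) P + X (Sum.inr 1) * cov (Sum.inr 1) P := by
  simp only [cov_apply, Sum.swap_inl, Sum.swap_inr]
  linear_combination euler_wtZ h

theorem euler_wtX {P : PolyLX} {N : ℕ} (h : P.IsWeightedHomogeneous wtX N) :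
    X (Sum.inr 0) * pderiv (Sum.inr 0) P + X (Sum.inr 1) * pderiv (Sum.inr 1) P = (N : PolyLX) * P := by
  simpa [Fintype.sum_sum_type, wtX] using h.sum_weight_X_mul_pderiv

theorem euler_wtL {P : PolyLX} {N : ℕ} (h : P.IsWeightedHomogeneous wtL N) :
    X (Sum.inl 0) * pderiv (Sum.inl 0) P + X (Sum.inl 1) * pderiv (Sum.inl 1) P = (N : PolyLX) * P := by
  simpa [Fintype.sum_sum_type, wtL] using h.sum_weight_X_mul_pderiv

theorem isWeightedHomogeneous_wtZ {P : PolyLX} {i j : ℕ} (hL : P.IsWeightedHomogeneous wtL i)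
    (hX : P.IsWeightedHomogeneous wtX j) : P.IsWeightedHomogeneous wtZ (i - j) := by
  intro d hd
  rw [weight_wtZ, hL hd, hX hd]

theorem isWeightedHomogeneous_wtL_of_wtZ {P : PolyLX} {i j : ℕ} {n : ℤ}
    (hZ : P.IsWeightedHomogeneous wtZ n)
    (hX : P.IsWeightedHomogeneous wtX j) (hi : (i : ℤ) = n + j) : P.IsWeightedHomogeneous wtL i := by
  intro d hd
  have h1 := hZ hd
  rw [weight_wtZ, hX hd] at h1
  omega

theorem comp_isWeightedHomogeneous_wtZ {P : PolyLX} {n : ℤ} (hZ : P.IsWeightedHomogeneous wtZ n)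
    (j : ℕ) : (comp wtX j P).IsWeightedHomogeneous wtZ n := by
  classical
  intro d hd
  rw [coeff_weightedHomogeneousComponent] at hd
  split_ifs at hd
  · exact hZ hd
  · exact absurd rfl hd

theorem comp_wtX_eq_comp_wtL {P : PolyLX} {n : ℤ} (hZ : P.IsWeightedHomogeneous wtZ n) {i j : ℕ}
    (hi : (i : ℤ) = n + j) : comp wtX j P = comp wtL i P := by
  classical
  ext d
  rw [coeff_weightedHomogeneousComponent, coeff_weightedHomogeneousComponent]
  by_cases hd : coeff d P = 0
  · simp [hd]
  · have h1 := hZ hd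
    rw [weight_wtZ] at h1
    have : Finsupp.weight wtX d = j ↔ Finsupp.weight wtL d = i := by omega
    simp only [this]

theorem comp_wtX_eq_zero_of_wtZ {P : PolyLX} {n : ℤ} (hZ : P.IsWeightedHomogeneous wtZ n) {j : ℕ}
    (hi : n + j < 0) : comp wtX j P = 0 := by
  classical
  ext d
  rw [coeff_weightedHomogeneousComponent]
  by_cases hd : coeff d P = 0
  · simp [hd]
  · have h1 := hZ hd
    rw [weight_wtZ] at h1
    rw [if_neg (by omega)]
    simp

end GaugedOperator

/-! ### Bispectrality: the differential equations in λ and in x. -/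

section Equations

open MvPolynomial

variable {ι : Type*} [Fintype ι] {e : ι → Fin 2 → ℂ} {m : ι → ℕ} {P : PolyLX}

theorem dX_eq_zero {f : PolyLX} (hf : f.IsWeightedHomogeneous wtX 0) (v : Fin 2 → ℂ) :
    dX v f = 0 := by
  rw [dX_apply, pderiv_inr_eq_zero hf, pderiv_inr_eq_zero hf]; simp

theorem QuasiInvAlong.gaugedOp {v : Fin 2 → ℂ} (hv : dotProduct v v = 1) {k : ℕ} {f : PolyLX}
    (hP : QuasiInvAlong v k P) (hf : f.IsWeightedHomogeneous wtX 0) :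
    QuasiInvAlong v k (gaugedOp Sum.inl f P) := by
  have h2 : (2 : PolyLX).IsWeightedHomogeneous wtX 0 := isWeightedHomogeneous_C (R := ℂ) wtX 2
  have hf2 : (f ^ 2).IsWeightedHomogeneous wtX 0 := by simpa using hf.pow 2
  have hk : ∀ k, (2 * f * pderiv (Sum.inl k) f).IsWeightedHomogeneous wtX 0 := fun k => by
    simpa using (h2.mul hf).mul (hf.pderiv (i := Sum.inl k) (n' := 0) rfl)
  rw [BakerAkhiezer.gaugedOp, gaugedSq_apply, mul_assoc (f ^ 2)]
  exact ((((hP.cov_inl 0).cov_inl 0).add ((hP.cov_inl 1).cov_inl 1)).mul (dX_eq_zero hf2 v)).sub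
    (((hP.cov_inl 0).mul (dX_eq_zero (hk 0) v)).add ((hP.cov_inl 1).mul (dX_eq_zero (hk 1) v)))
    |>.sub ((hP.mul_norm_sq hv).mul (dX_eq_zero hf2 v))

theorem gaugedLaplacian_zero (s : Fin 2 → Fin 2 ⊕ Fin 2) (f : PolyLX) :
    gaugedLaplacian s f 0 = 0 := by
  simp [gaugedLaplacian]

/-- The differential equation in `λ`. -/
theorem exists_lam_equation (he : ∀ i, dotProduct (e i) (e i) = 1)
    (hne : ∀ i j, j ≠ i → dotProduct (e j) (perp (e i)) ≠ 0)
    (hP : ∀ i, QuasiInvAlong (e i) (m i) P) (hN : ∀ j, ∑ i, m i < j → comp wtX j P = 0)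
    (htop : comp wtX (∑ i, m i) P = prodLam e m * prodX e m) :
    ∃ w : PolyLX, w.IsWeightedHomogeneous wtX 0 ∧
      prodLam e m * gaugedOp Sum.inl (prodLam e m) P = w * P := by
  set N := ∑ i, m i with hNdef
  set a := prodLam e m with ha
  set b := prodX e m with hb
  have haX : a.IsWeightedHomogeneous wtX 0 := prodLam_isWeightedHomogeneous
  -- Operators in λ respect conditions imposed on x; the term with (x, x) does so as well by
  -- `QuasiInvAlong.mul_norm_sq`.
  have hQ : ∀ i, QuasiInvAlong (e i) (m i) (gaugedOp Sum.inl a P) :=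
    fun i => (hP i).gaugedOp (he i) haX
  -- The only possible term above x-degree N is 2a (a D(ab) - (D a) ab) with D = `polar Sum.inl`; it
  -- vanishes because b does not involve λ.
  have hcomp : ∀ j, N < j → comp wtX j (gaugedOp Sum.inl a P) = 0 := by
    intro j hj
    obtain ⟨k, rfl⟩ : ∃ k, j = k + 1 := ⟨j - 1, by omega⟩
    rw [comp_succ_gaugedOp (fun _ => rfl) (fun _ => rfl) haX, hN _ hj, gaugedLaplacian_zero]
    rcases eq_or_lt_of_le (Nat.lt_succ_iff.1 hj) with h | h
    · have hpb : polar Sum.inl b = 0 := by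
        rw [polar_apply, pderiv_inl_eq_zero prodX_isWeightedHomogeneous_wtL,
          pderiv_inl_eq_zero prodX_isWeightedHomogeneous_wtL]
        simp
      rw [← h, htop, Derivation.leibniz, hpb]
      simp
      right
      ring
    · rw [hN _ h]
      simp
  obtain ⟨w, hw⟩ := prodX_dvd_leading he hne hQ hcomp
  have hbX : b.IsWeightedHomogeneous wtX N := prodX_isWeightedHomogeneous
  have hwX : w.IsWeightedHomogeneous wtX 0 := by
    refine isWeightedHomogeneous_factor hbX (prodX_ne_zero he) ?_
    rw [← hw, add_zero]
    exact weightedHomogeneousComponent_isWeightedHomogeneous N _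
  -- By the choice of w the difference of the two sides has x-degree below N; being quasi-invariant,
  -- it is zero.
  refine ⟨w, hwX, sub_eq_zero.1 ?_⟩
  refine eq_zero_of_quasiInv he hne
    (fun i => ((hQ i).mul (dX_eq_zero haX _)).sub ((hP i).mul (dX_eq_zero hwX _))) fun j hj => ?_
  rw [map_sub, comp_mul_of_zero haX, comp_mul_of_zero hwX]
  rcases eq_or_lt_of_le hj with h | h
  · rw [← h, htop, hw]
    ring
  · rw [hcomp j h, hN j h]
    simp

theorem linFormLam_prime {v : Fin 2 → ℂ} (hv : dotProduct v v = 1) : Prime (linFormLam v) := by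
  have h : renameEquiv ℂ (Equiv.sumComm (Fin 2) (Fin 2)) (linFormX v) = linFormLam v := by
    simp [linFormX, linFormLam]
  rw [← h]
  exact (MulEquiv.prime_iff (renameEquiv ℂ (Equiv.sumComm (Fin 2) (Fin 2)))).2 (linFormX_prime hv)

theorem isRelPrime_prodLam_prodX (he : ∀ i, dotProduct (e i) (e i) = 1) :
    IsRelPrime (prodLam e m) (prodX e m) := by
  refine IsRelPrime.prod_left fun i _ => IsRelPrime.prod_right fun j _ => IsRelPrime.pow ?_
  rw [(linFormLam_prime (he i)).irreducible.isRelPrime_iff_not_dvd]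
  rintro ⟨Q, hQ⟩
  have h1 := congrArg (eval (Sum.elim 0 (e j))) hQ
  rw [map_mul, eval_linFormX, eval_linFormLam, he] at h1
  simp at h1

/-- The logarithmic equation `D g / g = D a / a` propagates to higher derivatives. -/
theorem derivation_iterate_of_proportional {A : Type*} [CommRing A] [IsDomain A] [Algebra ℂ A]
    (D : Derivation ℂ A A) {a g : A} (ha : a ≠ 0) (h : a * D g = D a * g) (n : ℕ) :
    a * D^[n] g = D^[n] a * g := by
  induction n with
  | zero => rfl
  | succ n ih =>
    have h1 := congrArg D ih
    rw [Derivation.leibniz, Derivation.leibniz] at h1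
    simp only [smul_eq_mul] at h1
    rw [Function.iterate_succ_apply', Function.iterate_succ_apply']
    apply mul_left_cancel₀ ha
    linear_combination a * h1 - D a * ih + D^[n] a * h

/-- Write a for the product in λ. The hypothesis says that g and a have equal logarithmic
derivatives, so a D^N g = (D^N a) g, with D^N a = N! ∏ (e_i, x)^(m_i). This is coprime to a, hence a
divides g. -/
theorem prodLam_dvd (he : ∀ i, dotProduct (e i) (e i) = 1) {g : PolyLX}
    (h : prodLam e m * polar Sum.inl g = polar Sum.inl (prodLam e m) * g) : prodLam e m ∣ g := by
  classical
  have h1 := derivation_iterate_of_proportional _ (prodLam_ne_zero he) h (∑ i, m i)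
  have h2 : ∀ v, polar Sum.inl (linFormLam v) = linFormX v := fun v => by
    rw [polar_apply, linFormX_apply, linFormLam_apply]
    simp [pderiv_X]
    ring
  have h3 : ∀ v, polar Sum.inl (linFormX v) = 0 := fun v => by
    rw [polar_apply, linFormX_apply]
    simp [pderiv_X]
  have h4 : (polar Sum.inl)^[∑ i, m i] (prodLam e m) = ((∑ i, m i).factorial : PolyLX) * prodX e m :=
    (derivation_iterate_prod (polar Sum.inl) (fun i => linFormLam (e i)) (fun i => linFormX (e i))
      (fun i => h2 _) (fun i => h3 _) m univ).1
  have h5 : prodLam e m ∣ g * prodX e m := by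
    refine ⟨C ((∑ i, m i).factorial : ℂ)⁻¹ * (polar Sum.inl)^[∑ i, m i] g, ?_⟩
    have h6 : (C ((∑ i, m i).factorial : ℂ)⁻¹ * ((∑ i, m i).factorial : PolyLX)) = 1 := by
      rw [← map_natCast (C : ℂ →+* PolyLX), ← C_mul, inv_mul_cancel₀, C_1]
      exact_mod_cast Nat.factorial_ne_zero _
    rw [h4] at h1
    linear_combination (-g * prodX e m) * h6 - C ((∑ i, m i).factorial : ℂ)⁻¹ * h1
  exact (isRelPrime_prodLam_prodX he).dvd_of_dvd_mul_right h5

variable {w : PolyLX}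

/-- In x-degree n + 1 the equation reduces to proportionality of the logarithmic derivatives of a
and of the leading component, the situation of `prodLam_dvd`. -/
theorem prodLam_dvd_leading (he : ∀ i, dotProduct (e i) (e i) = 1)
    (hw : w.IsWeightedHomogeneous wtX 0) {G : PolyLX}
    (hG : prodLam e m * gaugedOp Sum.inl (prodLam e m) G = w * G) {n : ℕ}
    (hn : ∀ j, n < j → comp wtX j G = 0) : prodLam e m ∣ comp wtX n G := by
  have haX : (prodLam e m).IsWeightedHomogeneous wtX 0 := prodLam_isWeightedHomogeneous
  have ha0 := prodLam_ne_zero (m := m) he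
  have h1 := congrArg (comp wtX (n + 1)) hG
  rw [comp_mul_of_zero haX, comp_mul_of_zero hw, hn (n + 1) (by omega), mul_zero,
    comp_succ_gaugedOp (fun _ => rfl) (fun _ => rfl) haX, hn (n + 1) (by omega),
    gaugedLaplacian_zero, zero_add] at h1
  have h2 := (mul_eq_zero.1 h1).resolve_left ha0
  have h3 := (mul_eq_zero.1 h2).resolve_left (mul_ne_zero two_ne_zero ha0)
  exact prodLam_dvd he (sub_eq_zero.1 h3)

/-- A solution of the equation in `λ` of small degree in `λ` vanishes. -/
theorem eq_zero_of_lam_equation (he : ∀ i, dotProduct (e i) (e i) = 1)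
    (hw : w.IsWeightedHomogeneous wtX 0) {G : PolyLX} {c : ℤ} (hGZ : G.IsWeightedHomogeneous wtZ c)
    (hG : prodLam e m * gaugedOp Sum.inl (prodLam e m) G = w * G)
    (hn : ∀ j : ℕ, ((∑ i, m i : ℕ) : ℤ) ≤ c + j → comp wtX j G = 0) : G = 0 := by
  obtain ⟨B, hB⟩ := exists_comp_bound wtX G
  -- Descending induction on the x-degree n; that component has λ-degree c + n, and it is divisible
  -- by a polynomial of λ-degree N.
  have h : ∀ k n, B ≤ n + k → comp wtX n G = 0 := by
    intro k
    induction k with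
    | zero => exact hB
    | succ k ih =>
      intro n hk
      rcases le_or_gt ((∑ i, m i : ℕ) : ℤ) (c + n) with h1 | h1
      · exact hn n h1
      rcases lt_or_ge (c + n) 0 with h2 | h2
      · exact comp_wtX_eq_zero_of_wtZ hGZ h2
      obtain ⟨g, hg⟩ := prodLam_dvd_leading he hw hG (n := n) fun j hj => ih j (by omega)
      have h3 : (comp wtX n G).IsWeightedHomogeneous wtL (c + n).toNat :=
        isWeightedHomogeneous_wtL_of_wtZ (comp_isWeightedHomogeneous_wtZ hGZ n)
          (weightedHomogeneousComponent_isWeightedHomogeneous n G) (Int.toNat_of_nonneg h2)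
      rw [hg] at h3 ⊢
      rw [eq_zero_of_isWeightedHomogeneous_mul prodLam_isWeightedHomogeneous_wtL
        (prodLam_ne_zero he) h3 (by omega), mul_zero]
  exact eq_zero_of_comp fun n => h _ n (Nat.le_add_left _ _)

/-- The differential equation in `x`. -/
theorem exists_x_equation (he : ∀ i, dotProduct (e i) (e i) = 1)
    (hne : ∀ i j, j ≠ i → dotProduct (e j) (perp (e i)) ≠ 0)
    (hm : ∑ i, m i ≠ 0) (hP : ∀ i, QuasiInvAlong (e i) (m i) P) (hPZ : P.IsWeightedHomogeneous wtZ 0)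
    (hN : ∀ j, ∑ i, m i < j → comp wtX j P = 0)
    (htop : comp wtX (∑ i, m i) P = prodLam e m * prodX e m) :
    ∃ h : PolyLX, h.IsWeightedHomogeneous wtL 0 ∧
      prodX e m * gaugedOp Sum.inr (prodX e m) P = h * P := by
  obtain ⟨w, hwX, hw⟩ := exists_lam_equation he hne hP hN htop
  set N := ∑ i, m i with hNdef
  set a := prodLam e m with ha
  set b := prodX e m with hb
  have haX : a.IsWeightedHomogeneous wtX 0 := prodLam_isWeightedHomogeneous
  have haL : a.IsWeightedHomogeneous wtL N := prodLam_isWeightedHomogeneous_wtL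
  have hbX : b.IsWeightedHomogeneous wtX N := prodX_isWeightedHomogeneous
  have hbL : b.IsWeightedHomogeneous wtL 0 := prodX_isWeightedHomogeneous_wtL
  have hbZ : b.IsWeightedHomogeneous wtZ (-N) := by
    simpa using isWeightedHomogeneous_wtZ hbL hbX
  have hNL : ∀ j, N < j → comp wtL j P = 0 := fun j hj => by
    rw [← comp_wtX_eq_comp_wtL hPZ (j := j) (by ring), hN j hj]
  have htopL : comp wtL N P = a * b := by
    rw [← comp_wtX_eq_comp_wtL hPZ (j := N) (by ring), htop]
  set Q := gaugedOp Sum.inr b P with hQ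
  have hQZ : Q.IsWeightedHomogeneous wtZ (2 - 2 * N) := by
    have := isWeightedHomogeneous_gaugedOp_inr hPZ hbZ
    rwa [show 2 * (-(N : ℤ)) + (0 + 2) = 2 - 2 * N by ring] at this
  -- Q inherits the λ-equation of P, since the two operators commute on P and w depends on λ only.
  have hQw : a * gaugedOp Sum.inl a Q = w * Q := by
    rw [hQ, gaugedOp_comm (fun k => pderiv_inr_eq_zero haX k) (fun k => pderiv_inl_eq_zero hbL k)
      (euler_wtL haL) (euler_wtX hbX) (cov_euler_wtZ hPZ),
      ← gaugedOp_mul (pderiv_inr_eq_zero haX 0) (pderiv_inr_eq_zero haX 1), hw,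
      gaugedOp_mul (pderiv_inr_eq_zero hwX 0) (pderiv_inr_eq_zero hwX 1)]
  have hQL : ∀ j, N < j → comp wtL j Q = 0 := by
    intro j hj
    obtain ⟨k, rfl⟩ : ∃ k, j = k + 1 := ⟨j - 1, by omega⟩
    rw [comp_succ_gaugedOp (fun _ => rfl) (fun _ => rfl) hbL, hNL _ hj, gaugedLaplacian_zero]
    rcases eq_or_lt_of_le (Nat.lt_succ_iff.1 hj) with h | h
    · have hpa : polar Sum.inr a = 0 := by
        rw [polar_apply, pderiv_inr_eq_zero haX, pderiv_inr_eq_zero haX]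
        simp
      rw [← h, htopL, Derivation.leibniz, hpa]
      simp
      right
      ring
    · rw [hNL _ h]
      simp
  -- Q has weight 2 - 2N, so its λ-degree N corresponds to x-degree 3N - 2. The truncated
  -- subtraction is exact because N ≥ 1.
  obtain ⟨M, hM⟩ : ∃ M, M = 3 * N - 2 := ⟨_, rfl⟩
  have hMZ : (N : ℤ) = 2 - 2 * N + M := by omega
  obtain ⟨h, hh⟩ := prodLam_dvd_leading he hwX hQw (n := M) fun j hj => by
    rw [comp_wtX_eq_comp_wtL hQZ (i := (2 - 2 * N + j : ℤ).toNat) (by omega)]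
    exact hQL _ (by omega)
  rw [← ha] at hh
  have hhL : h.IsWeightedHomogeneous wtL 0 := by
    refine isWeightedHomogeneous_factor haL (prodLam_ne_zero he) ?_
    rw [← hh, add_zero, comp_wtX_eq_comp_wtL hQZ hMZ]
    exact weightedHomogeneousComponent_isWeightedHomogeneous _ _
  have hhX : h.IsWeightedHomogeneous wtX M := by
    refine isWeightedHomogeneous_factor haX (prodLam_ne_zero he) ?_
    rw [← hh, zero_add]
    exact weightedHomogeneousComponent_isWeightedHomogeneous _ _
  have hhZ : h.IsWeightedHomogeneous wtZ (-M) := by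
    simpa using isWeightedHomogeneous_wtZ hhL hhX
  have hGZ : (b * Q - h * P).IsWeightedHomogeneous wtZ (2 - 3 * N) := by
    have e1 := hbZ.mul hQZ
    have e2 := hhZ.mul hPZ
    rw [show -(N : ℤ) + (2 - 2 * N) = 2 - 3 * N by ring] at e1
    rw [show -(M : ℤ) + 0 = 2 - 3 * N by omega] at e2
    exact Submodule.sub_mem (weightedHomogeneousSubmodule ℂ wtZ (2 - 3 * N : ℤ)) e1 e2
  -- The difference b Q - h P solves the λ-equation, and its component of λ-degree N cancels by the
  -- choice of h; uniqueness gives zero.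
  refine ⟨h, hhL, sub_eq_zero.1 (eq_zero_of_lam_equation (m := m) he hwX hGZ ?_ ?_)⟩
  · have e3 : gaugedOp Sum.inl a (b * Q - h * P) =
        b * gaugedOp Sum.inl a Q - h * gaugedOp Sum.inl a P := by
      rw [← gaugedOp_mul (pderiv_inl_eq_zero hbL 0) (pderiv_inl_eq_zero hbL 1),
        ← gaugedOp_mul (pderiv_inl_eq_zero hhL 0) (pderiv_inl_eq_zero hhL 1), gaugedOp, gaugedOp,
        gaugedOp, map_sub]
      ring
    rw [← ha, e3]
    linear_combination b * hQw - h * hw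
  · intro j hj
    rw [comp_wtX_eq_comp_wtL hGZ (i := (2 - 3 * N + j : ℤ).toNat) (by omega), map_sub,
      comp_mul_of_zero hbL, comp_mul_of_zero hhL]
    rcases eq_or_lt_of_le hj with h1 | h1
    · rw [← h1, Int.toNat_natCast, htopL, ← comp_wtX_eq_comp_wtL hQZ hMZ, hh]
      ring
    · rw [hNL _ (by omega), hQL _ (by omega)]
      simp

end Equations

/-! ### Values of quasi-invariant polynomials on a line. -/

section Restrictions

open MvPolynomial

variable {e : Fin 2 → ℂ} {m : ℕ} {F : PolyLX}

/-- The binomial system of degree n - j < m has only the trivial solution; the unknown r = 0 is the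
restriction of the component of degree j. -/
theorem QuasiInvAlong.dvd_comp_of_lt (he : dotProduct e e = 1) (hF : QuasiInvAlong e m F)
    {n j : ℕ} (hn : ∀ j, n < j → comp wtX j F = 0) (hj : n < j + m) :
    linFormX e ∣ comp wtX j F := by
  rcases lt_or_ge n j with h | h
  · rw [hn j h]; exact dvd_zero _
  rw [linFormX_dvd_iff he]
  have h1 := eq_zero_of_sum_choose (A := PolyLX) (d := n - j)
    (S := (Icc 1 m).image fun s => 2 * s - 1)
    (Y := fun r => linFormLam e ^ (n - j - r) *
      restr e ((dX e)^[r] (comp wtX (n - (n - j) + r) F)))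
    (by rw [card_image_odd]; omega) (by
      intro u hu
      obtain ⟨s, hs, rfl⟩ := mem_image.1 hu
      exact hF.sum_choose he hn (Nat.sub_le n j) (mem_Icc.1 hs).1 (mem_Icc.1 hs).2) 0 (Nat.zero_le _)
  have h2 := (mul_eq_zero.1 h1).resolve_left (pow_ne_zero _ (linFormLam_ne_zero he))
  rwa [Function.iterate_zero, id, add_zero, Nat.sub_sub_self h] at h2

theorem restr_iterate_pow_mul (he : dotProduct e e = 1) (k : ℕ) (f : PolyLX) :
    restr e ((dX e)^[k] (linFormX e ^ k * f)) = (k.factorial : PolyLX) * restr e f := by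
  induction k with
  | zero => simp
  | succ k ih =>
    rw [pow_succ', mul_assoc, derivation_iterate_mul (dX e) (dX_linFormX e e) (by simp [he]),
      map_add, map_mul, restr_linFormX, zero_mul, zero_add, map_mul, ih, he, Nat.factorial_succ]
    simp
    ring

theorem linFormX_dvd_of_eval_perp (he : dotProduct e e = 1) {n : ℕ}
    (hF : F.IsWeightedHomogeneous wtX n)
    (h : ∀ lam : Fin 2 → ℂ, eval (Sum.elim lam (perp e)) F = 0) : linFormX e ∣ F := by
  apply linFormX_dvd_of_eval he
  intro lam s _
  have h1 := eval_of_isWeightedHomogeneous hF s (Sum.elim lam (perp e))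
  rw [h, mul_zero] at h1
  rw [← h1]
  congr 1
  ext (k | k) <;> simp [wtX]

/-- Replacing λ by sλ gives a polynomial in s that vanishes identically; its coefficients are the
values of the components. -/
theorem eval_comp_wtL_eq_zero {x : Fin 2 → ℂ}
    (h : ∀ lam : Fin 2 → ℂ, eval (Sum.elim lam x) F = 0) (K : ℕ) (lam : Fin 2 → ℂ) :
    eval (Sum.elim lam x) (comp wtL K F) = 0 := by
  obtain ⟨B, hB⟩ := exists_comp_bound wtL F
  set p : Polynomial ℂ := ∑ n ∈ range B,
    Polynomial.monomial n (eval (Sum.elim lam x) (comp wtL n F)) with hp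
  have hp0 : p = 0 := by
    apply Polynomial.funext
    intro s
    rw [hp, Polynomial.eval_finsetSum, Polynomial.eval_zero, ← h (s • lam)]
    conv_rhs => rw [eq_sum_comp hB, map_sum]
    refine sum_congr rfl fun n _ => ?_
    have h1 := eval_of_isWeightedHomogeneous
      (weightedHomogeneousComponent_isWeightedHomogeneous (w := wtL) n F) s (Sum.elim lam x)
    rw [Polynomial.eval_monomial, mul_comm, ← h1]
    congr 1
    ext (k | k) <;> simp [wtL]
  rcases le_or_gt B K with h1 | h1
  · rw [hB K h1, map_zero]
  · have h2 := congrArg (fun q => Polynomial.coeff q K) hp0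
    simpa [hp, Polynomial.finsetSum_coeff, Polynomial.coeff_monomial, h1] using h2

theorem isWeightedHomogeneous_twX {n : ℤ} (h : F.IsWeightedHomogeneous wtZ n) (v : Fin 2 → ℂ) :
    (twX v F).IsWeightedHomogeneous wtZ (n + 1) := by
  rw [twX_apply']
  exact ((isWeightedHomogeneous_cov_inr h 0).C_mul _).add
    ((isWeightedHomogeneous_cov_inr h 1).C_mul _)

/-- The second derivative across the line, its first derivative along the line, and the values on
the line of a quasi-invariant polynomial of weight zero are not proportional. -/
theorem QuasiInvAlong.exists_not_proportional (he : dotProduct e e = 1)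
    (hF : QuasiInvAlong e m F) (hFZ : F.IsWeightedHomogeneous wtZ 0)
    {n : ℕ} (hn : ∀ j, n < j → comp wtX j F = 0) (hmn : m ≤ n)
    (hne : restr e ((dX e)^[m] (comp wtX n F)) ≠ 0) :
    ∃ lam lam' : Fin 2 → ℂ,
      eval (Sum.elim lam (perp e)) (twX e (twX e F) - twX (perp e) F) *
          eval (Sum.elim lam' (perp e)) F ≠
        eval (Sum.elim lam' (perp e)) (twX e (twX e F) - twX (perp e) F) *
          eval (Sum.elim lam (perp e)) F := by
  by_contra! hcon
  -- If F vanished on the line, the system would have the additional zero u = 0, where only its r =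
  -- 0 term survives.
  obtain ⟨lam', hlam'⟩ : ∃ lam' : Fin 2 → ℂ, eval (Sum.elim lam' (perp e)) F ≠ 0 := by
    by_contra! h0
    apply hF.sum_choose_ne_zero he hn hmn hne (u := 0) (by simp)
    have h1 := eval_comp_wtL_eq_zero h0 (n - m)
    rw [← comp_wtX_eq_comp_wtL hFZ (j := n - m) (by ring)] at h1
    have h2 := linFormX_dvd_of_eval_perp he
      (weightedHomogeneousComponent_isWeightedHomogeneous (n - m) F) h1
    rw [linFormX_dvd_iff he] at h2
    refine sum_eq_zero fun r _ => ?_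
    rcases r with _ | r
    · rw [Function.iterate_zero, id, add_zero, h2]
      simp
    · simp
  set c := eval (Sum.elim lam' (perp e)) (twX e (twX e F) - twX (perp e) F) /
    eval (Sum.elim lam' (perp e)) F with hc
  have hZ : ∀ lam : Fin 2 → ℂ, eval (Sum.elim lam (perp e))
      (twX e (twX e F) - twX (perp e) F - C c * F) = 0 := by
    intro lam
    rw [map_sub, map_mul, eval_C, hc, sub_eq_zero, div_mul_eq_mul_div, eq_div_iff hlam']
    exact hcon lam lam'
  -- Proportionality is now read in λ-degree n - m + 2. The components of F of x-degrees n - m + 1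
  -- and n - m + 2 vanish on the line, so the contributions of F and of its derivative along the
  -- line drop out. The second normal derivative is then zero there, which makes u = 2 an additional
  -- zero of the system.
  have hd1 := hF.dvd_comp_of_lt he hn (j := n - m + 1) (by omega)
  have hd2 := hF.dvd_comp_of_lt he hn (j := n - m + 2) (by omega)
  have hF1 := isWeightedHomogeneous_twX hFZ (perp e)
  have hF2 := isWeightedHomogeneous_twX (isWeightedHomogeneous_twX hFZ e) e
  have hval : ∀ lam : Fin 2 → ℂ, eval (Sum.elim lam (perp e)) (comp wtX (n - m) (twX e (twX e F)))
      = 0 := by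
    intro lam
    have h1 := eval_comp_wtL_eq_zero hZ (n - m + 2) lam
    rw [map_sub, map_sub (comp wtL (n - m + 2)) (twX e (twX e F)),
      weightedHomogeneousComponent_C_mul, ← comp_wtX_eq_comp_wtL hFZ (j := n - m + 2) (by push_cast; ring),
      ← comp_wtX_eq_comp_wtL hF1 (j := n - m + 1) (by push_cast; ring),
      ← comp_wtX_eq_comp_wtL hF2 (j := n - m) (by push_cast; ring)] at h1
    have h2 := comp_wtX_twX_pow (perp e) 1 (n - m + 1) F
    have h3 : linFormX e ∣ dX (perp e) (comp wtX (n - m + 2) F) := by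
      obtain ⟨Q, hQ⟩ := hd2
      refine ⟨dX (perp e) Q, ?_⟩
      rw [hQ, Derivation.leibniz, dX_linFormX, dotProduct_comm, dotProduct_perp]
      simp
    have h4 : linFormX e ∣ comp wtX (n - m + 1) (twX (perp e) F) := by
      rw [pow_one] at h2
      rw [h2, sum_range_succ, sum_range_one]
      simp only [Function.iterate_zero, id, Function.iterate_one]
      exact dvd_add (Dvd.dvd.mul_left (Dvd.dvd.mul_left hd1 _) _)
        (Dvd.dvd.mul_left (Dvd.dvd.mul_left h3 _) _)
    have h5 : dotProduct e (perp e) = 0 := dotProduct_perp e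
    rw [map_sub, map_sub, eval_eq_zero_of_linFormX_dvd h4 lam h5, map_mul,
      eval_eq_zero_of_linFormX_dvd hd2 lam h5] at h1
    simpa using h1
  have hdvd := linFormX_dvd_of_eval_perp he
    (weightedHomogeneousComponent_isWeightedHomogeneous (n - m) _) hval
  have h6 := comp_wtX_twX_pow e 2 (n - m) F
  rw [pow_two, Module.End.mul_apply] at h6
  rw [linFormX_dvd_iff he, h6, map_sum] at hdvd
  simp only [map_mul, map_natCast, map_pow, restr_linFormLam] at hdvd
  have h7 := sum_choose_shift (linFormLam e) (u := 2) (d := m)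
    (y := fun r => restr e ((dX e)^[r] (comp wtX (n - m + r) F))) (fun r hr => by
      rw [hn _ (by omega), iterate_map_zero, map_zero])
  rw [hdvd, mul_zero] at h7
  exact hF.sum_choose_ne_zero he hn hmn hne (u := 2) (by simp)
    ((mul_eq_zero.1 h7.symm).resolve_left (pow_ne_zero _ (linFormLam_ne_zero he)))

end Restrictions

/-! ### Logarithmic derivatives after a change of rings. -/

section LogDerivative

theorem map_derivation_prod {A B ι : Type*} [CommRing A] [Algebra ℂ A] [CommRing B]
    (D : Derivation ℂ A A) (S : A →+* B) (l : ι → A) (m : ι → ℕ) {z : B} {θ : ι → B}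
    (h : ∀ j, z * S (D (l j)) = θ j * S (l j)) (s : Finset ι) :
    z * S (D (∏ j ∈ s, l j ^ m j)) = (∑ j ∈ s, m j * θ j) * S (∏ j ∈ s, l j ^ m j) := by
  classical
  have hpow : ∀ j, ∀ n : ℕ, z * S (D (l j ^ n)) = n * θ j * S (l j ^ n) := by
    intro j n
    induction n with
    | zero => simp
    | succ n ih =>
      rw [pow_succ, Derivation.leibniz, map_add, smul_eq_mul, smul_eq_mul, map_mul, map_mul,
        map_mul]
      push_cast
      linear_combination S (l j ^ n) * h j + S (l j) * ih
  induction s using Finset.induction_on with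
  | empty => simp
  | insert a s ha ih =>
    rw [prod_insert ha, sum_insert ha, Derivation.leibniz, map_add, smul_eq_mul, smul_eq_mul,
      map_mul, map_mul, map_mul]
    linear_combination S (l a ^ m a) * ih + S (∏ j ∈ s, l j ^ m j) * hpow a (m a)

end LogDerivative

/-! ### Local expansion of the x-equation at a line. -/

section Local

open MvPolynomial

theorem lineSubst_eq_of_isWeightedHomogeneous {f : PolyLX} (hf : f.IsWeightedHomogeneous wtL 0)
    (lam lam' x v : Fin 2 → ℂ) : lineSubst lam x v f = lineSubst lam' x v f := by
  rw [f.as_sum, map_sum, map_sum]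
  refine sum_congr rfl fun d hd => ?_
  have h1 := hf (mem_support_iff.1 hd)
  simp [Finsupp.weight_apply, Finsupp.sum_fintype, Fintype.sum_sum_type, wtL] at h1
  rw [lineSubst, lineSubst, aeval_monomial, aeval_monomial]
  congr 1
  refine Finsupp.prod_congr fun i hi => ?_
  rcases i with k | k
  · exfalso
    rw [Finsupp.mem_support_iff] at hi
    fin_cases k
    · exact hi h1.1
    · exact hi h1.2
  · simp

theorem gaugedOp_inr_eq {v : Fin 2 → ℂ} (hv : dotProduct v v = 1) (b P : PolyLX) :
    gaugedOp Sum.inr b P = b ^ 2 * (twX v (twX v P) + twX (perp v) (twX (perp v) P) -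
        (X (Sum.inl 0) ^ 2 + X (Sum.inl 1) ^ 2) * P) -
      2 * b * (dX v b * twX v P + dX (perp v) b * twX (perp v) P) := by
  have h1 : (C (v 0) * C (v 0) + C (v 1) * C (v 1) : PolyLX) = 1 := by
    rw [← C_1, ← hv]
    simp [dotProduct, Fin.sum_univ_two]
  rw [gaugedOp, gaugedSq_apply, sum_cov_sq hv]
  simp only [dX_apply, twX_apply', perp, Matrix.cons_val_zero, Matrix.cons_val_one, C_neg,
    Sum.swap_inr]
  linear_combination (2 * b * (pderiv (Sum.inr 0) b * cov (Sum.inr 0) P +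
    pderiv (Sum.inr 1) b * cov (Sum.inr 1) P)) * h1

theorem lineSubst_linFormX_ne_zero {κ : Type*} {e : κ → Fin 2 → ℂ} (he : ∀ i, dotProduct (e i) (e i) = 1)
    (hne : ∀ i j, j ≠ i → dotProduct (e j) (perp (e i)) ≠ 0) (i j : κ) (lam : Fin 2 → ℂ) :
    lineSubst lam (perp (e i)) (e i) (linFormX (e j)) ≠ 0 := by
  by_cases hij : j = i
  · subst hij
    have := lineSubst_linFormX_self (he j) lam 1
    rw [one_smul] at this
    rw [this]
    exact PowerSeries.X_ne_zero
  · intro h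
    have h1 := constantCoeff_lineSubst lam (perp (e i)) (e i) (linFormX (e j))
    rw [h, eval_linFormX, map_zero] at h1
    exact hne i j hij h1.symm

theorem lineSubst_linFormX_one {κ : Type*} {e : κ → Fin 2 → ℂ} {i j : κ}
    (h : dotProduct (e j) (perp (e i)) ≠ 0)
    (lam : Fin 2 → ℂ) : invLinear 1 (slope e i j) *
      lineSubst lam (perp (e i)) (e i) (linFormX (e j)) =
        PowerSeries.C (dotProduct (e j) (perp (e i))) := by
  have h1 := lineSubst_linFormX h lam 1
  rw [one_smul] at h1
  rw [h1]
  have h2 := invLinear_spec one_ne_zero (slope e i j)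
  rw [slope] at h2 ⊢
  linear_combination PowerSeries.C (dotProduct (e j) (perp (e i))) * h2

variable {ι : Type*} [Fintype ι] [DecidableEq ι] {e : ι → Fin 2 → ℂ} {m : ι → ℕ} {P : PolyLX}

/-- The logarithmic derivative of the product in the normal direction is m_i/t + ∑ m_j c_j/(1 + c_j
t), with c_j the slopes; it is multiplied by t to clear the pole. -/
theorem lineSubst_dX_prodX (he : ∀ i, dotProduct (e i) (e i) = 1)
    (hne : ∀ i j, j ≠ i → dotProduct (e j) (perp (e i)) ≠ 0) (i : ι) (lam : Fin 2 → ℂ) :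
    PowerSeries.X * lineSubst lam (perp (e i)) (e i) (dX (e i) (prodX e m)) =
      (PowerSeries.C (m i : ℂ) + PowerSeries.X * tangentCoeff e m i 1) *
        lineSubst lam (perp (e i)) (e i) (prodX e m) := by
  set S := lineSubst lam (perp (e i)) (e i) with hS
  have hC : ∀ c, S (C c) = PowerSeries.C c := fun c => by simp [hS, lineSubst]
  have h := map_derivation_prod (dX (e i)) (S : PolyLX →+* PowerSeries ℂ)
    (fun j => linFormX (e j)) m (z := PowerSeries.X)
    (θ := fun j => if j = i then 1 else
      PowerSeries.X * (PowerSeries.C (slope e i j) * invLinear 1 (slope e i j))) (by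
    intro j
    simp only [RingHom.coe_coe]
    rw [dX_linFormX, hC]
    split_ifs with hj
    · have h1 := lineSubst_linFormX_self (he i) lam 1
      rw [one_smul, ← hS] at h1
      rw [hj, he, h1]
      simp
    · have h1 := lineSubst_linFormX_one (hne i j hj) lam
      rw [← hS] at h1
      have h2 : PowerSeries.C (dotProduct (e j) (e i)) = PowerSeries.C (slope e i j) *
          PowerSeries.C (dotProduct (e j) (perp (e i))) := by
        rw [← map_mul, slope, div_mul_cancel₀ _ (hne i j hj)]
      rw [dotProduct_comm, h2]
      linear_combination (-PowerSeries.X * PowerSeries.C (slope e i j)) * h1) univ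
  rw [RingHom.coe_coe] at h
  rw [prodX, h]
  congr 1
  rw [← add_sum_erase univ _ (mem_univ i), if_pos rfl, mul_one, tangentCoeff, mul_sum]
  congr 1
  refine sum_congr rfl fun j hj => ?_
  rw [if_neg (ne_of_mem_erase hj), map_mul, map_natCast]
  ring

theorem lineSubst_dX_perp_prodX
    (hne : ∀ i j, j ≠ i → dotProduct (e j) (perp (e i)) ≠ 0) (i : ι) (lam : Fin 2 → ℂ) :
    lineSubst lam (perp (e i)) (e i) (dX (perp (e i)) (prodX e m)) =
      alongCoeff e m i 1 * lineSubst lam (perp (e i)) (e i) (prodX e m) := by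
  set S := lineSubst lam (perp (e i)) (e i) with hS
  have hC : ∀ c, S (C c) = PowerSeries.C c := fun c => by simp [hS, lineSubst]
  have h := map_derivation_prod (dX (perp (e i))) (S : PolyLX →+* PowerSeries ℂ)
    (fun j => linFormX (e j)) m (z := 1)
    (θ := fun j => if j = i then 0 else invLinear 1 (slope e i j)) (by
    intro j
    simp only [RingHom.coe_coe]
    rw [dX_linFormX, hC, dotProduct_comm]
    split_ifs with hj
    · rw [hj, dotProduct_perp]
      simp
    · have h1 := lineSubst_linFormX_one (hne i j hj) lam
      rw [← hS] at h1
      rw [h1, one_mul]) univ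
  rw [RingHom.coe_coe, one_mul] at h
  rw [prodX, h]
  congr 1
  rw [← add_sum_erase univ _ (mem_univ i), if_pos rfl, mul_zero, zero_add, alongCoeff]
  refine sum_congr rfl fun j hj => ?_
  rw [if_neg (ne_of_mem_erase hj), map_natCast]

/-- A configuration with a quasi-invariant polynomial of the prescribed leading term satisfies the
conditions on the slopes. -/
theorem slope_sum_eq_zero (he : ∀ i, dotProduct (e i) (e i) = 1)
    (hne : ∀ i j, j ≠ i → dotProduct (e j) (perp (e i)) ≠ 0)
    (hP : ∀ i, QuasiInvAlong (e i) (m i) P) (hPZ : P.IsWeightedHomogeneous wtZ 0)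
    (hN : ∀ j, ∑ i, m i < j → comp wtX j P = 0)
    (htop : comp wtX (∑ i, m i) P = prodLam e m * prodX e m) (i : ι) {r : ℕ} (hr1 : 1 ≤ r)
    (hr2 : r ≤ m i) : ∑ j, (m j : ℂ) * slope e i j ^ (2 * r - 1) = 0 := by
  have hmi : m i ≤ ∑ i, m i := single_le_sum (f := m) (fun _ _ => Nat.zero_le _) (mem_univ i)
  obtain ⟨h, hhL, hh⟩ := exists_x_equation he hne (by omega) hP hPZ hN htop
  have hbL : (prodX e m).IsWeightedHomogeneous wtL 0 := prodX_isWeightedHomogeneous_wtL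
  set v := e i with hv
  -- The leading component contains (e_i, x) exactly to the power m_i, since the other factors do
  -- not vanish on the line.
  have hne0 : restr v ((dX v)^[m i] (comp wtX (∑ i, m i) P)) ≠ 0 := by
    have h1 : prodLam e m * prodX e m = linFormX v ^ m i *
        (prodLam e m * ∏ j ∈ univ.erase i, linFormX (e j) ^ m j) := by
      rw [prodX, ← mul_prod_erase univ _ (mem_univ i)]
      ring
    rw [htop, h1, restr_iterate_pow_mul (he i)]
    refine mul_ne_zero (by exact_mod_cast Nat.factorial_ne_zero _) ?_
    rw [Ne, ← linFormX_dvd_iff (he i), (linFormX_prime (he i)).dvd_mul, not_or]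
    constructor
    · intro h2
      obtain ⟨j, _, hj⟩ := (linFormX_prime (he i)).exists_mem_finset_dvd h2
      have h3 := eval_eq_zero_of_linFormX_dvd ((linFormX_prime (he i)).dvd_of_dvd_pow hj) (e j)
        (dotProduct_perp (e i))
      rw [eval_linFormLam, he] at h3
      exact one_ne_zero h3
    · intro h2
      obtain ⟨j, hj', hj⟩ := (linFormX_prime (he i)).exists_mem_finset_dvd h2
      have h3 := eval_eq_zero_of_linFormX_dvd ((linFormX_prime (he i)).dvd_of_dvd_pow hj) 0
        (dotProduct_perp (e i))
      rw [eval_linFormX] at h3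
      exact hne i j (ne_of_mem_erase hj') h3
  obtain ⟨lam, lam', hlam⟩ := (hP i).exists_not_proportional (he i) hPZ hN hmi hne0
  obtain ⟨R, hR⟩ := hP i 1 le_rfl (by omega)
  rw [show 2 * 1 - 1 = 1 by rfl, pow_one, ← hv] at hR
  have hX : ∀ lam, lineSubst lam (perp v) v (linFormX v) = PowerSeries.X := fun lam => by
    simpa using lineSubst_linFormX_self (he i) lam 1
  have hodd : ∀ lam, ∀ Q, QuasiInvAlong v (m i) Q → OddVanish (2 * m i) (jet lam (perp v) v Q) :=
    fun lam Q hQ => by simpa using hQ.oddVanish lam 1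
  have hder : ∀ lam, PowerSeries.derivative ℂ (jet lam (perp v) v P) =
      PowerSeries.X * jet lam (perp v) v R := fun lam => by
    rw [derivative_jet, hR, jet_mul, hX]
  set B := lineSubst lam (perp v) v (prodX e m) with hB
  have hBB : ∀ lam', lineSubst lam' (perp v) v (prodX e m) = B :=
    fun lam' => lineSubst_eq_of_isWeightedHomogeneous hbL _ _ _ _
  have hB0 : B ≠ 0 := by
    rw [hB, prodX, map_prod]
    exact prod_ne_zero_iff.2 fun j _ => by
      rw [map_pow]; exact pow_ne_zero _ (lineSubst_linFormX_ne_zero he hne i j lam)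
  set W := lineSubst lam (perp v) v h with hW
  have hWW : ∀ lam', lineSubst lam' (perp v) v h = W :=
    fun lam' => lineSubst_eq_of_isWeightedHomogeneous hhL _ _ _ _
  -- The x-equation expanded at e_i⊥ in the direction e_i. The logarithmic derivatives of b extract
  -- a common factor b³, and W is the same for every λ because h and b involve x only.
  have hequation : ∀ lam, B ^ 3 *
      (PowerSeries.derivative ℂ (PowerSeries.derivative ℂ (jet lam (perp v) v P)) +
      jet lam (perp v) v (twX (perp v) (twX (perp v) P)) -
      PowerSeries.C (dotProduct lam lam) * jet lam (perp v) v P -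
      PowerSeries.C (2 * m i : ℂ) * jet lam (perp v) v R -
      PowerSeries.C 2 * (tangentCoeff e m i 1 * PowerSeries.derivative ℂ (jet lam (perp v) v P) +
        alongCoeff e m i 1 * jet lam (perp v) v (twX (perp v) P))) =
      W * jet lam (perp v) v P := by
    intro lam
    have h1 := congrArg (jet lam (perp v) v) hh
    have h2 : lineSubst lam (perp v) v (X (Sum.inl 0) ^ 2 + X (Sum.inl 1) ^ 2) =
        PowerSeries.C (dotProduct lam lam) := by
      simp [lineSubst, dotProduct, Fin.sum_univ_two]
      ring
    have h3 := lineSubst_dX_prodX (m := m) he hne i lam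
    have h4 := lineSubst_dX_perp_prodX (m := m) hne i lam
    have h5 : PowerSeries.C (2 : ℂ) = (2 : PowerSeries ℂ) := map_ofNat _ 2
    rw [jet_mul, jet_mul, hWW, gaugedOp_inr_eq (he i), map_sub, jet_mul, jet_mul, map_sub, map_add,
      map_add, jet_mul, jet_mul, jet_mul, h2, map_pow, map_mul, map_ofNat, hBB, ← hv] at h1
    rw [← hv, hBB] at h3 h4
    rw [h4, ← derivative_jet, ← derivative_jet, hder] at h1
    rw [map_mul, h5, hder, ← h1]
    linear_combination (2 * B ^ 2 * jet lam (perp v) v R) * h3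
  have hcc : ∀ lam, PowerSeries.constantCoeff (jet lam (perp v) v R) -
      PowerSeries.constantCoeff (jet lam (perp v) v (twX (perp v) P)) =
      eval (Sum.elim lam (perp v)) (twX v (twX v P) - twX (perp v) P) := by
    intro lam
    rw [map_sub, ← constantCoeff_jet lam _ v, ← constantCoeff_jet lam _ v, ← derivative_jet,
      ← derivative_jet, hder, Derivation.leibniz]
    simp
  refine (tangentCoeff_evenVanish_iff one_ne_zero i (m i)).1 ?_ r hr1 hr2
  refine EvenVanish.of_laplacian (κ := dotProduct lam lam) (μ := dotProduct lam' lam')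
    (p := jet lam (perp v) v P) (q := jet lam' (perp v) v P) (p₁ := jet lam (perp v) v R)
    (q₁ := jet lam' (perp v) v R) (b := alongCoeff e m i 1)
    (hodd lam P (hP i)) (hder lam) (hodd lam _ (hP i).twX_perp) (hodd lam _ (hP i).twX_perp.twX_perp)
    (hodd lam' P (hP i)) (hder lam') (hodd lam' _ (hP i).twX_perp)
    (hodd lam' _ (hP i).twX_perp.twX_perp)
    (by simpa only [map_one, one_mul] using alongCoeff_add (e := e) (m := m) one_ne_zero i) ?_ ?_
  -- Multiplying each equation by the solution for the other λ and subtracting eliminates W.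
  · apply mul_left_cancel₀ (pow_ne_zero 3 hB0)
    linear_combination jet lam' (perp v) v P * hequation lam - jet lam (perp v) v P * hequation lam'
  · rw [hcc, hcc, constantCoeff_jet, constantCoeff_jet]
    exact hlam

end Local

/-! ### Reduction of a general BA function to equal bidegrees. -/

section Projection

open MvPolynomial

variable {P : PolyLX} {N : ℕ}

/-- A monomial of weight zero has equal degrees in λ and x, each at most half of the total degree.
-/
theorem comp_wtX_comp_wtZ_eq_zero (hP : P.totalDegree ≤ 2 * N) {j : ℕ} (hj : N < j) :
    comp wtX j (comp wtZ 0 P) = 0 := by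
  classical
  ext d
  rw [coeff_weightedHomogeneousComponent, coeff_weightedHomogeneousComponent, coeff_zero]
  split_ifs with h1 h2
  · apply coeff_eq_zero_of_totalDegree_lt
    have h3 := degree_eq_weight d
    rw [weight_wtZ] at h2
    change _ < d.degree
    omega
  · rfl
  · rfl

theorem comp_wtX_comp_wtZ (P : PolyLX) (N : ℕ) :
    comp wtX N (comp wtZ 0 P) = comp wtZ 0 (homogeneousComponent (2 * N) P) := by
  classical
  ext d
  rw [coeff_weightedHomogeneousComponent, coeff_weightedHomogeneousComponent,
    coeff_weightedHomogeneousComponent, coeff_homogeneousComponent]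
  have h1 := degree_eq_weight d
  have h2 := weight_wtZ d
  split_ifs <;> first | rfl | omega

theorem highestTerm_smul {ι : Type*} [Fintype ι] (c : ι → ℂ) (e : ι → Fin 2 → ℂ) (m : ι → ℕ) :
    highestTerm (fun i => c i • e i) m =
      C (∏ i, c i ^ (2 * m i)) * (prodLam e m * prodX e m) := by
  rw [highestTerm, prodLam, prodX, map_prod, ← prod_mul_distrib, ← prod_mul_distrib]
  refine prod_congr rfl fun i _ => ?_
  have h1 : linFormLam (c i • e i) = C (c i) * linFormLam (e i) := by
    simp [linFormLam_apply]; ring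
  have h2 : linFormX (c i • e i) = C (c i) * linFormX (e i) := by
    simp [linFormX_apply]; ring
  rw [h1, h2, map_pow]
  ring

theorem twX_smul (c : ℂ) (v : Fin 2 → ℂ) : twX (c • v) = c • twX v := by
  simp [twX, smul_smul, smul_add]

/-- The polynomial factor of a Baker-Akhiezer function is quasi-invariant. -/
theorem quasiInvAlong_of_dirDeriv {e : Fin 2 → ℂ} (he : dotProduct e e = 1) {c : ℂ} (hc : c ≠ 0)
    {m : ℕ} (h : ∀ s : ℕ, 1 ≤ s → s ≤ m → ∀ lam x, dotProduct (c • e) x = 0 →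
      dirDeriv (c • e) (2 * s - 1)
        (fun x => eval (Sum.elim lam x) P * Complex.exp (dotProduct lam x)) x = 0) :
    QuasiInvAlong e m P := by
  intro s hs1 hs2
  apply linFormX_dvd_of_eval he
  intro lam r _
  have h1 := h s hs1 hs2 lam (r • perp e) (by
    rw [smul_dotProduct, dotProduct_smul, dotProduct_perp, smul_zero, smul_zero])
  rw [dirDeriv_mul_exp, twX_smul, smul_pow, LinearMap.smul_apply, smul_eval] at h1
  have h2 := (mul_eq_zero.1 h1).resolve_right (Complex.exp_ne_zero _)
  exact (mul_eq_zero.1 h2).resolve_left (pow_ne_zero _ hc)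

/-- A planar configuration that admits the Baker-Akhiezer function satisfies the cotangent
conditions. -/
theorem cotCondition_of_admitsBA {ι : Type*} [Fintype ι] {m : ι → ℕ} {c φ : ι → ℂ}
    (hc : ∀ i, c i ≠ 0) (hφ : ∀ i j, i ≠ j → Complex.sin (φ j - φ i) ≠ 0)
    (h : AdmitsBA (fun i => c i • unitVec (φ i)) m) : CotCondition m φ := by
  classical
  obtain ⟨Φ, ⟨P, hdeg, htop, hΦ⟩, hvan⟩ := h
  have he := fun i => dotProduct_unitVec_self (φ i)
  have hΦ' : ∀ lam, Φ lam =
      fun x => eval (Sum.elim lam x) P * Complex.exp (dotProduct lam x) :=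
    fun lam => funext fun x => hΦ lam x
  have hP : ∀ i, QuasiInvAlong (unitVec (φ i)) (m i) P := fun i =>
    quasiInvAlong_of_dirDeriv (he i) (hc i) fun s hs1 hs2 lam x hx => by
      rw [← hΦ']; exact hvan i s hs1 hs2 lam x hx
  set κ := ∏ i, c i ^ (2 * m i) with hκ
  have hκ0 : κ ≠ 0 := prod_ne_zero_iff.2 fun i _ => pow_ne_zero _ (hc i)
  have hZ : (prodLam (fun i => unitVec (φ i)) m * prodX (fun i => unitVec (φ i)) m
      ).IsWeightedHomogeneous wtZ 0 := by
    simpa using isWeightedHomogeneous_wtZ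
      ((prodLam_isWeightedHomogeneous_wtL (m := m)).mul (prodX_isWeightedHomogeneous_wtL (m := m)))
      ((prodLam_isWeightedHomogeneous (m := m)).mul (prodX_isWeightedHomogeneous (m := m)))
  intro i r hr1 hr2
  -- The factor κ⁻¹ undoes the rescaling of the highest term caused by passing to unit vectors.
  -- Projection to weight zero keeps quasi-invariance, and also the highest term, which itself has
  -- weight zero.
  have := slope_sum_eq_zero (e := fun i => unitVec (φ i)) (m := m) (P := comp wtZ 0 (κ⁻¹ • P)) he
    (fun i j hij => by rw [dotProduct_unitVec_perp]; exact hφ i j hij.symm)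
    (fun i => ((hP i).smul κ⁻¹).comp_wtZ 0)
    (weightedHomogeneousComponent_isWeightedHomogeneous 0 _)
    (fun j hj => comp_wtX_comp_wtZ_eq_zero ((totalDegree_smul_le _ _).trans hdeg) hj)
    (by
      rw [comp_wtX_comp_wtZ, map_smul, htop, highestTerm_smul, ← hκ, smul_eq_C_mul, ← mul_assoc,
        ← C_mul, inv_mul_cancel₀ hκ0, C_1, one_mul]
      exact hZ.weightedHomogeneousComponent_same) i hr1 hr2
  simpa only [slope_unitVec] using this

end Projection

end BakerAkhiezer

theorem proposition3p3 {ι : Type*} [Fintype ι] (α : ι → Fin 2 → ℂ) (m : ι → ℕ)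
    (hα : BakerAkhiezer.IsConfiguration α)
    (c φ : ι → ℂ) (hφ : ∀ i, α i = c i • BakerAkhiezer.unitVec (φ i))
    (hBA : BakerAkhiezer.AdmitsBA α m) (q : ℕ) (hq : 1 ≤ q) :
    BakerAkhiezer.IsConfiguration (BakerAkhiezer.Tvec q φ) ∧
      BakerAkhiezer.AdmitsBA (BakerAkhiezer.Tvec q φ) (BakerAkhiezer.Tmult q m) := by
  obtain rfl : α = fun i => c i • BakerAkhiezer.unitVec (φ i) := funext hφ
  have hc : ∀ i, c i ≠ 0 := fun i h0 => hα.nonisotropic i (by simp [h0])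
  have hsin : ∀ i j, i ≠ j → Complex.sin (φ j - φ i) ≠ 0 := by
    intro i j hij
    rw [← BakerAkhiezer.linearIndependent_unitVec_iff, LinearIndependent.pair_iff]
    intro s t hst
    have h1 := LinearIndependent.pair_iff.1 (hα.noncollinear i j hij) (s / c i) (t / c j) (by
      rw [smul_smul, smul_smul, div_mul_cancel₀ _ (hc i), div_mul_cancel₀ _ (hc j), hst])
    exact ⟨(div_eq_zero_iff.1 h1.1).resolve_right (hc i),
      (div_eq_zero_iff.1 h1.2).resolve_right (hc j)⟩
  have hcot := (BakerAkhiezer.cotCondition_of_admitsBA hc hsin hBA).cover hsin hq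
  have hT : BakerAkhiezer.Tvec q φ =
    fun p => BakerAkhiezer.unitVec (BakerAkhiezer.coverAngle q φ p) := rfl
  rw [hT]
  refine ⟨⟨fun p => ?_, fun a b hab => ?_⟩, ?_⟩
  · rw [BakerAkhiezer.dotProduct_unitVec_self]
    exact one_ne_zero
  · rw [BakerAkhiezer.linearIndependent_unitVec_iff]
    exact BakerAkhiezer.sin_coverAngle_sub_ne_zero hsin hq a b hab
  · exact hcot.admitsBA fun a b hab => BakerAkhiezer.sin_coverAngle_sub_ne_zero hsin hq a b hab
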